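/- **Setting.** Let $p,q,q_1$ be fixed with $q_1>1$, and let $k_0,m\ge 0$ be fixed integers. Let $(\mathbf Y_t)_{t\in\mathbb Z}$ be a $p\times q$ matrix-valued time series whose vectorization is weakly stationary. For random $p\times q$ matrices put $\mathrm{Cov}_r(\mathbf U,\mathbf V)=\frac1pE(\mathbf U-E\mathbf U)^{T}(\mathbf V-E\mathbf V)$. Suppose $\mathbf Y_t=\mathbf X_t\mathbf A^{T}$ with $\mathbf A$ a constant $q\times q$ matrix, $\mathrm{Cov}_r(\mathbf Y_t,\mathbf Y_t)=\mathrm{Cov}_r(\mathbf X_t,\mathbf X_t)=\mathbf I_q$, where the columns of $\mathbf X_t$ are divided into $q_1$ non-empty groups $\mathbf X_t^{(1)},\dots,\mathbf X_t^{(q_1)}$ (of $l_1,\dots,l_{q_1}$ columns) with $\mathrm{Cov}_r(\mathbf X^{(i)}_t,\mathbf X^{(j)}_s)=\mathbf 0$ for all $t,s$ and $i\ne j$; let $\mathbf A_1,\dots,\mathbf A_{q_1}$ be the corresponding groups of columns of $\mathbf A$. Let $\boldsymbol\Sigma_y(k)=\mathrm{Cov}_r(\mathbf Y_{t+k},\mathbf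 Y_t)$, $\mathbf W_y=\sum_{k=0}^{k_0}\boldsymbol\Sigma_y(k)\boldsymbol\Sigma_y(k)^{T}$, define $\mathbf W_x$ in the same way from $\mathbf X_t$, and let $\mathbf W_{x,1},\dots,\mathbf W_{x,q_1}$ be its diagonal blocks. Let $\boldsymbol\Sigma_{y,k,l}(h)$ be the $q\times q$ covariance matrix of the $k$-th row of $\mathbf Y_{t+h}$ and the $l$-th row of $\mathbf Y_t$. **Assumptions.** For some $\gamma>2$ and $K_1$, $E|y_{ij}^t-Ey_{ij}^t|^{2\gamma}\le K_1$ for all $i,j,t$; the $\alpha$-mixing coefficients of $(\mathbf Y_t)$ satisfy $\sum_{k\ge1}\alpha(k)^{1-2/\gamma}<\infty$; and the gap $\varpi=\min_{i<j}\min\{|\lambda-\mu|:\lambda\in\sigma(\mathbf W_{x,i}),\mu\in\sigma(\mathbf W_{x,j})\}$ is positive. **Estimators.** From $\mathbf Y_1,\dots,\mathbf Y_n$ with mean $\bar{\mathbf Y}$ let $\hat{\boldsymbol\Sigma}_y(k)=\frac1{np}\sum_{t=1}^{n-k}(\mathbf Y_{t+k}-\bar{\mathbf Y})^{T}(\mathbf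 Y_t-\bar{\mathbf Y})$, $\hat{\mathbf S}=\mathbf I_q+\sum_{k=1}^{k_0}\hat{\boldsymbol\Sigma}_y(k)\hat{\boldsymbol\Sigma}_y(k)^{T}$, and let $\hat{\boldsymbol\Gamma}=(\hat{\mathbf v}_1,\dots,\hat{\mathbf v}_q)$ be any orthogonal matrix of eigenvectors of $\hat{\mathbf S}$. Let $\hat{\boldsymbol\Sigma}_{y,k,l}(h)=\frac1n\sum_t(\mathbf y_{k:}^{t+h}-\bar{\mathbf y}_{k:})^{T}(\mathbf y_{l:}^{t}-\bar{\mathbf y}_{l:})$, the sum over $1\le t,t+h\le n$, where $\mathbf y_{k:}^t$ is the $k$-th row of $\mathbf Y_t$, and for $i<j$ let $\hat L(i,j)$ be the largest value, over $|h|\le m$ and $1\le k,l\le p$, of $|\hat{\mathbf v}_i^{T}\hat{\boldsymbol\Sigma}_{y,k,l}(h)\hat{\mathbf v}_j|\,/\,\big(\hat{\mathbf v}_i^{T}\hat{\boldsymbol\Sigma}_{y,k,k}(0)\hat{\mathbf v}_i\;\hat{\mathbf v}_j^{T}\hat{\boldsymbol\Sigma}_{y,l,l}(0)\hat{\mathbf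 v}_j\big)^{1/2}$. With $q_0=q(q-1)/2$, $\hat L_1\ge\dots\ge\hat L_{q_0}$ the ordered values, $C>0$ any constant and $\delta_n=n^{-1/2}$, let $\hat d$ be a maximizer of $(\hat L_j+C\delta_n)/(\hat L_{j+1}+C\delta_n)$ over $1\le j<q_0$, and let $\hat E$ consist of $\hat d$ pairs with the largest values of $\hat L$ (ties broken arbitrarily). **True graph.** For an orthogonal matrix $\boldsymbol\Gamma$ of eigenvectors of $\mathbf W_y$ and $(\mathbf z_1^t,\dots,\mathbf z_q^t)=\mathbf Y_t\boldsymbol\Gamma$, let $L(i,j)$ be the maximum over $|h|\le m$ and all entries of $|\mathrm{Corr}(\mathbf z_i^{t+h},\mathbf z_j^t)|$, let $L_1\ge\dots\ge L_{q_0}$ be the ordered values, $E=\{(i,j):i<j,\ L(i,j)>0\}$, $d=|E|$ and $\chi=\max_{1\le j<d}L_j/L_{j+1}$ (set to $0$ if $d\le1$). **Theorem 1.** (i) Suppose that $\mathbf v^{T}\boldsymbol\Sigma_{y,k,k}(0)\mathbf v>0$ for every eigenvector $\mathbf v$ of $\mathbf W_y$ and every $k$ (so that all the correlations are defined). - *General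 case.* Let $\boldsymbol\Gamma=\boldsymbol\Gamma_n$ be an orthogonal eigenvector matrix $(\mathbf v_1,\dots,\mathbf v_q)$ of $\mathbf W_y$ that is columnwise closest, up to signs, to $\hat{\boldsymbol\Gamma}$, i.e. that maximizes $\sum_i|\hat{\mathbf v}_i^{T}\mathbf v_i|$ among all such matrices, and let $E=E_n$, $d=d_n$, $\chi=\chi_n$ be formed from it (they may be random). If $P(0<d_n<q_0)\to1$ and there are constants $\epsilon_n>0$ with $n\epsilon_n^2\to\infty$, $P(\min_{(i,j)\in E_n}L(i,j)\ge\epsilon_n)\to1$ and $\chi_n/\epsilon_n=o_p(n^{1/2})$, then $P(\hat E=E_n)\to1$. - *Distinct eigenvalues.* If the eigenvalues of $\mathbf W_y$ are distinct, the columns of a fixed $\boldsymbol\Gamma$ are ordered by decreasing eigenvalues, those of $\hat{\boldsymbol\Gamma}$ likewise, and $0<d<q_0$, then $P(\hat E=E)\to1$ for the nonrandom graph $E$ of $\boldsymbol\Gamma$. (ii) There is a permutation (depending on the sample) of the columns of $\hat{\boldsymbol\Gamma}$ which gives $\hat{\mathbf A}=(\hat{\mathbf A}_1,\dots,\hat{\mathbf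 A}_{q_1})$, with $\hat{\mathbf A}_j$ of size $q\times l_j$, such that $$\max_{1\le j\le q_1}D(\mathcal M(\hat{\mathbf A}_j),\mathcal M(\mathbf A_j))=O_p(n^{-1/2}),$$ where $\mathcal M(\cdot)$ is the column space and $D(\mathcal M(\mathbf H_1),\mathcal M(\mathbf H_2))=\sqrt{1-\mathrm{tr}(\mathbf P_1\mathbf P_2)/\min(r_1,r_2)}$ for matrices $\mathbf H_i$ of full column rank $r_i$, with $\mathbf P_i=\mathbf H_i(\mathbf H_i^{T}\mathbf H_i)^{-1}\mathbf H_i^{T}$. -/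

import Mathlib

noncomputable section

namespace MatSeg

open MeasureTheory ProbabilityTheory Filter Topology Matrix

/-! ### Population quantities of a matrix-valued time series -/

section Population

variable {Ω : Type*} [MeasurableSpace Ω] {p q : ℕ}

/-- Entrywise expectation of a random matrix. -/
def meanMat (μ : Measure Ω) (U : Ω → Matrix (Fin p) (Fin q) ℝ) : Matrix (Fin p) (Fin q) ℝ :=
  Matrix.of fun i a => ∫ ω, U ω i a ∂μ

/-- The covariance matrix over the rows, `p⁻¹ E (U - EU)ᵀ (V - EV)`. -/
def covR (μ : Measure Ω) (U V : Ω → Matrix (Fin p) (Fin q) ℝ) : Matrix (Fin q) (Fin q) ℝ :=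
  Matrix.of fun a b =>
    (p : ℝ)⁻¹ * ∫ ω, ((U ω - meanMat μ U)ᵀ * (V ω - meanMat μ V)) a b ∂μ

/-- `Σ_y(k) = Cov_r(Y_{t+k}, Y_t)`, evaluated at `t = 0` (the series is weakly stationary). -/
def autocov (μ : Measure Ω) (Y : ℤ → Ω → Matrix (Fin p) (Fin q) ℝ) (k : ℤ) :
    Matrix (Fin q) (Fin q) ℝ :=
  covR μ (Y k) (Y 0)

/-- `Σ_{y,i,j}(h)`, the covariance matrix of the `i`-th row at time `t + h` and the `j`-th row at
time `t`, evaluated at `t = 0`. -/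
def rowAutocov (μ : Measure Ω) (Y : ℤ → Ω → Matrix (Fin p) (Fin q) ℝ) (i j : Fin p) (h : ℤ) :
    Matrix (Fin q) (Fin q) ℝ :=
  Matrix.of fun a b => cov[fun ω => Y h ω i a, fun ω => Y 0 ω j b; μ]

/-- `W = ∑_{k=0}^{k₀} Σ(k) Σ(k)ᵀ`. -/
def wMat (μ : Measure Ω) (Y : ℤ → Ω → Matrix (Fin p) (Fin q) ℝ) (k₀ : ℕ) :
    Matrix (Fin q) (Fin q) ℝ :=
  ∑ k ∈ Finset.range (k₀ + 1), autocov μ Y k * (autocov μ Y k)ᵀ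

/-- Weak stationarity of the vectorized series: the means and all the autocovariances of the
entries do not vary with time. -/
def WeaklyStationary (μ : Measure Ω) (Y : ℤ → Ω → Matrix (Fin p) (Fin q) ℝ) : Prop :=
  (∀ t, meanMat μ (Y t) = meanMat μ (Y 0)) ∧
    ∀ (t k : ℤ) (i j : Fin p) (a b : Fin q),
      cov[fun ω => Y (t + k) ω i a, fun ω => Y t ω j b; μ] =
        cov[fun ω => Y k ω i a, fun ω => Y 0 ω j b; μ]

/-- `sup_t max_{i,j} E |y_{ij}^t - μ_{ij}|^{2γ} ≤ K₁`, the expectations being finite. -/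
def MomentBound (μ : Measure Ω) (Y : ℤ → Ω → Matrix (Fin p) (Fin q) ℝ) (γ K₁ : ℝ) : Prop :=
  ∀ (t : ℤ) (i : Fin p) (a : Fin q),
    Integrable (fun ω => |Y t ω i a - meanMat μ (Y t) i a| ^ (2 * γ)) μ ∧
      ∫ ω, |Y t ω i a - meanMat μ (Y t) i a| ^ (2 * γ) ∂μ ≤ K₁

/-- The σ-algebra generated by the entries of `Y_t`, `t ∈ T`. -/
@[reducible] def sigmaAlg (Y : ℤ → Ω → Matrix (Fin p) (Fin q) ℝ) (T : Set ℤ) : MeasurableSpace Ω :=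
  ⨆ t ∈ T, ⨆ i : Fin p, ⨆ a : Fin q,
    MeasurableSpace.comap (fun ω => Y t ω i a) (inferInstance : MeasurableSpace ℝ)

/-- The `α`-mixing coefficient at lag `k`. -/
def alphaMix (μ : Measure Ω) (Y : ℤ → Ω → Matrix (Fin p) (Fin q) ℝ) (k : ℕ) : ℝ :=
  sSup {x : ℝ | ∃ (i : ℤ) (A B : Set Ω),
    MeasurableSet[sigmaAlg Y (Set.Iic i)] A ∧ MeasurableSet[sigmaAlg Y (Set.Ici (i + k))] B ∧
      x = |μ.real (A ∩ B) - μ.real A * μ.real B|}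

/-- The blocks of columns: column `c` belongs to the block `g c`. -/
abbrev Block {q₁ : ℕ} (g : Fin q → Fin q₁) (j : Fin q₁) : Type := {c : Fin q // g c = j}

/-- The columns of `M` that belong to block `j`. -/
def colBlock {q₁ : ℕ} (g : Fin q → Fin q₁) (M : Matrix (Fin q) (Fin q) ℝ) (j : Fin q₁) :
    Matrix (Fin q) (Block g j) ℝ :=
  M.submatrix id Subtype.val

/-- The `j`-th diagonal block of `M`. -/
def diagBlock {q₁ : ℕ} (g : Fin q → Fin q₁) (M : Matrix (Fin q) (Fin q) ℝ) (j : Fin q₁) :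
    Matrix (Block g j) (Block g j) ℝ :=
  M.submatrix Subtype.val Subtype.val

/-- The model: `Y_t = X_t Aᵀ`, both series standardized, and different column groups of the latent
series `X` uncorrelated at all times. -/
structure Segmented {q₁ : ℕ} (μ : Measure Ω) (Y X : ℤ → Ω → Matrix (Fin p) (Fin q) ℝ)
    (A : Matrix (Fin q) (Fin q) ℝ) (g : Fin q → Fin q₁) : Prop where
  eq : ∀ t ω, Y t ω = X t ω * Aᵀ
  var_Y : covR μ (Y 0) (Y 0) = 1
  var_X : covR μ (X 0) (X 0) = 1
  uncorrelated : ∀ (t s : ℤ) (a b : Fin q), g a ≠ g b → covR μ (X t) (X s) a b = 0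

/-- The gap between the spectra of different diagonal blocks of `W`. -/
def eigenGap {q₁ : ℕ} (g : Fin q → Fin q₁) (W : Matrix (Fin q) (Fin q) ℝ) : ℝ :=
  sInf {x : ℝ | ∃ i j : Fin q₁, i < j ∧
    ∃ l ∈ spectrum ℝ (diagBlock g W i), ∃ u ∈ spectrum ℝ (diagBlock g W j), x = |l - u|}

/-- Correlation of the columns `i` and `j` of `Z_t = Y_t V`: the `(k,l)` entry is
`Corr(z_{k,i}^{t+h}, z_{l,j}^t)`, evaluated at `t = 0`. -/
def popCorr (μ : Measure Ω) (Y : ℤ → Ω → Matrix (Fin p) (Fin q) ℝ)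
    (V : Matrix (Fin q) (Fin q) ℝ) (i j : Fin q) (h : ℤ) : Matrix (Fin p) (Fin p) ℝ :=
  Matrix.of fun k l =>
    cov[fun ω => (Y h ω * V) k i, fun ω => (Y 0 ω * V) l j; μ] /
      (√(Var[fun ω => (Y h ω * V) k i; μ]) * √(Var[fun ω => (Y 0 ω * V) l j; μ]))

end Population

/-! ### Sample quantities -/

section Sample

variable {Ω : Type*} {p q : ℕ}

/-- `Ȳ = n⁻¹ ∑_{t=1}^n Y_t`. -/
def sampleMean (Y : ℤ → Ω → Matrix (Fin p) (Fin q) ℝ) (n : ℕ) (ω : Ω) :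
    Matrix (Fin p) (Fin q) ℝ :=
  (n : ℝ)⁻¹ • ∑ t ∈ Finset.Icc (1 : ℤ) n, Y t ω

/-- `Σ̂_y(k) = (np)⁻¹ ∑_{t=1}^{n-k} (Y_{t+k} - Ȳ)ᵀ (Y_t - Ȳ)`. -/
def sampleAutocov (Y : ℤ → Ω → Matrix (Fin p) (Fin q) ℝ) (n : ℕ) (k : ℤ) (ω : Ω) :
    Matrix (Fin q) (Fin q) ℝ :=
  ((n : ℝ) * p)⁻¹ • ∑ t ∈ Finset.Icc (1 : ℤ) (n - k),
    (Y (t + k) ω - sampleMean Y n ω)ᵀ * (Y t ω - sampleMean Y n ω)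

/-- `Σ̂_{y,i,j}(h) = n⁻¹ ∑_t (y_{i:}^{t+h} - ȳ_{i:})ᵀ (y_{j:}^t - ȳ_{j:})`, the sum over all `t` for
which both `t` and `t + h` are observation times (so `t = 1, …, n - h` if `h ≥ 0`). -/
def sampleRowAutocov (Y : ℤ → Ω → Matrix (Fin p) (Fin q) ℝ) (n : ℕ) (i j : Fin p) (h : ℤ)
    (ω : Ω) : Matrix (Fin q) (Fin q) ℝ :=
  (n : ℝ)⁻¹ • ∑ t ∈ (Finset.Icc (1 : ℤ) n).filter (fun t => t + h ∈ Finset.Icc (1 : ℤ) n),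
    Matrix.vecMulVec ((Y (t + h) ω - sampleMean Y n ω) i) ((Y t ω - sampleMean Y n ω) j)

/-- `Ŝ = I + ∑_{k=1}^{k₀} Σ̂_y(k) Σ̂_y(k)ᵀ`. -/
def sHat (Y : ℤ → Ω → Matrix (Fin p) (Fin q) ℝ) (k₀ n : ℕ) (ω : Ω) :
    Matrix (Fin q) (Fin q) ℝ :=
  1 + ∑ k ∈ Finset.Icc 1 k₀, sampleAutocov Y n k ω * (sampleAutocov Y n k ω)ᵀ

/-- `v_iᵀ Σ̂_{y,k,l}(h) v_j`, where `v_i` is the `i`-th column of `V`. -/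
def sampleDelta (Y : ℤ → Ω → Matrix (Fin p) (Fin q) ℝ) (n : ℕ) (V : Matrix (Fin q) (Fin q) ℝ)
    (i j : Fin q) (k l : Fin p) (h : ℤ) (ω : Ω) : ℝ :=
  V.col i ⬝ᵥ (sampleRowAutocov Y n k l h ω *ᵥ V.col j)

/-- Sample correlation matrix at lag `h` of the columns `i` and `j` of `Y_t V`. -/
def sampleCorr (Y : ℤ → Ω → Matrix (Fin p) (Fin q) ℝ) (n : ℕ) (V : Matrix (Fin q) (Fin q) ℝ)
    (i j : Fin q) (h : ℤ) (ω : Ω) : Matrix (Fin p) (Fin p) ℝ :=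
  Matrix.of fun k l =>
    sampleDelta Y n V i j k l h ω /
      (√(sampleDelta Y n V i i k k 0 ω) * √(sampleDelta Y n V j j l l 0 ω))

end Sample

/-! ### Eigenvector matrices and the distance between column spaces -/

section LinearAlgebra

variable {q : ℕ}

/-- The columns of `V` are orthonormal eigenvectors of `M`. -/
def IsEigenbasis (M V : Matrix (Fin q) (Fin q) ℝ) : Prop :=
  Vᵀ * V = 1 ∧ (Vᵀ * M * V).IsDiag

/-- The eigenvalue that belongs to column `i` of the eigenvector matrix `V` of `M`. -/
def eigenvalueOf (M V : Matrix (Fin q) (Fin q) ℝ) (i : Fin q) : ℝ :=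
  (Vᵀ * M * V) i i

/-- `V` is an orthonormal eigenvector matrix of `M` which, among all such matrices, is columnwise
closest to `U` up to signs: for orthogonal `U`, `V` this is the minimality of
`∑ᵢ min(‖uᵢ - vᵢ‖², ‖uᵢ + vᵢ‖²) = ∑ᵢ (2 - 2 |uᵢ ⬝ vᵢ|)`. -/
def IsClosestEigenbasis (M U V : Matrix (Fin q) (Fin q) ℝ) : Prop :=
  IsEigenbasis M V ∧ ∀ V', IsEigenbasis M V' →
    ∑ i, |U.col i ⬝ᵥ V'.col i| ≤ ∑ i, |U.col i ⬝ᵥ V.col i|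

variable {ι κ : Type*} [Fintype ι] [Fintype κ] [DecidableEq ι] [DecidableEq κ]

/-- Orthogonal projection `H (Hᵀ H)⁻¹ Hᵀ` onto the column space of a matrix of full column rank. -/
def colProj (H : Matrix (Fin q) ι ℝ) : Matrix (Fin q) (Fin q) ℝ :=
  H * (Hᵀ * H)⁻¹ * Hᵀ

/-- `D(M(H₁), M(H₂)) = √(1 - tr(P₁ P₂) / min(r₁, r₂))`. -/
def spaceDist (H₁ : Matrix (Fin q) ι ℝ) (H₂ : Matrix (Fin q) κ ℝ) : ℝ :=
  √(1 - (colProj H₁ * colProj H₂).trace / (min (Fintype.card ι) (Fintype.card κ) : ℕ))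

end LinearAlgebra

/-! ### The connection graph and the ratio-based rule -/

section Graph

variable {p q : ℕ}

/-- The unordered pairs of distinct columns. -/
abbrev Pair (q : ℕ) : Type := {e : Fin q × Fin q // e.1 < e.2}

/-- `max_{|h| ≤ m} |G(h)|_∞`. -/
def maxCorr (m : ℕ) (G : ℤ → Matrix (Fin p) (Fin p) ℝ) : ℝ :=
  ⨆ x : (Finset.Icc (-(m : ℤ)) m : Finset ℤ) × Fin p × Fin p, |G x.1 x.2.1 x.2.2|

/-- The `j`-th largest of the values `L e`, `1 ≤ j ≤ q(q-1)/2`. -/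
def ordStat (L : Pair q → ℝ) (j : ℕ) : ℝ :=
  (((Finset.univ : Finset (Pair q)).val.map L).sort (· ≥ ·)).getD (j - 1) 0

/-- The edge set `{e : L e > 0}`. -/
def edges (L : Pair q → ℝ) : Finset (Pair q) :=
  Finset.univ.filter fun e => 0 < L e

/-- `χ = max_{1 ≤ j < d} L_j / L_{j+1}` with `d` the number of edges (`0` if `d ≤ 1`). -/
def chi (L : Pair q → ℝ) : ℝ :=
  sSup ((fun j : ℕ => ordStat L j / ordStat L (j + 1)) '' Set.Ico 1 (edges L).card)

/-- `d` maximizes `(L_j + c) / (L_{j+1} + c)` over `1 ≤ j < q₀ = q(q-1)/2`. -/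
def IsRatioArgmax (L : Pair q → ℝ) (c : ℝ) (d : ℕ) : Prop :=
  d ∈ Set.Ico 1 (q * (q - 1) / 2) ∧
    ∀ j ∈ Set.Ico 1 (q * (q - 1) / 2),
      (ordStat L j + c) / (ordStat L (j + 1) + c) ≤ (ordStat L d + c) / (ordStat L (d + 1) + c)

/-- `F` consists of `d` pairs with the largest values of `L`, with `d` chosen by the ratio rule. -/
def IsRatioGraph (L : Pair q → ℝ) (c : ℝ) (F : Finset (Pair q)) : Prop :=
  IsRatioArgmax L c F.card ∧ ∀ e ∈ F, ∀ e' ∉ F, L e' ≤ L e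

variable {Ω : Type*} [MeasurableSpace Ω]

/-- The true maximum cross correlation of the columns of `Z_t = Y_t V`. -/
def popMaxCorr (μ : Measure Ω) (Y : ℤ → Ω → Matrix (Fin p) (Fin q) ℝ) (m : ℕ)
    (V : Matrix (Fin q) (Fin q) ℝ) (e : Pair q) : ℝ :=
  maxCorr m (popCorr μ Y V e.1.1 e.1.2)

/-- The sample maximum cross correlation of the columns of `Y_t V`. -/
def sampleMaxCorr {Ω : Type*} (Y : ℤ → Ω → Matrix (Fin p) (Fin q) ℝ) (m n : ℕ)
    (V : Matrix (Fin q) (Fin q) ℝ) (ω : Ω) (e : Pair q) : ℝ :=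
  maxCorr m fun h => sampleCorr Y n V e.1.1 e.1.2 h ω

end Graph

/-! ### Stochastic orders; for sets that need not be measurable, `μ` is the outer measure -/

section Orders

variable {Ω : Type*} [MeasurableSpace Ω]

/-- The probability of the event `S n` tends to `1` (its complement has outer measure tending
to `0`). -/
def WithProbTendingToOne (μ : Measure Ω) (S : ℕ → Ω → Prop) : Prop :=
  Tendsto (fun n => μ {ω | ¬ S n ω}) atTop (𝓝 0)

/-- `ξ n = O_p(r n)`. -/
def IsBigOp (μ : Measure Ω) (ξ : ℕ → Ω → ℝ) (r : ℕ → ℝ) : Prop :=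
  ∀ η : ENNReal, 0 < η → ∃ M : ℝ, ∀ᶠ n in atTop, μ {ω | M * r n < |ξ n ω|} ≤ η

/-- `ξ n = o_p(r n)`. -/
def IsLittleOp (μ : Measure Ω) (ξ : ℕ → Ω → ℝ) (r : ℕ → ℝ) : Prop :=
  ∀ η : ℝ, 0 < η → Tendsto (fun n => μ {ω | η * r n < |ξ n ω|}) atTop (𝓝 0)

end Orders

end MatSeg

end

open MeasureTheory ProbabilityTheory Filter Topology Matrix MatSeg

/-!
The sample row autocovariances are `√n`-consistent, and everything else is deterministic
perturbation theory on top of that.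

*Rate.* Davydov's inequality `abs_cov_le_of_moments` bounds covariances of functionals of the series
with moments of order `γ > 2` by `α ^ (1 - 2/γ)`; it follows from the layer-cake formula for bounded
variables and a truncation. As the mixing coefficients are summable with this power, partial sums
of the centered entries and of their products have variance `O(n)` (`exists_variance_sum_le`), so
that the sum `autocovError` of the absolute errors of all sample autocovariances up to a fixed lag
is `O_p(n^{-1/2})` (`isBigOp_autocovError`). The entries of `Ŝ - W_y` are of the same order.

*Eigenvectors.* An eigenvector of `Ŝ` satisfies the eigenvalue equation of `W_y` up to an error of
the order `‖Ŝ - W_y‖`, hence is that close to the eigenspace of `W_y` whose eigenvalue is nearest.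
Orthonormalizing the projections without leaving the eigenspaces gives an exact eigenvector
matrix of `W_y` at a distance of the same order (`exists_isEigenbasis_near`). No eigenvalues of the
two matrices have to be matched for this. The columnwise closest eigenvector matrix is then equally
close up to signs (`IsClosestEigenbasis.signClose`), and if the eigenvalues are distinct, it is the
ordered one, again up to signs (`exists_signClose_of_strictAnti`).

*Column spaces.* `A` is orthogonal and `Aᵀ W_y A = W_x` is block diagonal. Since the spectra of the
blocks are disjoint, an exact eigenvector of `W_y` has its coordinates with respect to the columns
of `A` in a single block, and counting the eigenvectors in each block gives the permutation
(`exists_perm_of_blockDiagonal`); the distance of the column spaces is then read off from the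
remaining small coordinates (`spaceDist_colBlock_le`).

*Graph.* The variances of the transformed series are bounded below over the compact set of unit
eigenvectors of `W_y`, so the sample maximum correlations are Lipschitz functions of the errors
(`exists_abs_sampleMaxCorr_sub_le`), with absolute values removing the signs. If all of them are
accurate to `O(n^{-1/2})`, the ratio at the true number of edges is at least of the order `√n ε`,
the ratios beyond it are bounded, and those before it are at most of the order of `chi`; the rule
therefore finds the true number of edges, and the largest values are at the true edges
(`IsRatioGraph.eq_edges`).
-/

noncomputable section

namespace MatSeg

/-! ### Covariance inequalities under strong mixing -/

section Mixing

variable {Ω : Type*}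

/-- If two finite measures almost agree on the upper level sets of a bounded function, then they
give it almost the same integral (layer-cake formula). -/
lemma abs_integral_sub_le_of_levelSets [MeasurableSpace Ω] (ν₁ ν₂ : Measure Ω) [IsFiniteMeasure ν₁]
    [IsFiniteMeasure ν₂] {W : Ω → ℝ} (hW : Measurable W) {M a : ℝ} (hM : 0 ≤ M)
    (h0 : ∀ ω, 0 ≤ W ω) (h1 : ∀ ω, W ω ≤ M)
    (h : ∀ t, |ν₁.real {ω | t ≤ W ω} - ν₂.real {ω | t ≤ W ω}| ≤ a) :
    |∫ ω, W ω ∂ν₁ - ∫ ω, W ω ∂ν₂| ≤ M * a := by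
  have hint : ∀ ν : Measure Ω, IsFiniteMeasure ν → Integrable W ν := fun ν _ =>
    Integrable.of_bound hW.aestronglyMeasurable M
      (ae_of_all _ fun ω => by rw [Real.norm_eq_abs, abs_of_nonneg (h0 ω)]; exact h1 ω)
  have hlc : ∀ ν : Measure Ω, IsFiniteMeasure ν →
      ∫ ω, W ω ∂ν = ∫ t in Set.Ioc 0 M, ν.real {ω | t ≤ W ω} := fun ν hν =>
    (hint ν hν).integral_eq_integral_Ioc_meas_le (ae_of_all _ h0) (ae_of_all _ h1)
  have hmono : ∀ ν : Measure Ω, IsFiniteMeasure ν →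
      IntegrableOn (fun t => ν.real {ω | t ≤ W ω}) (Set.Ioc 0 M) := by
    intro ν hν
    refine (AntitoneOn.integrableOn_isCompact (isCompact_Icc (a := 0) (b := M)) ?_).mono_set
      Set.Ioc_subset_Icc_self
    intro s _ t _ hst
    exact measureReal_mono (fun ω hω => le_trans hst hω)
  rw [hlc ν₁ inferInstance, hlc ν₂ inferInstance,
    ← integral_sub (hmono ν₁ inferInstance) (hmono ν₂ inferInstance)]
  have := norm_setIntegral_le_of_norm_le_const (μ := volume) (s := Set.Ioc (0 : ℝ) M) (C := a)
    (f := fun t => ν₁.real {ω | t ≤ W ω} - ν₂.real {ω | t ≤ W ω}) (by simp)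
    (fun t _ => by rw [Real.norm_eq_abs]; exact h t)
  simpa [hM, mul_comm] using this

/-- Covariance inequality for bounded nonnegative variables under strong mixing. -/
lemma abs_integral_mul_sub_le_of_nonneg {F G : MeasurableSpace Ω} [mΩ : MeasurableSpace Ω]
    (μ : Measure Ω) [IsProbabilityMeasure μ] (hF : F ≤ mΩ) (hG : G ≤ mΩ) {a : ℝ}
    (hmix : ∀ A B : Set Ω, MeasurableSet[F] A → MeasurableSet[G] B →
      |μ.real (A ∩ B) - μ.real A * μ.real B| ≤ a)
    {U V : Ω → ℝ} (hU : Measurable[F] U) (hV : Measurable[G] V) {M : ℝ} (hM : 0 ≤ M)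
    (hU0 : ∀ ω, 0 ≤ U ω) (hUM : ∀ ω, U ω ≤ M) (hV0 : ∀ ω, 0 ≤ V ω) (hVM : ∀ ω, V ω ≤ M) :
    |∫ ω, U ω * V ω ∂μ - (∫ ω, U ω ∂μ) * ∫ ω, V ω ∂μ| ≤ M * (M * a) := by
  have hU' : Measurable U := hU.mono hF le_rfl
  have hV' : Measurable V := hV.mono hG le_rfl
  have hUint : Integrable U μ := Integrable.of_bound hU'.aestronglyMeasurable M
      (ae_of_all _ fun ω => by rw [Real.norm_eq_abs, abs_of_nonneg (hU0 ω)]; exact hUM ω)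
  -- one of the variables an indicator
  have key : ∀ B, MeasurableSet[G] B →
      |∫ ω in B, U ω ∂μ - μ.real B * ∫ ω, U ω ∂μ| ≤ M * a := by
    intro B hB
    have := abs_integral_sub_le_of_levelSets (μ.restrict B) ((μ.real B).toNNReal • μ) hU'
      (a := a) hM hU0 hUM (fun t => by
        have hA : MeasurableSet[F] {ω | t ≤ U ω} := hU measurableSet_Ici
        have := hmix _ B hA hB
        rw [measureReal_restrict_apply (hF _ hA), measureReal_nnreal_smul_apply]
        rw [Real.coe_toNNReal _ measureReal_nonneg, mul_comm (μ.real B)]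
        exact this)
    rw [integral_smul_nnreal_measure, NNReal.smul_def, smul_eq_mul,
      Real.coe_toNNReal _ measureReal_nonneg] at this
    exact this
  have hI0 : 0 ≤ ∫ ω, U ω ∂μ := integral_nonneg hU0
  have hfin : IsFiniteMeasure (μ.withDensity fun ω => ENNReal.ofReal (U ω)) :=
    isFiniteMeasure_withDensity_ofReal hUint.2
  have := abs_integral_sub_le_of_levelSets (μ.withDensity fun ω => ENNReal.ofReal (U ω))
    ((∫ ω, U ω ∂μ).toNNReal • μ) hV' (a := M * a) hM hV0 hVM (fun t => by
      have hB : MeasurableSet[G] {ω | t ≤ V ω} := hV measurableSet_Ici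
      have := key _ hB
      rw [measureReal_nnreal_smul_apply, Real.coe_toNNReal _ hI0]
      have h2 : (μ.withDensity fun ω => ENNReal.ofReal (U ω)).real {ω | t ≤ V ω} =
          ∫ ω in {ω | t ≤ V ω}, U ω ∂μ := by
        rw [measureReal_def, withDensity_apply _ (hG _ hB),
          ← ofReal_integral_eq_lintegral_ofReal hUint.integrableOn (ae_of_all _ hU0),
          ENNReal.toReal_ofReal (integral_nonneg hU0)]
      rw [h2, mul_comm]
      exact this)
  rw [integral_smul_nnreal_measure, NNReal.smul_def, smul_eq_mul, Real.coe_toNNReal _ hI0,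
    integral_withDensity_eq_integral_toReal_smul hU'.ennreal_ofReal (by simp)] at this
  simpa [ENNReal.toReal_ofReal, hU0] using this

/-- Covariance inequality for bounded variables under strong mixing. -/
lemma abs_cov_le_of_bounded {F G : MeasurableSpace Ω} [mΩ : MeasurableSpace Ω]
    (μ : Measure Ω) [IsProbabilityMeasure μ] (hF : F ≤ mΩ) (hG : G ≤ mΩ) {a : ℝ}
    (hmix : ∀ A B : Set Ω, MeasurableSet[F] A → MeasurableSet[G] B →
      |μ.real (A ∩ B) - μ.real A * μ.real B| ≤ a)
    {U V : Ω → ℝ} (hU : Measurable[F] U) (hV : Measurable[G] V) {M : ℝ} (hM : 0 ≤ M)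
    (hUM : ∀ ω, |U ω| ≤ M) (hVM : ∀ ω, |V ω| ≤ M) :
    |cov[U, V; μ]| ≤ 4 * M ^ 2 * a := by
  have hU' : Measurable U := hU.mono hF le_rfl
  have hV' : Measurable V := hV.mono hG le_rfl
  have hUi : Integrable U μ := Integrable.of_bound hU'.aestronglyMeasurable M (ae_of_all _ hUM)
  have hVi : Integrable V μ := Integrable.of_bound hV'.aestronglyMeasurable M (ae_of_all _ hVM)
  have hUs : Measurable[F] fun ω => U ω + M := (measurable_id.add_const M).comp hU
  have hVs : Measurable[G] fun ω => V ω + M := (measurable_id.add_const M).comp hV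
  have hL : ∀ (Z : Ω → ℝ), Measurable Z → (∀ ω, |Z ω| ≤ M) → MemLp (fun ω => Z ω + M) 2 μ := by
    intro Z hZ hb
    refine MemLp.of_bound (hZ.add_const M).aestronglyMeasurable (2 * M) (ae_of_all _ fun ω => ?_)
    rw [Real.norm_eq_abs]
    have := abs_le.1 (hb ω)
    rw [abs_le]; constructor <;> linarith
  have h := abs_integral_mul_sub_le_of_nonneg μ hF hG hmix hUs hVs (M := 2 * M) (by linarith)
    (fun ω => by linarith [(abs_le.1 (hUM ω)).1]) (fun ω => by linarith [(abs_le.1 (hUM ω)).2])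
    (fun ω => by linarith [(abs_le.1 (hVM ω)).1]) (fun ω => by linarith [(abs_le.1 (hVM ω)).2])
  have e : cov[U, V; μ] = cov[fun ω => U ω + M, fun ω => V ω + M; μ] := by
    rw [covariance_add_const_left hUi, covariance_add_const_right hVi]
  rw [e, covariance_eq_sub (hL U hU' hUM) (hL V hV' hVM)]
  refine le_trans h (le_of_eq (by ring))

lemma memLp_of_integrable_rpow [MeasurableSpace Ω] {μ : Measure Ω} {U : Ω → ℝ}
    (hU : Measurable U) {r : ℝ} (hr : 0 < r) (hi : Integrable (fun ω => |U ω| ^ r) μ) :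
    MemLp U (ENNReal.ofReal r) μ := by
  rw [← integrable_norm_rpow_iff hU.aestronglyMeasurable (by simpa using hr) (by simp),
    ENNReal.toReal_ofReal hr.le]
  simpa [Real.norm_eq_abs] using hi

lemma memLp_two_of_integrable_rpow [MeasurableSpace Ω] {μ : Measure Ω} [IsFiniteMeasure μ]
    {U : Ω → ℝ} (hU : Measurable U) {r : ℝ} (hr : 2 ≤ r)
    (hi : Integrable (fun ω => |U ω| ^ r) μ) : MemLp U 2 μ :=
  (memLp_of_integrable_rpow hU (by linarith) hi).mono_exponent
    (by rw [show (2 : ENNReal) = ENNReal.ofReal 2 by simp]; exact ENNReal.ofReal_le_ofReal hr)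

/-- The part of a real number that exceeds `M` in absolute value. -/
def tailPart (M x : ℝ) : ℝ := if |x| ≤ M then 0 else x

lemma measurable_tailPart (M : ℝ) : Measurable (tailPart M) :=
  Measurable.ite (measurableSet_le measurable_id.abs measurable_const) measurable_const
    measurable_id

lemma abs_sub_tailPart_le {M : ℝ} (hM : 0 ≤ M) (x : ℝ) : |x - tailPart M x| ≤ M := by
  unfold tailPart
  split_ifs with h <;> simp [h, hM]

lemma abs_tailPart_rpow_le {M : ℝ} (hM : 0 < M) {s r : ℝ} (hs : 0 < s) (hsr : s ≤ r) (x : ℝ) :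
    |tailPart M x| ^ s ≤ M ^ (s - r) * |x| ^ r := by
  unfold tailPart
  split_ifs with h
  · rw [abs_zero, Real.zero_rpow hs.ne']; positivity
  · push Not at h
    have hx : 0 < |x| := hM.trans h
    calc |x| ^ s = |x| ^ (s - r) * |x| ^ r := by rw [← Real.rpow_add hx]; congr 1; ring
      _ ≤ M ^ (s - r) * |x| ^ r := by
        gcongr ?_ * _
        exact Real.rpow_le_rpow_of_nonpos hM h.le (by linarith)

lemma integral_abs_tailPart_le [MeasurableSpace Ω] {μ : Measure Ω} {U : Ω → ℝ}
    (hU : Measurable U) {M r K : ℝ} (hM : 0 < M) (hr : 1 ≤ r)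
    (hi : Integrable (fun ω => |U ω| ^ r) μ) (hK : ∫ ω, |U ω| ^ r ∂μ ≤ K) :
    Integrable (fun ω => |tailPart M (U ω)|) μ ∧
      ∫ ω, |tailPart M (U ω)| ∂μ ≤ M ^ (1 - r) * K := by
  have hb : ∀ ω, |tailPart M (U ω)| ≤ M ^ (1 - r) * |U ω| ^ r := fun ω => by
    simpa using abs_tailPart_rpow_le hM one_pos hr (U ω)
  have hint : Integrable (fun ω => |tailPart M (U ω)|) μ :=
    (hi.const_mul (M ^ (1 - r))).mono'
      ((measurable_tailPart M).comp hU).abs.aestronglyMeasurable (ae_of_all _ fun ω => by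
        simpa using hb ω)
  refine ⟨hint, (integral_mono hint (hi.const_mul _) hb).trans ?_⟩
  rw [integral_const_mul]
  gcongr

lemma integral_sq_tailPart_le [MeasurableSpace Ω] {μ : Measure Ω} {U : Ω → ℝ}
    (hU : Measurable U) {M r K : ℝ} (hM : 0 < M) (hr : 2 ≤ r)
    (hi : Integrable (fun ω => |U ω| ^ r) μ) (hK : ∫ ω, |U ω| ^ r ∂μ ≤ K) :
    Integrable (fun ω => tailPart M (U ω) ^ 2) μ ∧
      ∫ ω, tailPart M (U ω) ^ 2 ∂μ ≤ M ^ (2 - r) * K := by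
  have hb : ∀ ω, tailPart M (U ω) ^ 2 ≤ M ^ (2 - r) * |U ω| ^ r := fun ω => by
    simpa using abs_tailPart_rpow_le hM two_pos hr (U ω)
  have hint : Integrable (fun ω => tailPart M (U ω) ^ 2) μ :=
    (hi.const_mul (M ^ (2 - r))).mono'
      (((measurable_tailPart M).comp hU).pow_const 2).aestronglyMeasurable (ae_of_all _ fun ω => by
        simpa using hb ω)
  refine ⟨hint, (integral_mono hint (hi.const_mul _) hb).trans ?_⟩
  rw [integral_const_mul]
  gcongr

lemma abs_cov_le_of_bounded_left [MeasurableSpace Ω] {μ : Measure Ω} [IsProbabilityMeasure μ]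
    {P Q : Ω → ℝ} (hP : MemLp P 2 μ) (hQ : MemLp Q 2 μ) {M : ℝ} (hM : ∀ ω, |P ω| ≤ M) :
    |cov[P, Q; μ]| ≤ 2 * M * ∫ ω, |Q ω| ∂μ := by
  have hQi : Integrable (fun ω => |Q ω|) μ := (hQ.integrable one_le_two).abs
  have h1 : |∫ ω, P ω * Q ω ∂μ| ≤ M * ∫ ω, |Q ω| ∂μ := by
    rw [← integral_const_mul]
    refine (abs_integral_le_integral_abs).trans (integral_mono (hP.integrable_mul hQ).abs
      (hQi.const_mul M) fun ω => ?_)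
    change |P ω * Q ω| ≤ M * |Q ω|
    rw [abs_mul]
    gcongr
    exact hM ω
  have h2 : |∫ ω, P ω ∂μ| ≤ M := by
    have := norm_integral_le_of_norm_le_const (μ := μ) (f := P) (ae_of_all _ hM)
    simpa using this
  have h3 : |∫ ω, Q ω ∂μ| ≤ ∫ ω, |Q ω| ∂μ := abs_integral_le_integral_abs
  have hM0 : 0 ≤ M := (abs_nonneg _).trans h2
  rw [covariance_eq_sub hP hQ]
  calc _ ≤ |∫ ω, P ω * Q ω ∂μ| + |(∫ ω, P ω ∂μ) * ∫ ω, Q ω ∂μ| := abs_sub _ _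
    _ ≤ M * ∫ ω, |Q ω| ∂μ + M * ∫ ω, |Q ω| ∂μ := by
      rw [abs_mul]; gcongr
    _ = _ := by ring

lemma two_mul_abs_cov_le [MeasurableSpace Ω] {μ : Measure Ω} [IsProbabilityMeasure μ]
    {P Q : Ω → ℝ} (hP : MemLp P 2 μ) (hQ : MemLp Q 2 μ) :
    2 * |cov[P, Q; μ]| ≤ ∫ ω, P ω ^ 2 ∂μ + ∫ ω, Q ω ^ 2 ∂μ := by
  have h1 := variance_nonneg (P + Q) μ
  have h2 := variance_nonneg (P - Q) μ
  rw [variance_add hP hQ] at h1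
  rw [variance_sub hP hQ] at h2
  have h3 := variance_le_expectation_sq (μ := μ) hP.aestronglyMeasurable
  have h4 := variance_le_expectation_sq (μ := μ) hQ.aestronglyMeasurable
  simp only [Pi.pow_apply] at h3 h4
  rcases abs_cases (cov[P, Q; μ]) with h | h <;> linarith

/-- Davydov's covariance inequality: variables with moments of order `r > 2` that are measurable
with respect to σ-algebras with mixing coefficient at most `a`. Both are truncated at the level
`a ^ (-1/r)`. -/
lemma abs_cov_le_of_moments_of_pos {F G : MeasurableSpace Ω} [mΩ : MeasurableSpace Ω]
    (μ : Measure Ω) [IsProbabilityMeasure μ] (hF : F ≤ mΩ) (hG : G ≤ mΩ) {a : ℝ} (ha : 0 < a)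
    (hmix : ∀ A B : Set Ω, MeasurableSet[F] A → MeasurableSet[G] B →
      |μ.real (A ∩ B) - μ.real A * μ.real B| ≤ a)
    {U V : Ω → ℝ} (hU : Measurable[F] U) (hV : Measurable[G] V) {r K : ℝ} (hr : 2 < r)
    (hUi : Integrable (fun ω => |U ω| ^ r) μ) (hUK : ∫ ω, |U ω| ^ r ∂μ ≤ K)
    (hVi : Integrable (fun ω => |V ω| ^ r) μ) (hVK : ∫ ω, |V ω| ^ r ∂μ ≤ K) :
    |cov[U, V; μ]| ≤ (4 + 5 * K) * a ^ (1 - 2 / r) := by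
  set M : ℝ := a ^ (-1 / r) with hMdef
  have hM : 0 < M := by positivity
  have hU' : Measurable U := hU.mono hF le_rfl
  have hV' : Measurable V := hV.mono hG le_rfl
  have hU2 := memLp_two_of_integrable_rpow hU' hr.le hUi
  have hV2 := memLp_two_of_integrable_rpow hV' hr.le hVi
  have htail : ∀ Z : Ω → ℝ, Measurable Z → Integrable (fun ω => |Z ω| ^ r) μ →
      ∫ ω, |Z ω| ^ r ∂μ ≤ K → MemLp (fun ω => tailPart M (Z ω)) 2 μ := fun Z hZ hi hK =>
    (memLp_two_iff_integrable_sq ((measurable_tailPart M).comp hZ).aestronglyMeasurable).2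
      (integral_sq_tailPart_le hZ hM hr.le hi hK).1
  have hUt := htail U hU' hUi hUK
  have hVt := htail V hV' hVi hVK
  have hUb : MemLp (fun ω => U ω - tailPart M (U ω)) 2 μ := hU2.sub hUt
  have hVb : MemLp (fun ω => V ω - tailPart M (V ω)) 2 μ := hV2.sub hVt
  have e : cov[U, V; μ] =
      cov[fun ω => U ω - tailPart M (U ω), fun ω => V ω - tailPart M (V ω); μ]
      + cov[fun ω => U ω - tailPart M (U ω), fun ω => tailPart M (V ω); μ]
      + cov[fun ω => V ω - tailPart M (V ω), fun ω => tailPart M (U ω); μ]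
      + cov[fun ω => tailPart M (U ω), fun ω => tailPart M (V ω); μ] := by
    rw [covariance_comm (fun ω => V ω - tailPart M (V ω)),
      covariance_fun_sub_fun_sub hU2 hUt hV2 hVt, covariance_fun_sub_left hU2 hUt hVt,
      covariance_fun_sub_right hUt hV2 hVt]
    ring
  have hpow1 : M ^ 2 * a = a ^ (1 - 2 / r) := by
    rw [hMdef, ← Real.rpow_natCast, ← Real.rpow_mul ha.le]
    nth_rewrite 2 [← Real.rpow_one a]
    rw [← Real.rpow_add ha]
    congr 1; push_cast; ring
  have hpow2 : M ^ (2 - r) = a ^ (1 - 2 / r) := by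
    rw [hMdef, ← Real.rpow_mul ha.le]
    congr 1; field_simp; ring
  have hpow3 : M * M ^ (1 - r) = a ^ (1 - 2 / r) := by
    rw [← hpow2]
    nth_rewrite 1 [← Real.rpow_one M]
    rw [← Real.rpow_add hM]
    congr 1; ring
  have mF : Measurable[F] fun ω => U ω - tailPart M (U ω) :=
    (measurable_id.sub (measurable_tailPart M)).comp hU
  have mG : Measurable[G] fun ω => V ω - tailPart M (V ω) :=
    (measurable_id.sub (measurable_tailPart M)).comp hV
  have b1 := abs_cov_le_of_bounded μ hF hG hmix mF mG hM.le
    (fun ω => abs_sub_tailPart_le hM.le (U ω)) (fun ω => abs_sub_tailPart_le hM.le (V ω))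
  have b2 := abs_cov_le_of_bounded_left hUb hVt (fun ω => abs_sub_tailPart_le hM.le (U ω))
  have b3 := abs_cov_le_of_bounded_left hVb hUt (fun ω => abs_sub_tailPart_le hM.le (V ω))
  have b4 := two_mul_abs_cov_le hUt hVt
  have c2 := (integral_abs_tailPart_le hV' hM (by linarith) hVi hVK).2
  have c3 := (integral_abs_tailPart_le hU' hM (by linarith) hUi hUK).2
  have c4 := (integral_sq_tailPart_le hU' hM hr.le hUi hUK).2
  have c5 := (integral_sq_tailPart_le hV' hM hr.le hVi hVK).2
  have d2 := mul_le_mul_of_nonneg_left c2 (by positivity : 0 ≤ 2 * M)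
  have d3 := mul_le_mul_of_nonneg_left c3 (by positivity : 0 ≤ 2 * M)
  rw [show 2 * M * (M ^ (1 - r) * K) = 2 * (M * M ^ (1 - r)) * K by ring, hpow3] at d2 d3
  rw [hpow2] at c4 c5
  rw [mul_assoc, hpow1] at b1
  rw [e]
  refine (abs_add_le _ _).trans ?_
  refine (add_le_add_left ((abs_add_le _ _).trans
    (add_le_add_left (abs_add_le _ _) _)) _).trans ?_
  linarith

/-- Davydov's covariance inequality, including the case of independent σ-algebras (`a = 0`). -/
lemma abs_cov_le_of_moments {F G : MeasurableSpace Ω} [mΩ : MeasurableSpace Ω]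
    (μ : Measure Ω) [IsProbabilityMeasure μ] (hF : F ≤ mΩ) (hG : G ≤ mΩ) {a : ℝ} (ha : 0 ≤ a)
    (hmix : ∀ A B : Set Ω, MeasurableSet[F] A → MeasurableSet[G] B →
      |μ.real (A ∩ B) - μ.real A * μ.real B| ≤ a)
    {U V : Ω → ℝ} (hU : Measurable[F] U) (hV : Measurable[G] V) {r K : ℝ} (hr : 2 < r)
    (hUi : Integrable (fun ω => |U ω| ^ r) μ) (hUK : ∫ ω, |U ω| ^ r ∂μ ≤ K)
    (hVi : Integrable (fun ω => |V ω| ^ r) μ) (hVK : ∫ ω, |V ω| ^ r ∂μ ≤ K) :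
    |cov[U, V; μ]| ≤ (4 + 5 * K) * a ^ (1 - 2 / r) := by
  have hs : 0 < 1 - 2 / r := by rw [sub_pos, div_lt_one (by linarith)]; exact hr
  have hc : Tendsto (fun b : ℝ => (4 + 5 * K) * b ^ (1 - 2 / r)) (𝓝[>] a)
      (𝓝 ((4 + 5 * K) * a ^ (1 - 2 / r))) :=
    ((Real.continuous_rpow_const hs.le).tendsto a |>.const_mul _).mono_left nhdsWithin_le_nhds
  refine ge_of_tendsto hc ?_
  filter_upwards [self_mem_nhdsWithin] with b hb
  exact abs_cov_le_of_moments_of_pos μ hF hG (lt_of_le_of_lt ha hb)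
    (fun A B hA hB => (hmix A B hA hB).trans (le_of_lt hb)) hU hV hr hUi hUK hVi hVK

variable {p q : ℕ}

lemma sigmaAlg_mono (Y : ℤ → Ω → Matrix (Fin p) (Fin q) ℝ) {S T : Set ℤ} (h : S ⊆ T) :
    sigmaAlg Y S ≤ sigmaAlg Y T :=
  biSup_mono fun _ ht => h ht

lemma sigmaAlg_le [mΩ : MeasurableSpace Ω] {Y : ℤ → Ω → Matrix (Fin p) (Fin q) ℝ}
    (hmeas : ∀ t i a, Measurable fun ω => Y t ω i a) (T : Set ℤ) : sigmaAlg Y T ≤ mΩ :=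
  iSup₂_le fun t _ => iSup₂_le fun i a => (hmeas t i a).comap_le

lemma measurable_sigmaAlg (Y : ℤ → Ω → Matrix (Fin p) (Fin q) ℝ) {T : Set ℤ} {t : ℤ}
    (ht : t ∈ T) (i : Fin p) (a : Fin q) : Measurable[sigmaAlg Y T] fun ω => Y t ω i a := by
  rw [measurable_iff_comap_le]
  exact le_iSup₂_of_le t ht (le_iSup₂_of_le i a le_rfl)

section AlphaMix

variable [mΩ : MeasurableSpace Ω] (μ : Measure Ω) (Y : ℤ → Ω → Matrix (Fin p) (Fin q) ℝ)

/-- Bound for the covariance at lag `n` of functionals of the series that depend on the times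
within distance `H` only: up to lag `2 * H` the trivial mixing bound `1` is used. -/
def mixingBound (r K : ℝ) (H n : ℕ) : ℝ :=
  (4 + 5 * K) * if n ≤ 2 * H then 1 else alphaMix μ Y (n - 2 * H) ^ (1 - 2 / r)

variable {μ Y}

lemma summable_mixingBound {r : ℝ}
    (hmix : Summable fun k : ℕ => alphaMix μ Y (k + 1) ^ (1 - 2 / r)) (K : ℝ) (H : ℕ) :
    Summable fun z : ℤ => mixingBound μ Y r K H z.natAbs := by
  have h : Summable (mixingBound μ Y r K H) := by
    refine (summable_nat_add_iff (2 * H + 1)).1 ?_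
    refine (hmix.mul_left (4 + 5 * K)).congr fun k => ?_
    rw [mixingBound, if_neg (by omega), show k + (2 * H + 1) - 2 * H = k + 1 by omega]
  exact Summable.of_nat_of_neg (by simpa using h) (by simpa using h)

variable (μ Y) [IsProbabilityMeasure μ]

lemma abs_measureReal_inter_sub_le_one (A B : Set Ω) :
    |μ.real (A ∩ B) - μ.real A * μ.real B| ≤ 1 := by
  have h1 : μ.real (A ∩ B) ≤ 1 := measureReal_le_one
  have h2 : μ.real A * μ.real B ≤ 1 :=
    mul_le_one₀ measureReal_le_one measureReal_nonneg measureReal_le_one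
  have h3 : 0 ≤ μ.real (A ∩ B) := measureReal_nonneg
  have h4 : 0 ≤ μ.real A * μ.real B := mul_nonneg measureReal_nonneg measureReal_nonneg
  rw [abs_le]; constructor <;> linarith

lemma abs_measureReal_inter_sub_le_alphaMix {i : ℤ} {k : ℕ} {A B : Set Ω}
    (hA : MeasurableSet[sigmaAlg Y (Set.Iic i)] A)
    (hB : MeasurableSet[sigmaAlg Y (Set.Ici (i + k))] B) :
    |μ.real (A ∩ B) - μ.real A * μ.real B| ≤ alphaMix μ Y k := by
  refine le_csSup ⟨1, ?_⟩ ⟨i, A, B, hA, hB, rfl⟩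
  rintro x ⟨_, A, B, _, _, rfl⟩
  exact abs_measureReal_inter_sub_le_one μ A B

lemma alphaMix_nonneg (k : ℕ) : 0 ≤ alphaMix μ Y k :=
  (abs_nonneg _).trans (abs_measureReal_inter_sub_le_alphaMix μ Y (i := 0) (k := k)
    (A := ∅) (B := ∅) (@MeasurableSet.empty _ (sigmaAlg Y _))
    (@MeasurableSet.empty _ (sigmaAlg Y _)))

variable {μ Y}

lemma abs_cov_le_mixingBound (hmeas : ∀ t i a, Measurable fun ω => Y t ω i a) {r K : ℝ}
    (hr : 2 < r) {H : ℕ} {ξ : ℤ → Ω → ℝ}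
    (hξ : ∀ t, Measurable[sigmaAlg Y (Set.Icc (t - H) (t + H))] (ξ t))
    (hi : ∀ t, Integrable (fun ω => |ξ t ω| ^ r) μ) (hK : ∀ t, ∫ ω, |ξ t ω| ^ r ∂μ ≤ K)
    (s t : ℤ) : |cov[ξ s, ξ t; μ]| ≤ mixingBound μ Y r K H (s - t).natAbs := by
  wlog hst : s ≤ t generalizing s t
  · rw [covariance_comm, ← Int.natAbs_neg, neg_sub]
    exact this t s (le_of_not_ge hst)
  rw [mixingBound]
  split_ifs with h
  · have := abs_cov_le_of_moments μ (sigmaAlg_le hmeas _) (sigmaAlg_le hmeas _) zero_le_one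
      (fun A B _ _ => abs_measureReal_inter_sub_le_one μ A B) (hξ s) (hξ t) hr
      (hi s) (hK s) (hi t) (hK t)
    simpa using this
  · refine abs_cov_le_of_moments μ (sigmaAlg_le hmeas (Set.Iic (s + H)))
      (sigmaAlg_le hmeas (Set.Ici (s + H + ((s - t).natAbs - 2 * H : ℕ))))
      (alphaMix_nonneg μ Y _) (fun A B hA hB => abs_measureReal_inter_sub_le_alphaMix μ Y hA hB)
      ((hξ s).mono (sigmaAlg_mono Y fun x hx => hx.2) le_rfl)
      ((hξ t).mono (sigmaAlg_mono Y fun x hx => ?_) le_rfl) hr (hi s) (hK s) (hi t) (hK t)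
    have := hx.1
    simp only [Set.mem_Ici]
    omega

/-- Partial sums of a short-range functional of a mixing series have variance of the order of the
number of terms. -/
lemma exists_variance_sum_le (hmeas : ∀ t i a, Measurable fun ω => Y t ω i a) {r : ℝ}
    (hr : 2 < r) (hmix : Summable fun k : ℕ => alphaMix μ Y (k + 1) ^ (1 - 2 / r)) {K : ℝ} {H : ℕ}
    {ξ : ℤ → Ω → ℝ} (hξ : ∀ t, Measurable[sigmaAlg Y (Set.Icc (t - H) (t + H))] (ξ t))
    (hi : ∀ t, Integrable (fun ω => |ξ t ω| ^ r) μ) (hK : ∀ t, ∫ ω, |ξ t ω| ^ r ∂μ ≤ K) :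
    ∃ C : ℝ, ∀ T : Finset ℤ, Var[∑ t ∈ T, ξ t; μ] ≤ T.card * C := by
  have hL : ∀ t, MemLp (ξ t) 2 μ := fun t =>
    memLp_two_of_integrable_rpow ((hξ t).mono (sigmaAlg_le hmeas _) le_rfl) hr.le (hi t)
  have hcov := abs_cov_le_mixingBound hmeas hr hξ hi hK
  have hsum := summable_mixingBound hmix K H
  have hK0 : 0 ≤ K := le_trans (integral_nonneg fun ω => by positivity) (hK 0)
  have hnn : ∀ n, 0 ≤ mixingBound μ Y r K H n := fun n => by
    rw [mixingBound]
    have := alphaMix_nonneg μ Y (n - 2 * H)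
    split_ifs <;> positivity
  refine ⟨∑' z : ℤ, mixingBound μ Y r K H z.natAbs, fun T => ?_⟩
  rw [variance_sum' fun t _ => hL t, ← nsmul_eq_mul]
  refine Finset.sum_le_card_nsmul _ _ _ fun s _ => ?_
  calc ∑ t ∈ T, cov[ξ s, ξ t; μ] ≤ ∑ t ∈ T, mixingBound μ Y r K H (s - t).natAbs :=
        Finset.sum_le_sum fun t _ => (le_abs_self _).trans (hcov s t)
    _ ≤ ∑' t : ℤ, mixingBound μ Y r K H (s - t).natAbs :=
        ((Equiv.subLeft s).summable_iff.2 hsum).sum_le_tsum T (fun t _ => hnn _)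
    _ = _ := (Equiv.subLeft s).tsum_eq fun z : ℤ => mixingBound μ Y r K H z.natAbs

end AlphaMix

end Mixing

/-! ### Stochastic orders -/

section StochasticOrders

variable {Ω : Type*} [MeasurableSpace Ω] {μ : Measure Ω} {ξ ζ : ℕ → Ω → ℝ} {r s : ℕ → ℝ}

lemma IsBigOp.mono_eventually (hζ : IsBigOp μ ζ r) (h : ∀ᶠ n in atTop, ∀ ω, |ξ n ω| ≤ |ζ n ω|) :
    IsBigOp μ ξ r := by
  intro η hη
  obtain ⟨M, hM⟩ := hζ η hη
  refine ⟨M, ?_⟩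
  filter_upwards [hM, h] with n hn hle
  exact (measure_mono fun ω hω => lt_of_lt_of_le hω (hle ω)).trans hn

lemma IsBigOp.add (hξ : IsBigOp μ ξ r) (hζ : IsBigOp μ ζ r) :
    IsBigOp μ (fun n ω => ξ n ω + ζ n ω) r := by
  intro η hη
  obtain ⟨M₁, h₁⟩ := hξ (η / 2) (ENNReal.half_pos hη.ne')
  obtain ⟨M₂, h₂⟩ := hζ (η / 2) (ENNReal.half_pos hη.ne')
  refine ⟨M₁ + M₂, ?_⟩
  filter_upwards [h₁, h₂] with n hn₁ hn₂
  calc μ {ω | (M₁ + M₂) * r n < |ξ n ω + ζ n ω|}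
      ≤ μ ({ω | M₁ * r n < |ξ n ω|} ∪ {ω | M₂ * r n < |ζ n ω|}) := by
        refine measure_mono fun ω hω => ?_
        by_contra hcon
        simp only [Set.mem_union, Set.mem_ofPred_eq, not_or, not_lt] at hcon hω
        have := abs_add_le (ξ n ω) (ζ n ω)
        linarith [hcon.1, hcon.2]
    _ ≤ _ := measure_union_le _ _
    _ ≤ η / 2 + η / 2 := add_le_add hn₁ hn₂
    _ = η := ENNReal.add_halves η

lemma IsBigOp.mul (hξ : IsBigOp μ ξ r) (hζ : IsBigOp μ ζ s) :
    IsBigOp μ (fun n ω => ξ n ω * ζ n ω) (fun n => r n * s n) := by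
  intro η hη
  obtain ⟨M₁, h₁⟩ := hξ (η / 2) (ENNReal.half_pos hη.ne')
  obtain ⟨M₂, h₂⟩ := hζ (η / 2) (ENNReal.half_pos hη.ne')
  refine ⟨M₁ * M₂, ?_⟩
  filter_upwards [h₁, h₂] with n hn₁ hn₂
  calc μ {ω | M₁ * M₂ * (r n * s n) < |ξ n ω * ζ n ω|}
      ≤ μ ({ω | M₁ * r n < |ξ n ω|} ∪ {ω | M₂ * s n < |ζ n ω|}) := by
        refine measure_mono fun ω hω => ?_
        by_contra hcon
        simp only [Set.mem_union, Set.mem_ofPred_eq, not_or, not_lt] at hcon hω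
        have := mul_le_mul hcon.1 hcon.2 (abs_nonneg _) ((abs_nonneg _).trans hcon.1)
        rw [abs_mul] at hω
        linarith [show M₁ * r n * (M₂ * s n) = M₁ * M₂ * (r n * s n) by ring]
    _ ≤ _ := measure_union_le _ _
    _ ≤ η / 2 + η / 2 := add_le_add hn₁ hn₂
    _ = η := ENNReal.add_halves η

lemma IsBigOp.of_bound {C : ℝ} (h : ∀ᶠ n in atTop, ∀ ω, |ξ n ω| ≤ C * r n) :
    IsBigOp μ ξ r := by
  intro η _
  refine ⟨C, ?_⟩
  filter_upwards [h] with n hn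
  have : {ω | C * r n < |ξ n ω|} = ∅ := by
    ext ω; simpa using hn ω
  simp [this]

lemma IsBigOp.mono_rate (hξ : IsBigOp μ ξ r) (h : ∀ n, r n ≤ s n) (hr : ∀ n, 0 ≤ r n) :
    IsBigOp μ ξ s := by
  intro η hη
  obtain ⟨M, hM⟩ := hξ η hη
  refine ⟨|M|, ?_⟩
  filter_upwards [hM] with n hn
  refine (measure_mono fun ω hω => ?_).trans hn
  have hω' : |M| * s n < |ξ n ω| := hω
  change M * r n < |ξ n ω|
  calc M * r n ≤ |M| * s n := mul_le_mul (le_abs_self M) (h n) (hr n) (abs_nonneg M)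
    _ < _ := hω'

lemma IsBigOp.sum {ι : Type*} (S : Finset ι) {ξ : ι → ℕ → Ω → ℝ}
    (h : ∀ i ∈ S, IsBigOp μ (ξ i) r) : IsBigOp μ (fun n ω => ∑ i ∈ S, ξ i n ω) r := by
  classical
  induction S using Finset.induction_on with
  | empty => exact IsBigOp.of_bound (C := 0) (by simp)
  | insert i S hi ih =>
    simp only [Finset.sum_insert hi]
    exact (h i (Finset.mem_insert_self i S)).add
      (ih fun j hj => h j (Finset.mem_insert_of_mem hj))

lemma inv_sqrt_nat_mul_self_le (n : ℕ) : (√(n : ℝ))⁻¹ * (√(n : ℝ))⁻¹ ≤ (√(n : ℝ))⁻¹ := by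
  rcases Nat.eq_zero_or_pos n with rfl | hn
  · simp
  · have : 1 ≤ √(n : ℝ) := Real.one_le_sqrt.2 (by exact_mod_cast hn)
    exact mul_le_of_le_one_left (by positivity) (inv_le_one_of_one_le₀ this)

lemma IsBigOp.mul_of_sqrt (hξ : IsBigOp μ ξ fun n => (√(n : ℝ))⁻¹)
    (hζ : IsBigOp μ ζ fun n => (√(n : ℝ))⁻¹) :
    IsBigOp μ (fun n ω => ξ n ω * ζ n ω) fun n => (√(n : ℝ))⁻¹ :=
  (hξ.mul hζ).mono_rate inv_sqrt_nat_mul_self_le fun n => by positivity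

/-- A centered sequence with variance `O(1/n)` is `O_p(n^{-1/2})` by Chebyshev's inequality. -/
lemma isBigOp_of_variance_le [IsFiniteMeasure μ] (hL : ∀ n, MemLp (ξ n) 2 μ)
    (hmean : ∀ n, ∫ ω, ξ n ω ∂μ = 0) {C : ℝ} (h : ∀ n, 0 < n → Var[ξ n; μ] ≤ C / n) :
    IsBigOp μ ξ fun n => (√(n : ℝ))⁻¹ := by
  intro η hη
  have hlim : Tendsto (fun M : ℝ => ENNReal.ofReal (C / M ^ 2)) atTop (𝓝 0) := by
    rw [← ENNReal.ofReal_zero]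
    exact (ENNReal.continuous_ofReal.tendsto 0).comp
      (tendsto_const_nhds.div_atTop (tendsto_pow_atTop two_ne_zero))
  obtain ⟨M, hM, hM0⟩ := ((hlim.eventually (ge_mem_nhds hη)).and (eventually_gt_atTop 0)).exists
  refine ⟨M, ?_⟩
  filter_upwards [eventually_gt_atTop 0] with n hn
  have hn' : (0 : ℝ) < n := by exact_mod_cast hn
  have hc : 0 < M * (√(n : ℝ))⁻¹ := by positivity
  have := meas_ge_le_variance_div_sq (hL n) hc
  rw [hmean n] at this
  simp only [sub_zero] at this
  have hsub : {ω | M * (√(n : ℝ))⁻¹ < |ξ n ω|} ⊆ {ω | M * (√(n : ℝ))⁻¹ ≤ |ξ n ω|} :=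
    fun ω hω => le_of_lt (α := ℝ) hω
  refine (measure_mono hsub).trans (this.trans ?_)
  refine (ENNReal.ofReal_le_ofReal ?_).trans hM
  rw [mul_pow, inv_pow, Real.sq_sqrt hn'.le, div_le_div_iff₀ (by positivity) (by positivity)]
  have := h n hn
  rw [le_div_iff₀ hn'] at this
  calc Var[ξ n; μ] * M ^ 2 = (Var[ξ n; μ] * n) * (M ^ 2 * (n : ℝ)⁻¹) := by field_simp
    _ ≤ C * (M ^ 2 * (n : ℝ)⁻¹) := by gcongr

end StochasticOrders

/-! ### Root-n consistency of the sample autocovariances -/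

section Rate

variable {Ω : Type*} [MeasurableSpace Ω] {μ : Measure Ω} {p q : ℕ}
  {Y : ℤ → Ω → Matrix (Fin p) (Fin q) ℝ}

/-- The normalized partial sums of a centered short-range functional of the series are
`O_p(n^{-1/2})`. -/
lemma isBigOp_partialSum [IsProbabilityMeasure μ]
    (hmeas : ∀ t i a, Measurable fun ω => Y t ω i a) {r : ℝ}
    (hr : 2 < r) (hmix : Summable fun k : ℕ => alphaMix μ Y (k + 1) ^ (1 - 2 / r)) {K c : ℝ}
    {H : ℕ} {ξ : ℤ → Ω → ℝ}
    (hξ : ∀ t, Measurable[sigmaAlg Y (Set.Icc (t - H) (t + H))] (ξ t))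
    (hi : ∀ t, Integrable (fun ω => |ξ t ω| ^ r) μ) (hK : ∀ t, ∫ ω, |ξ t ω| ^ r ∂μ ≤ K)
    (hc : ∀ t, ∫ ω, ξ t ω ∂μ = c) (T : ℕ → Finset ℤ) (hT : ∀ n, (T n).card ≤ n) :
    IsBigOp μ (fun n ω => (n : ℝ)⁻¹ * ∑ t ∈ T n, (ξ t ω - c)) fun n => (√(n : ℝ))⁻¹ := by
  obtain ⟨C, hC⟩ := exists_variance_sum_le hmeas hr hmix hξ hi hK
  have hL : ∀ t, MemLp (ξ t) 2 μ := fun t =>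
    memLp_two_of_integrable_rpow ((hξ t).mono (sigmaAlg_le hmeas _) le_rfl) hr.le (hi t)
  have hL' : ∀ n, MemLp (fun ω => ∑ t ∈ T n, (ξ t ω - c)) 2 μ := fun n =>
    memLp_finsetSum _ fun t _ => (hL t).sub (memLp_const c)
  refine isBigOp_of_variance_le (C := max C 0) (fun n => (hL' n).const_mul _) (fun n => ?_)
    fun n hn => ?_
  · rw [integral_const_mul, integral_finsetSum (T n) (f := fun t ω => ξ t ω - c) fun t _ =>
      ((hL t).integrable one_le_two).sub (integrable_const c)]
    rw [Finset.sum_eq_zero, mul_zero]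
    intro t _
    rw [integral_sub ((hL t).integrable one_le_two) (integrable_const c), hc t]
    simp
  · have hn' : (0 : ℝ) < n := by exact_mod_cast hn
    have e : (fun ω => ∑ t ∈ T n, (ξ t ω - c)) =
        fun ω => (∑ t ∈ T n, ξ t) ω - (T n).card * c := by
      ext ω; simp [Finset.sum_sub_distrib]
    have hsum : MemLp (∑ t ∈ T n, ξ t) 2 μ := memLp_finsetSum' _ fun t _ => hL t
    rw [variance_const_mul, e, variance_sub_const hsum.aestronglyMeasurable]
    have h1 : Var[∑ t ∈ T n, ξ t; μ] ≤ n * max C 0 :=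
      (hC (T n)).trans <| (mul_le_mul_of_nonneg_left (le_max_left C 0) (by positivity)).trans <|
        mul_le_mul_of_nonneg_right (by exact_mod_cast hT n) (le_max_right C 0)
    calc ((n : ℝ)⁻¹) ^ 2 * Var[∑ t ∈ T n, ξ t; μ] ≤ ((n : ℝ)⁻¹) ^ 2 * (n * max C 0) := by gcongr
      _ = max C 0 / n := by field_simp

/-- The entries of the series, centered at their common mean. -/
def centered (μ : Measure Ω) (Y : ℤ → Ω → Matrix (Fin p) (Fin q) ℝ) (i : Fin p) (a : Fin q)
    (t : ℤ) (ω : Ω) : ℝ :=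
  Y t ω i a - meanMat μ (Y 0) i a

lemma measurable_centered {T : Set ℤ} {t : ℤ} (ht : t ∈ T) (i : Fin p) (a : Fin q) :
    Measurable[sigmaAlg Y T] (centered μ Y i a t) :=
  (measurable_id.sub_const (meanMat μ (Y 0) i a)).comp (measurable_sigmaAlg Y ht i a)

lemma measurable_centered' (hmeas : ∀ t i a, Measurable fun ω => Y t ω i a) (i : Fin p)
    (a : Fin q) (t : ℤ) : Measurable (centered μ Y i a t) :=
  (hmeas t i a).sub_const _

lemma MomentBound.centered {γ K : ℝ} (hstat : WeaklyStationary μ Y) (hmom : MomentBound μ Y γ K)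
    (i : Fin p) (a : Fin q) (t : ℤ) :
    Integrable (fun ω => |centered μ Y i a t ω| ^ (2 * γ)) μ ∧
      ∫ ω, |MatSeg.centered μ Y i a t ω| ^ (2 * γ) ∂μ ≤ K := by
  have := hmom t i a
  rw [hstat.1 t] at this
  exact this

lemma MomentBound.memLp_two [IsProbabilityMeasure μ]
    {γ K : ℝ} (hγ : 2 < γ)
    (hmeas : ∀ t i a, Measurable fun ω => Y t ω i a) (hmom : MomentBound μ Y γ K)
    (t : ℤ) (i : Fin p) (a : Fin q) : MemLp (fun ω => Y t ω i a) 2 μ := by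
  have := memLp_two_of_integrable_rpow ((hmeas t i a).sub_const (meanMat μ (Y t) i a))
    (by linarith : 2 ≤ 2 * γ) (hmom t i a).1
  refine (this.add (memLp_const (meanMat μ (Y t) i a))).ae_eq (ae_of_all _ fun ω => ?_)
  simp

lemma integral_centered [IsProbabilityMeasure μ]
    {γ K : ℝ} (hγ : 2 < γ)
    (hmeas : ∀ t i a, Measurable fun ω => Y t ω i a) (hstat : WeaklyStationary μ Y)
    (hmom : MomentBound μ Y γ K) (i : Fin p) (a : Fin q) (t : ℤ) :
    ∫ ω, centered μ Y i a t ω ∂μ = 0 := by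
  unfold centered
  rw [integral_sub ((hmom.memLp_two hγ hmeas t i a).integrable one_le_two) (integrable_const _),
    ← hstat.1 t]
  simp [meanMat]

lemma integral_centered_mul (hstat : WeaklyStationary μ Y) (i j : Fin p) (a b : Fin q)
    (h t : ℤ) : ∫ ω, centered μ Y i a (t + h) ω * centered μ Y j b t ω ∂μ =
      rowAutocov μ Y i j h a b := by
  have h1 := hstat.2 t h i j a b
  have e : ∀ s (k : Fin p) (c : Fin q), ∫ ω, Y s ω k c ∂μ = meanMat μ (Y 0) k c := fun s k c => by
    rw [← hstat.1 s]; rfl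
  rw [rowAutocov, Matrix.of_apply, ← h1, covariance, e, e]
  rfl

lemma MomentBound.centered_rpow [IsProbabilityMeasure μ]
    {γ K : ℝ}
    (hmeas : ∀ t i a, Measurable fun ω => Y t ω i a) (hstat : WeaklyStationary μ Y)
    (hmom : MomentBound μ Y γ K) (i : Fin p) (a : Fin q) (t : ℤ) :
    Integrable (fun ω => |MatSeg.centered μ Y i a t ω| ^ γ) μ ∧
      ∫ ω, |MatSeg.centered μ Y i a t ω| ^ γ ∂μ ≤ 1 + K := by
  obtain ⟨h1, h2⟩ := MomentBound.centered hstat hmom i a t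
  have hb : ∀ ω, |MatSeg.centered μ Y i a t ω| ^ γ ≤
      1 + |MatSeg.centered μ Y i a t ω| ^ (2 * γ) := fun ω => by
    rw [mul_comm 2 γ, Real.rpow_mul (abs_nonneg _), Real.rpow_two]
    nlinarith [sq_nonneg (|MatSeg.centered μ Y i a t ω| ^ γ - 1 / 2)]
  have hint : Integrable (fun ω => |MatSeg.centered μ Y i a t ω| ^ γ) μ :=
    ((integrable_const (1 : ℝ)).add h1).mono'
      ((measurable_centered' hmeas i a t).abs.pow_const γ).aestronglyMeasurable
      (ae_of_all _ fun ω => by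
        rw [Real.norm_of_nonneg (by positivity)]; exact hb ω)
  refine ⟨hint, (integral_mono hint ((integrable_const (1 : ℝ)).add h1) hb).trans ?_⟩
  rw [integral_add' (integrable_const _) h1]
  simpa using h2

lemma MomentBound.centered_mul_rpow {γ K : ℝ}
    (hmeas : ∀ t i a, Measurable fun ω => Y t ω i a) (hstat : WeaklyStationary μ Y)
    (hmom : MomentBound μ Y γ K) (i j : Fin p) (a b : Fin q) (s t : ℤ) :
    Integrable (fun ω => |MatSeg.centered μ Y i a s ω * MatSeg.centered μ Y j b t ω| ^ γ) μ ∧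
      ∫ ω, |MatSeg.centered μ Y i a s ω * MatSeg.centered μ Y j b t ω| ^ γ ∂μ ≤ K := by
  obtain ⟨h1, h2⟩ := MomentBound.centered hstat hmom i a s
  obtain ⟨h3, h4⟩ := MomentBound.centered hstat hmom j b t
  have hb : ∀ ω, |MatSeg.centered μ Y i a s ω * MatSeg.centered μ Y j b t ω| ^ γ ≤
      (1 / 2) * (|MatSeg.centered μ Y i a s ω| ^ (2 * γ)
        + |MatSeg.centered μ Y j b t ω| ^ (2 * γ)) := fun ω => by
    rw [abs_mul, Real.mul_rpow (abs_nonneg _) (abs_nonneg _), mul_comm 2 γ,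
      Real.rpow_mul (abs_nonneg _), Real.rpow_mul (abs_nonneg _), Real.rpow_two, Real.rpow_two]
    nlinarith [sq_nonneg (|MatSeg.centered μ Y i a s ω| ^ γ
      - |MatSeg.centered μ Y j b t ω| ^ γ)]
  have hint : Integrable
      (fun ω => |MatSeg.centered μ Y i a s ω * MatSeg.centered μ Y j b t ω| ^ γ) μ :=
    ((h1.add h3).const_mul (1 / 2)).mono'
      (((measurable_centered' hmeas i a s).mul
        (measurable_centered' hmeas j b t)).abs.pow_const γ).aestronglyMeasurable
      (ae_of_all _ fun ω => by
        rw [Real.norm_of_nonneg (by positivity)]; exact hb ω)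
  refine ⟨hint, (integral_mono hint ((h1.add h3).const_mul (1 / 2)) hb).trans ?_⟩
  rw [integral_const_mul, integral_add' h1 h3]
  linarith

/-- The times `t` for which both `t` and `t + h` are observed. -/
def lagTimes (n : ℕ) (h : ℤ) : Finset ℤ :=
  (Finset.Icc (1 : ℤ) n).filter fun t => t + h ∈ Finset.Icc (1 : ℤ) n

lemma card_lagTimes_le (n : ℕ) (h : ℤ) : (lagTimes n h).card ≤ n :=
  (Finset.card_filter_le _ _).trans (by simp)

lemma le_card_lagTimes (n : ℕ) (h : ℤ) : (n : ℝ) - 2 * |(h : ℝ)| ≤ (lagTimes n h).card := by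
  have hsub : Finset.Icc (1 + |h|) (n - |h|) ⊆ lagTimes n h := by
    intro t ht
    simp only [lagTimes, Finset.mem_filter, Finset.mem_Icc] at ht ⊢
    have := neg_abs_le h
    have := le_abs_self h
    omega
  have h1 := Finset.card_le_card hsub
  rw [Int.card_Icc] at h1
  have h2 : (n : ℤ) - 2 * |h| ≤ (lagTimes n h).card := by omega
  have h3 : (((n : ℤ) - 2 * |h| : ℤ) : ℝ) ≤ (((lagTimes n h).card : ℤ) : ℝ) := by
    exact_mod_cast h2
  push_cast at h3
  exact h3

lemma sampleMean_sub_meanMat {n : ℕ} (hn : 0 < n) (ω : Ω) (i : Fin p) (a : Fin q) :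
    sampleMean Y n ω i a - meanMat μ (Y 0) i a =
      (n : ℝ)⁻¹ * ∑ t ∈ Finset.Icc (1 : ℤ) n, centered μ Y i a t ω := by
  have hn' : (n : ℝ) ≠ 0 := by positivity
  simp only [sampleMean, Matrix.smul_apply, Matrix.sum_apply, smul_eq_mul, centered,
    Finset.sum_sub_distrib, Finset.sum_const, Int.card_Icc, nsmul_eq_mul]
  simp only [add_sub_cancel_right, Int.toNat_natCast]
  field_simp

/-- The estimation error of a sample autocovariance, expressed through normalized partial sums of
centered variables. -/
lemma sampleRowAutocov_sub_eq {n : ℕ} (hn : 0 < n) (i j : Fin p) (a b : Fin q) (h : ℤ) (ω : Ω) :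
    sampleRowAutocov Y n i j h ω a b - rowAutocov μ Y i j h a b =
      (n : ℝ)⁻¹ * ∑ t ∈ lagTimes n h,
        (centered μ Y i a (t + h) ω * centered μ Y j b t ω - rowAutocov μ Y i j h a b)
      + ((-1) * ((n : ℝ)⁻¹ * ∑ t ∈ Finset.Icc (1 : ℤ) n, (centered μ Y i a t ω - 0)))
        * ((n : ℝ)⁻¹ * ∑ t ∈ lagTimes n h, (centered μ Y j b t ω - 0))
      + ((-1) * ((n : ℝ)⁻¹ * ∑ t ∈ Finset.Icc (1 : ℤ) n, (centered μ Y j b t ω - 0)))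
        * ((n : ℝ)⁻¹ * ∑ t ∈ lagTimes n h, (centered μ Y i a (t + h) ω - 0))
      + ((lagTimes n h).card / n *
          ((n : ℝ)⁻¹ * ∑ t ∈ Finset.Icc (1 : ℤ) n, (centered μ Y i a t ω - 0)))
        * ((n : ℝ)⁻¹ * ∑ t ∈ Finset.Icc (1 : ℤ) n, (centered μ Y j b t ω - 0))
      + ((lagTimes n h).card / n - 1) * rowAutocov μ Y i j h a b := by
  have hn' : (n : ℝ) ≠ 0 := by positivity
  simp only [sub_zero]
  rw [← sampleMean_sub_meanMat hn, ← sampleMean_sub_meanMat hn]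
  have e : sampleRowAutocov Y n i j h ω a b = (n : ℝ)⁻¹ * ∑ t ∈ lagTimes n h,
      (centered μ Y i a (t + h) ω - (sampleMean Y n ω i a - meanMat μ (Y 0) i a)) *
        (centered μ Y j b t ω - (sampleMean Y n ω j b - meanMat μ (Y 0) j b)) := by
    simp only [sampleRowAutocov, Matrix.smul_apply, Matrix.sum_apply, smul_eq_mul,
      Matrix.vecMulVec_apply, centered, lagTimes]
    congr 1
    refine Finset.sum_congr rfl fun t _ => ?_
    simp
  rw [e]
  generalize sampleMean Y n ω i a - meanMat μ (Y 0) i a = u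
  generalize sampleMean Y n ω j b - meanMat μ (Y 0) j b = v
  -- `u` and `v` are the centered sample means
  have e2 : ∑ t ∈ lagTimes n h, (centered μ Y i a (t + h) ω - u) * (centered μ Y j b t ω - v) =
      ∑ t ∈ lagTimes n h, centered μ Y i a (t + h) ω * centered μ Y j b t ω
      - u * ∑ t ∈ lagTimes n h, centered μ Y j b t ω
      - v * ∑ t ∈ lagTimes n h, centered μ Y i a (t + h) ω + (lagTimes n h).card * (u * v) := by
    rw [Finset.mul_sum, Finset.mul_sum, ← nsmul_eq_mul, ← Finset.sum_const,
      ← Finset.sum_sub_distrib, ← Finset.sum_sub_distrib, ← Finset.sum_add_distrib]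
    exact Finset.sum_congr rfl fun t _ => by ring
  rw [e2, Finset.sum_sub_distrib, Finset.sum_const, nsmul_eq_mul]
  field_simp
  ring

lemma isBigOp_sampleRowAutocov [IsProbabilityMeasure μ]
    {γ K : ℝ} (hγ : 2 < γ)
    (hmeas : ∀ t i a, Measurable fun ω => Y t ω i a) (hstat : WeaklyStationary μ Y)
    (hmom : MomentBound μ Y γ K)
    (hmix : Summable fun k : ℕ => alphaMix μ Y (k + 1) ^ (1 - 2 / γ))
    (i j : Fin p) (a b : Fin q) (h : ℤ) :
    IsBigOp μ (fun n ω => sampleRowAutocov Y n i j h ω a b - rowAutocov μ Y i j h a b)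
      fun n => (√(n : ℝ))⁻¹ := by
  have habs := neg_abs_le h
  have habs' := le_abs_self h
  have hmem : ∀ t : ℤ, t ∈ Set.Icc (t - (h.natAbs : ℤ)) (t + h.natAbs) := fun t => by
    constructor <;> omega
  have hmem' : ∀ t : ℤ, t + h ∈ Set.Icc (t - (h.natAbs : ℤ)) (t + h.natAbs) := fun t => by
    constructor <;> omega
  have hfull : ∀ n : ℕ, (Finset.Icc (1 : ℤ) n).card ≤ n := fun n => by simp
  have S1 := fun (i : Fin p) (a : Fin q) (T : ℕ → Finset ℤ) (hT : ∀ n, (T n).card ≤ n) =>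
    isBigOp_partialSum hmeas hγ hmix (H := h.natAbs)
      (fun t => measurable_centered (μ := μ) (hmem t) i a)
      (fun t => (hmom.centered_rpow hmeas hstat i a t).1)
      (fun t => (hmom.centered_rpow hmeas hstat i a t).2)
      (fun t => integral_centered hγ hmeas hstat hmom i a t) T hT
  have S2 := isBigOp_partialSum hmeas hγ hmix (H := h.natAbs)
      (fun t => measurable_centered (μ := μ) (hmem' t) i a)
      (fun t => (hmom.centered_rpow hmeas hstat i a (t + h)).1)
      (fun t => (hmom.centered_rpow hmeas hstat i a (t + h)).2)
      (fun t => integral_centered hγ hmeas hstat hmom i a (t + h)) _ (card_lagTimes_le · h)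
  have S3 := isBigOp_partialSum hmeas hγ hmix (H := h.natAbs)
      (ξ := fun t ω => centered μ Y i a (t + h) ω * centered μ Y j b t ω)
      (fun t => (measurable_centered (μ := μ) (hmem' t) i a).mul (measurable_centered (hmem t) j b))
      (fun t => (hmom.centered_mul_rpow hmeas hstat i j a b (t + h) t).1)
      (fun t => (hmom.centered_mul_rpow hmeas hstat i j a b (t + h) t).2)
      (fun t => integral_centered_mul hstat i j a b h t) _ (card_lagTimes_le · h)
  have S4 := S1 j b _ (card_lagTimes_le · h)
  have hneg : ∀ (i : Fin p) (a : Fin q), IsBigOp μ (fun n ω => (-1) *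
      ((n : ℝ)⁻¹ * ∑ t ∈ Finset.Icc (1 : ℤ) n, (centered μ Y i a t ω - 0)))
      fun n => (√(n : ℝ))⁻¹ := fun i a =>
    (S1 i a _ hfull).mono_eventually (Eventually.of_forall fun n ω => by simp)
  have hratio : ∀ n : ℕ, |((lagTimes n h).card : ℝ) / n| ≤ 1 := fun n => by
    rw [abs_of_nonneg (by positivity)]
    exact div_le_one_of_le₀ (by exact_mod_cast card_lagTimes_le n h) (by positivity)
  have S5 : IsBigOp μ (fun n ω => (lagTimes n h).card / n *
          ((n : ℝ)⁻¹ * ∑ t ∈ Finset.Icc (1 : ℤ) n, (centered μ Y i a t ω - 0)))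
      fun n => (√(n : ℝ))⁻¹ :=
    (S1 i a _ hfull).mono_eventually (Eventually.of_forall fun n ω => by
      rw [abs_mul]
      exact mul_le_of_le_one_left (abs_nonneg _) (hratio n))
  have S6 : IsBigOp μ (fun (n : ℕ) (_ : Ω) =>
      (((lagTimes n h).card : ℝ) / n - 1) * rowAutocov μ Y i j h a b)
      fun n => (√(n : ℝ))⁻¹ := by
    refine IsBigOp.of_bound (C := 2 * |(h : ℝ)| * |rowAutocov μ Y i j h a b|) ?_
    filter_upwards [eventually_gt_atTop 0] with n hn ω
    have hn' : (0 : ℝ) < n := by exact_mod_cast hn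
    have h1 : |((lagTimes n h).card : ℝ) / n - 1| ≤ 2 * |(h : ℝ)| * (n : ℝ)⁻¹ := by
      have l1 := le_card_lagTimes n h
      have l2 : ((lagTimes n h).card : ℝ) ≤ n := by exact_mod_cast card_lagTimes_le n h
      rw [div_sub_one hn'.ne', abs_div, abs_of_pos hn', div_eq_mul_inv]
      gcongr
      rw [abs_le]; constructor <;> linarith [abs_nonneg (h : ℝ)]
    have h2 : (n : ℝ)⁻¹ ≤ (√(n : ℝ))⁻¹ := by
      have := inv_sqrt_nat_mul_self_le n
      rwa [← mul_inv, Real.mul_self_sqrt hn'.le] at this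
    rw [abs_mul]
    calc _ ≤ 2 * |(h : ℝ)| * (√(n : ℝ))⁻¹ * |rowAutocov μ Y i j h a b| := by
          gcongr; exact h1.trans (by gcongr)
      _ = _ := by ring
  refine IsBigOp.mono_eventually ((((S3.add ((hneg i a).mul_of_sqrt S4)).add
    ((hneg j b).mul_of_sqrt S2)).add (S5.mul_of_sqrt (S1 j b _ hfull))).add S6) ?_
  filter_upwards [eventually_gt_atTop 0] with n hn ω
  rw [sampleRowAutocov_sub_eq hn]

/-- The sum of the absolute estimation errors of all sample autocovariances up to lag `H`. -/
def autocovError (μ : Measure Ω) (Y : ℤ → Ω → Matrix (Fin p) (Fin q) ℝ) (H n : ℕ) (ω : Ω) : ℝ :=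
  ∑ x ∈ Finset.Icc (-(H : ℤ)) H ×ˢ (Finset.univ : Finset (Fin p × Fin p × Fin q × Fin q)),
    |sampleRowAutocov Y n x.2.1 x.2.2.1 x.1 ω x.2.2.2.1 x.2.2.2.2 -
      rowAutocov μ Y x.2.1 x.2.2.1 x.1 x.2.2.2.1 x.2.2.2.2|

lemma abs_sampleRowAutocov_sub_le {H : ℕ} {h : ℤ} (hh : h ∈ Finset.Icc (-(H : ℤ)) H) (n : ℕ)
    (ω : Ω) (i j : Fin p) (a b : Fin q) :
    |sampleRowAutocov Y n i j h ω a b - rowAutocov μ Y i j h a b| ≤ autocovError μ Y H n ω :=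
  Finset.single_le_sum (f := fun x : ℤ × Fin p × Fin p × Fin q × Fin q =>
    |sampleRowAutocov Y n x.2.1 x.2.2.1 x.1 ω x.2.2.2.1 x.2.2.2.2 -
      rowAutocov μ Y x.2.1 x.2.2.1 x.1 x.2.2.2.1 x.2.2.2.2|)
    (fun _ _ => abs_nonneg _) (a := (h, i, j, a, b)) (by simpa using hh)

lemma autocovError_nonneg (H n : ℕ) (ω : Ω) : 0 ≤ autocovError μ Y H n ω :=
  Finset.sum_nonneg fun _ _ => abs_nonneg _

lemma isBigOp_autocovError [IsProbabilityMeasure μ]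
    {γ K : ℝ} (hγ : 2 < γ)
    (hmeas : ∀ t i a, Measurable fun ω => Y t ω i a) (hstat : WeaklyStationary μ Y)
    (hmom : MomentBound μ Y γ K)
    (hmix : Summable fun k : ℕ => alphaMix μ Y (k + 1) ^ (1 - 2 / γ)) (H : ℕ) :
    IsBigOp μ (autocovError μ Y H) fun n => (√(n : ℝ))⁻¹ :=
  IsBigOp.sum _ fun x _ =>
    (isBigOp_sampleRowAutocov hγ hmeas hstat hmom hmix _ _ _ _ x.1).mono_eventually
      (Eventually.of_forall fun n ω => by rw [abs_abs])

end Rate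

/-! ### Perturbation of eigenvectors -/

section Perturbation

variable {E : Type*} [NormedAddCommGroup E] [InnerProductSpace ℝ E]

lemma norm_inv_norm_smul_sub_le {w u : E} (hu : ‖u‖ = 1) {t : ℝ} (h : ‖w - u‖ ≤ t)
    (ht : t ≤ 1 / 2) : ‖w‖ ≠ 0 ∧ ‖‖w‖⁻¹ • w - u‖ ≤ 2 * t := by
  have h1 : |‖w‖ - 1| ≤ t := by
    rw [← hu]; exact (abs_norm_sub_norm_le w u).trans h
  have hw : 0 < ‖w‖ := by linarith [(abs_le.1 h1).1]
  refine ⟨hw.ne', ?_⟩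
  have h2 : ‖‖w‖⁻¹ • w - w‖ ≤ t := by
    have : ‖w‖⁻¹ • w - w = (‖w‖⁻¹ * (1 - ‖w‖)) • w := by
      rw [mul_sub, mul_one, inv_mul_cancel₀ hw.ne', sub_smul, one_smul]
    rw [this, norm_smul, Real.norm_eq_abs, abs_mul, abs_inv, abs_of_pos hw, mul_comm, ← mul_assoc,
      mul_inv_cancel₀ hw.ne', one_mul, abs_sub_comm]
    exact h1
  calc ‖‖w‖⁻¹ • w - u‖ = ‖(‖w‖⁻¹ • w - w) + (w - u)‖ := by congr 1; abel
    _ ≤ t + t := (norm_add_le _ _).trans (add_le_add h2 h)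
    _ = 2 * t := by ring

/-- Vectors `b i` that are close to an orthonormal system can be orthonormalized by a small change,
and without leaving given subspaces that are pairwise equal or orthogonal (Gram–Schmidt). -/
lemma exists_orthonormal_near (k : ℕ) : ∃ C δ : ℝ, 0 ≤ C ∧ 0 < δ ∧
    ∀ (K : Fin k → Submodule ℝ E) (b u : Fin k → E) (ε : ℝ),
      (∀ i j, K i = K j ∨ K i ⟂ K j) → (∀ i, b i ∈ K i) → Orthonormal ℝ u → 0 ≤ ε → ε ≤ δ →
      (∀ i, ‖b i - u i‖ ≤ ε) →
      ∃ e : Fin k → E, Orthonormal ℝ e ∧ ∀ i, e i ∈ K i ∧ ‖e i - u i‖ ≤ C * ε := by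
  induction k with
  | zero =>
    refine ⟨0, 1, le_rfl, one_pos, fun K b u ε _ _ _ _ _ _ => ⟨u, ⟨fun i => i.elim0, ?_⟩, fun i =>
      i.elim0⟩⟩
    exact fun i => i.elim0
  | succ k ih =>
    obtain ⟨C, δ, hC, hδ, h⟩ := ih
    set C₁ : ℝ := 1 + k * (2 * C + 1) with hC₁
    have hC₁pos : 0 < C₁ := by positivity
    refine ⟨max C (2 * C₁), min (min δ 1) (1 / (2 * C₁)), le_max_of_le_left hC, by positivity, ?_⟩
    intro K b u ε hK hb hu hε0 hε hbu
    have hε1 : ε ≤ δ := hε.trans ((min_le_left _ _).trans (min_le_left _ _))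
    have hε2 : ε ≤ 1 := hε.trans ((min_le_left _ _).trans (min_le_right _ _))
    have hε3 : C₁ * ε ≤ 1 / 2 := by
      have := hε.trans (min_le_right _ _)
      rw [le_div_iff₀ (by positivity)] at this
      linarith
    obtain ⟨e, he, heK⟩ := h (fun i => K i.succ) (fun i => b i.succ) (fun i => u i.succ) ε
      (fun i j => hK _ _) (fun i => hb _) (hu.comp _ (Fin.succ_injective k)) hε0 hε1
      (fun i => hbu _)
    set w : E := b 0 - ∑ i, (inner ℝ (e i) (b 0) : ℝ) • e i with hw
    have hb0 : ‖b 0‖ ≤ 2 := by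
      calc ‖b 0‖ = ‖(b 0 - u 0) + u 0‖ := by congr 1; abel
        _ ≤ ε + 1 := (norm_add_le _ _).trans (add_le_add (hbu 0) (hu.1 0).le)
        _ ≤ 2 := by linarith
    have hinner : ∀ i, |(inner ℝ (e i) (b 0) : ℝ)| ≤ (2 * C + 1) * ε := fun i => by
      have e1 : (inner ℝ (e i) (b 0) : ℝ) = inner ℝ (e i - u i.succ) (b 0)
          + inner ℝ (u i.succ) (b 0 - u 0) := by
        rw [inner_sub_left, inner_sub_right, hu.2 (Fin.succ_ne_zero i)]; ring
      rw [e1]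
      calc _ ≤ ‖e i - u i.succ‖ * ‖b 0‖ + ‖u i.succ‖ * ‖b 0 - u 0‖ :=
            (abs_add_le _ _).trans (add_le_add (abs_real_inner_le_norm _ _)
              (abs_real_inner_le_norm _ _))
        _ ≤ (C * ε) * 2 + 1 * ε := by
            rw [hu.1]
            gcongr
            · exact (heK i).2
            · exact hbu 0
        _ = _ := by ring
    have hwu : ‖w - u 0‖ ≤ C₁ * ε := by
      calc ‖w - u 0‖ = ‖(b 0 - u 0) - ∑ i, (inner ℝ (e i) (b 0) : ℝ) • e i‖ := by
            rw [hw]; congr 1; abel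
        _ ≤ ε + ∑ i : Fin k, (2 * C + 1) * ε := by
            refine (norm_sub_le _ _).trans (add_le_add (hbu 0) ((norm_sum_le _ _).trans
              (Finset.sum_le_sum fun i _ => ?_)))
            rw [norm_smul, he.1, mul_one]
            exact hinner i
        _ = C₁ * ε := by simp [hC₁]; ring
    obtain ⟨hwn, hwu'⟩ := norm_inv_norm_smul_sub_le (hu.1 0) hwu hε3
    have hwK : w ∈ K 0 := by
      refine Submodule.sub_mem _ (hb 0) (Submodule.sum_mem _ fun i _ => ?_)
      rcases hK i.succ 0 with h0 | h0
      · exact Submodule.smul_mem _ _ (h0 ▸ (heK i).1)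
      · rw [Submodule.isOrtho_iff_inner_eq.1 h0 _ (heK i).1 _ (hb 0), zero_smul]
        exact Submodule.zero_mem _
    have hwe : ∀ i, (inner ℝ (e i) w : ℝ) = 0 := fun i => by
      rw [hw, inner_sub_right, he.inner_right_fintype, sub_self]
    refine ⟨Fin.cons (‖w‖⁻¹ • w) e, ⟨fun i => ?_, fun i j hij => ?_⟩, fun i => ?_⟩
    · refine Fin.cases ?_ (fun i => ?_) i
      · simp only [Fin.cons_zero]
        rw [norm_smul, norm_inv, norm_norm, inv_mul_cancel₀ hwn]
      · simpa using he.1 i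
    · revert hij
      refine Fin.cases ?_ (fun i => ?_) i <;> refine Fin.cases ?_ (fun j => ?_) j
      · exact fun h => absurd rfl h
      · intro _
        simp only [Fin.cons_zero, Fin.cons_succ]
        rw [real_inner_smul_left, real_inner_comm, hwe, mul_zero]
      · intro _
        simp only [Fin.cons_zero, Fin.cons_succ]
        rw [real_inner_smul_right, hwe, mul_zero]
      · intro hij
        simp only [Fin.cons_succ]
        exact he.2 fun h => hij (congrArg Fin.succ h)
    · refine Fin.cases ?_ (fun i => ?_) i
      · simp only [Fin.cons_zero]
        refine ⟨Submodule.smul_mem _ _ hwK, hwu'.trans ?_⟩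
        rw [← mul_assoc]
        gcongr
        exact le_max_right _ _
      · simp only [Fin.cons_succ]
        refine ⟨(heK i).1, (heK i).2.trans ?_⟩
        gcongr
        exact le_max_left _ _

/-- A vector that almost satisfies an eigenvalue equation of a symmetric operator is close to an
eigenspace: the one whose eigenvalue is closest to the approximate eigenvalue. -/
lemma exists_mem_eigenspace_near [FiniteDimensional ℝ E] {T : E →ₗ[ℝ] E} (hT : T.IsSymmetric) :
    ∃ C : ℝ, 0 ≤ C ∧ ∀ (v : E) (l : ℝ), ∃ c : ℝ, ∃ b ∈ Module.End.eigenspace T c,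
      ‖b - v‖ ≤ C * ‖T v - l • v‖ := by
  set n := Module.finrank ℝ E with hn
  set e := hT.eigenvectorBasis hn.symm
  set lam := hT.eigenvalues hn.symm
  set S : ℝ := ∑ i, ∑ j, |lam i - lam j|⁻¹ with hS
  have hSle : ∀ i j, |lam i - lam j|⁻¹ ≤ S := fun i j =>
    (Finset.single_le_sum (f := fun j => |lam i - lam j|⁻¹) (fun _ _ => by positivity)
      (Finset.mem_univ j)).trans (Finset.single_le_sum (f := fun i => ∑ j, |lam i - lam j|⁻¹)
        (fun _ _ => by positivity) (Finset.mem_univ i))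
  have hS0 : 0 ≤ S := by positivity
  refine ⟨2 * S, by positivity, fun v l => ?_⟩
  rcases isEmpty_or_nonempty (Fin n) with hem | hne
  · have hv : v = 0 := by
      rw [← e.sum_repr v]; simp
    exact ⟨0, 0, Submodule.zero_mem _, by simp [hv]⟩
  -- the nearest eigenvalue; all others are at distance at least half their distance to it from `l`
  obtain ⟨i₀, hi₀⟩ := Finite.exists_min fun i => |lam i - l|
  refine ⟨lam i₀, ∑ i, (if lam i = lam i₀ then (inner ℝ (e i) v : ℝ) else 0) • e i, ?_, ?_⟩
  · refine Submodule.sum_mem _ fun i _ => ?_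
    split_ifs with h
    · refine Submodule.smul_mem _ _ ?_
      rw [Module.End.mem_eigenspace_iff, ← h]
      exact hT.apply_eigenvectorBasis hn.symm i
    · simp
  · set b := ∑ i, (if lam i = lam i₀ then (inner ℝ (e i) v : ℝ) else 0) • e i with hb
    have hcoord : ∀ i, ‖(inner ℝ (e i) (b - v) : ℝ)‖ ^ 2 ≤
        (2 * S) ^ 2 * ‖(inner ℝ (e i) (T v - l • v) : ℝ)‖ ^ 2 := fun i => by
      have e1 : (inner ℝ (e i) b : ℝ) = if lam i = lam i₀ then (inner ℝ (e i) v : ℝ) else 0 := by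
        rw [hb, e.orthonormal.inner_right_fintype]
      have e2 : (inner ℝ (e i) (T v - l • v) : ℝ) = (lam i - l) * inner ℝ (e i) v := by
        rw [inner_sub_right, ← hT, hT.apply_eigenvectorBasis hn.symm i, inner_smul_left,
          inner_smul_right]
        simp only [RCLike.ofReal_real_eq_id, id_eq, conj_trivial]
        ring
      rw [inner_sub_right, e1, e2, ← mul_pow]
      refine pow_le_pow_left₀ (norm_nonneg _) ?_ 2
      split_ifs with h
      · simp only [sub_self, norm_zero]; positivity
      · rw [zero_sub, norm_neg, norm_mul, ← mul_assoc]
        refine le_mul_of_one_le_left (norm_nonneg _) ?_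
        have hne : 0 < |lam i - lam i₀| := abs_pos.2 (sub_ne_zero.2 h)
        have h2 : |lam i - lam i₀| ≤ 2 * |lam i - l| := by
          have := hi₀ i
          have := abs_sub_le (lam i) l (lam i₀)
          rw [abs_sub_comm l] at this
          linarith
        calc (1 : ℝ) = |lam i - lam i₀|⁻¹ * |lam i - lam i₀| := (inv_mul_cancel₀ hne.ne').symm
          _ ≤ S * (2 * |lam i - l|) := mul_le_mul (hSle _ _) h2 hne.le hS0
          _ = 2 * S * ‖lam i - l‖ := by rw [Real.norm_eq_abs]; ring
    have hsq : ‖b - v‖ ^ 2 ≤ (2 * S * ‖T v - l • v‖) ^ 2 := by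
      rw [mul_pow, ← e.sum_sq_norm_inner_right (b - v), ← e.sum_sq_norm_inner_right (T v - l • v),
        Finset.mul_sum]
      exact Finset.sum_le_sum fun i _ => hcoord i
    exact le_of_sq_le_sq hsq (by positivity)

/-- Orthonormal approximate eigenvectors of a symmetric operator are close to orthonormal exact
eigenvectors, with a distance proportional to the residuals. -/
lemma exists_orthonormal_eigenvectors_near [FiniteDimensional ℝ E] {T : E →ₗ[ℝ] E}
    (hT : T.IsSymmetric) (k : ℕ) : ∃ C δ : ℝ, 0 ≤ C ∧ 0 < δ ∧
    ∀ (u : Fin k → E) (l : Fin k → ℝ) (ε : ℝ), Orthonormal ℝ u → 0 ≤ ε → ε ≤ δ →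
      (∀ i, ‖T (u i) - l i • u i‖ ≤ ε) →
      ∃ e : Fin k → E, Orthonormal ℝ e ∧ ∀ i, (∃ c : ℝ, T (e i) = c • e i) ∧
        ‖e i - u i‖ ≤ C * ε := by
  obtain ⟨C₁, hC₁, h₁⟩ := exists_mem_eigenspace_near hT
  obtain ⟨C₂, δ, hC₂, hδ, h₂⟩ := exists_orthonormal_near (E := E) k
  refine ⟨C₂ * C₁, δ / (C₁ + 1), by positivity, by positivity, fun u l ε hu hε0 hε hres => ?_⟩
  choose c b hb hbu using fun i => h₁ (u i) (l i)
  have hε' : C₁ * ε ≤ δ := by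
    rw [le_div_iff₀ (by positivity)] at hε
    nlinarith
  obtain ⟨e, he, heK⟩ := h₂ (fun i => Module.End.eigenspace T (c i)) b u (C₁ * ε)
    (fun i j => by
      by_cases h : c i = c j
      · left; rw [h]
      · right
        rw [Submodule.isOrtho_iff_inner_eq]
        intro x hx y hy
        exact hT.orthogonalFamily_eigenspaces h ⟨x, hx⟩ ⟨y, hy⟩)
    hb hu (by positivity) hε' (fun i => (hbu i).trans (by gcongr; exact hres i))
  refine ⟨e, he, fun i => ⟨⟨c i, Module.End.mem_eigenspace_iff.1 (heK i).1⟩, ?_⟩⟩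
  rw [mul_assoc]
  exact (heK i).2

end Perturbation

/-! ### Eigenvector matrices -/

section Eigenbasis

variable {q : ℕ} {M V W S : Matrix (Fin q) (Fin q) ℝ}

lemma sum_col_mul_col (hV : Vᵀ * V = 1) (i j : Fin q) :
    ∑ a, V a i * V a j = if i = j then 1 else 0 := by
  have := congrFun₂ hV i j
  simpa [Matrix.mul_apply, Matrix.one_apply] using this

lemma sum_row_mul_row (hV : Vᵀ * V = 1) (a b : Fin q) :
    ∑ i, V a i * V b i = if a = b then 1 else 0 := by
  have := congrFun₂ (show V * Vᵀ = 1 from mul_eq_one_comm.1 hV) a b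
  simpa [Matrix.mul_apply, Matrix.one_apply] using this

lemma abs_entry_le_one (hV : Vᵀ * V = 1) (a i : Fin q) : |V a i| ≤ 1 := by
  have h := sum_col_mul_col hV i i
  rw [if_pos rfl] at h
  have : V a i * V a i ≤ 1 :=
    h ▸ Finset.single_le_sum (f := fun a => V a i * V a i) (fun a _ => mul_self_nonneg _)
      (Finset.mem_univ a)
  exact abs_le_one_iff_mul_self_le_one.2 this

lemma IsEigenbasis.mulVec_col (h : IsEigenbasis M V) (i : Fin q) :
    M *ᵥ V.col i = eigenvalueOf M V i • V.col i := by
  have h1 : M * V = V * (Vᵀ * M * V) := by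
    rw [← Matrix.mul_assoc, ← Matrix.mul_assoc, mul_eq_one_comm.1 h.1, Matrix.one_mul]
  ext a
  have h2 := congrFun₂ h1 a i
  rw [Matrix.mul_apply, Matrix.mul_apply (M := V), Finset.sum_eq_single (f := fun j => V a j * _) i
    (fun b _ hb => by rw [h.2 hb, mul_zero]) (by simp)] at h2
  simpa [Matrix.mulVec, dotProduct, eigenvalueOf, mul_comm] using h2

lemma isEigenbasis_of_mulVec_col (hV : Vᵀ * V = 1)
    (h : ∀ i, ∃ c : ℝ, M *ᵥ V.col i = c • V.col i) : IsEigenbasis M V := by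
  refine ⟨hV, fun i j hij => ?_⟩
  obtain ⟨c, hc⟩ := h j
  have e : (Vᵀ * M * V) i j = V.col i ⬝ᵥ (M *ᵥ V.col j) := by
    rw [Matrix.mul_assoc, Matrix.mul_apply]; rfl
  rw [e, hc, dotProduct_smul]
  have := sum_col_mul_col hV i j
  rw [if_neg hij] at this
  simpa [dotProduct] using Or.inr this

lemma IsEigenbasis.eigenvalueOf_eq (h : IsEigenbasis M V) {i : Fin q} {c : ℝ}
    (hc : M *ᵥ V.col i = c • V.col i) : eigenvalueOf M V i = c := by
  rw [h.mulVec_col] at hc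
  have h0 := sum_col_mul_col h.1 i i
  rw [if_pos rfl] at h0
  have h1 := congrArg (fun x => V.col i ⬝ᵥ x) hc
  have h2 : V.col i ⬝ᵥ V.col i = 1 := h0
  simpa [dotProduct_smul, h2] using h1

lemma norm_toLp_le_sum (x : Fin q → ℝ) : ‖(WithLp.toLp 2 x : EuclideanSpace ℝ (Fin q))‖ ≤
    ∑ a, |x a| := by
  rw [EuclideanSpace.norm_eq]
  refine Real.sqrt_le_iff.2 ⟨by positivity, ?_⟩
  simpa using Finset.sum_sq_le_sq_sum_of_nonneg (s := Finset.univ) (f := fun a => |x a|)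
    (fun a _ => abs_nonneg (x a))

lemma abs_le_norm_toLp (x : Fin q → ℝ) (a : Fin q) :
    |x a| ≤ ‖(WithLp.toLp 2 x : EuclideanSpace ℝ (Fin q))‖ :=
  PiLp.norm_apply_le (WithLp.toLp 2 x : EuclideanSpace ℝ (Fin q)) a

lemma orthonormal_toLp_col_iff :
    Orthonormal ℝ (fun i => (WithLp.toLp 2 (V.col i) : EuclideanSpace ℝ (Fin q))) ↔
      Vᵀ * V = 1 := by
  rw [orthonormal_iff_ite]
  constructor
  · intro h
    ext i j
    have := h i j
    rw [EuclideanSpace.inner_toLp_toLp] at this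
    rw [Matrix.one_apply, ← this, Matrix.mul_apply, dotProduct]
    exact Finset.sum_congr rfl fun a _ => by simp [mul_comm]
  · intro h i j
    rw [EuclideanSpace.inner_toLp_toLp, ← sum_col_mul_col h i j]
    exact Finset.sum_congr rfl fun a _ => by simp [mul_comm]

/-- Perturbation of eigenvectors: every eigenvector matrix of a small perturbation of the symmetric
matrix `W` is close to some eigenvector matrix of `W`. -/
lemma exists_isEigenbasis_near (hW : Wᵀ = W) : ∃ C δ : ℝ, 0 ≤ C ∧ 0 < δ ∧
    ∀ (S V : Matrix (Fin q) (Fin q) ℝ) (r : ℝ), IsEigenbasis S V → 0 ≤ r → r ≤ δ →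
      (∀ a b, |S a b - W a b| ≤ r) →
      ∃ V', IsEigenbasis W V' ∧ ∀ a i, |V a i - V' a i| ≤ C * r := by
  have hsymm : (toEuclideanLin W).IsSymmetric :=
    Matrix.isSymmetric_toEuclideanLin_iff.2 (by
      rw [Matrix.IsHermitian, Matrix.conjTranspose_eq_transpose_of_trivial, hW])
  obtain ⟨C, δ, hC, hδ, h⟩ := exists_orthonormal_eigenvectors_near hsymm q
  refine ⟨C * q ^ 2, δ / (q ^ 2 + 1), by positivity, by positivity, fun S V r hV hr0 hr hSW => ?_⟩
  have hres : ∀ i, ‖toEuclideanLin W (WithLp.toLp 2 (V.col i)) -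
      eigenvalueOf S V i • (WithLp.toLp 2 (V.col i) : EuclideanSpace ℝ (Fin q))‖ ≤ q ^ 2 * r := by
    intro i
    have e : toEuclideanLin W (WithLp.toLp 2 (V.col i)) -
        eigenvalueOf S V i • (WithLp.toLp 2 (V.col i) : EuclideanSpace ℝ (Fin q)) =
        WithLp.toLp 2 ((W - S) *ᵥ V.col i) := by
      rw [Matrix.toLpLin_toLp, Matrix.toLin'_apply, ← WithLp.toLp_smul,
        ← hV.mulVec_col i, ← WithLp.toLp_sub]
      congr 1
      rw [Matrix.sub_mulVec]
    rw [e]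
    refine (norm_toLp_le_sum _).trans ?_
    calc ∑ a, |((W - S) *ᵥ V.col i) a| ≤ ∑ _a : Fin q, ∑ _b : Fin q, r := by
          refine Finset.sum_le_sum fun a _ => ?_
          rw [Matrix.mulVec, dotProduct]
          refine (Finset.abs_sum_le_sum_abs _ _).trans (Finset.sum_le_sum fun b _ => ?_)
          rw [abs_mul, Matrix.sub_apply, abs_sub_comm]
          calc _ ≤ r * 1 := mul_le_mul (hSW a b) (abs_entry_le_one hV.1 b i) (abs_nonneg _) hr0
            _ = r := mul_one r
      _ = q ^ 2 * r := by simp; ring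
  have hsmall : (q : ℝ) ^ 2 * r ≤ δ := by
    rw [le_div_iff₀ (by positivity)] at hr
    nlinarith
  obtain ⟨e, he, hee⟩ := h (fun i => WithLp.toLp 2 (V.col i)) (eigenvalueOf S V) (q ^ 2 * r)
    (orthonormal_toLp_col_iff.2 hV.1) (by positivity) hsmall hres
  set V' : Matrix (Fin q) (Fin q) ℝ := Matrix.of fun a i => e i a with hV'
  have hcol : ∀ i, (WithLp.toLp 2 (V'.col i) : EuclideanSpace ℝ (Fin q)) = e i := fun i => rfl
  refine ⟨V', isEigenbasis_of_mulVec_col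
    (orthonormal_toLp_col_iff.1 (by simpa only [hcol] using he)) fun i => ?_, fun a i => ?_⟩
  · obtain ⟨c, hc⟩ := (hee i).1
    refine ⟨c, ?_⟩
    rw [← hcol i, Matrix.toLpLin_toLp, Matrix.toLin'_apply, ← WithLp.toLp_smul] at hc
    exact (WithLp.toLp_injective 2) hc
  · have := (abs_le_norm_toLp (V'.col i - V.col i) a).trans (hee i).2
    rw [abs_sub_comm, mul_assoc]
    exact this

/-- The columns of `U` and `V` agree up to signs and up to entrywise errors of at most `ε`. -/
def SignClose (U V : Matrix (Fin q) (Fin q) ℝ) (ε : ℝ) : Prop :=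
  ∀ i, ∃ s : ℝ, (s = 1 ∨ s = -1) ∧ ∀ a, |U a i - s * V a i| ≤ ε

lemma sum_sub_sq_eq {U : Matrix (Fin q) (Fin q) ℝ} (hU : Uᵀ * U = 1) (hV : Vᵀ * V = 1) {s : ℝ}
    (hs : s = 1 ∨ s = -1) (i : Fin q) :
    ∑ a, (U a i - s * V a i) ^ 2 = 2 - 2 * (s * (U.col i ⬝ᵥ V.col i)) := by
  have h1 := sum_col_mul_col hU i i
  have h2 := sum_col_mul_col hV i i
  rw [if_pos rfl] at h1 h2
  have hs2 : s * s = 1 := by rcases hs with rfl | rfl <;> norm_num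
  have e : ∀ a, (U a i - s * V a i) ^ 2 =
      U a i * U a i + (s * s) * (V a i * V a i) - 2 * (s * (U a i * V a i)) := fun a => by ring
  simp only [e, Finset.sum_sub_distrib, Finset.sum_add_distrib, ← Finset.mul_sum, h1, h2, hs2]
  simp only [dotProduct, Matrix.col_apply]
  ring

lemma exists_sign_mul_eq_abs (x : ℝ) : ∃ s : ℝ, (s = 1 ∨ s = -1) ∧ s * x = |x| := by
  rcases le_total 0 x with h | h
  · exact ⟨1, Or.inl rfl, by rw [abs_of_nonneg h, one_mul]⟩
  · exact ⟨-1, Or.inr rfl, by rw [abs_of_nonpos h]; ring⟩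

/-- If some eigenvector matrix is within `ε` of `U`, then the columnwise closest one is close to `U`
up to signs: it attains at least the same value of `∑ |uᵢ ⬝ vᵢ|`, none of whose terms
exceeds `1`. -/
lemma IsClosestEigenbasis.signClose {U V' : Matrix (Fin q) (Fin q) ℝ}
    (h : IsClosestEigenbasis M U V) (hU : Uᵀ * U = 1) (hV' : IsEigenbasis M V') {ε : ℝ}
    (hε : 0 ≤ ε) (hUV' : ∀ a i, |U a i - V' a i| ≤ ε) : SignClose U V (q * ε) := by
  have h1 : ∀ i, 1 - q * ε ^ 2 / 2 ≤ |U.col i ⬝ᵥ V'.col i| := fun i => by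
    have e := sum_sub_sq_eq hU hV'.1 (Or.inl rfl) i
    have hle : ∑ a, (U a i - 1 * V' a i) ^ 2 ≤ q * ε ^ 2 := by
      calc _ ≤ ∑ _a : Fin q, ε ^ 2 := Finset.sum_le_sum fun a _ => by
            rw [one_mul, ← sq_abs]
            exact pow_le_pow_left₀ (abs_nonneg _) (hUV' a i) 2
        _ = _ := by simp
    rw [e] at hle
    linarith [le_abs_self (U.col i ⬝ᵥ V'.col i)]
  have h2 : ∀ i, |U.col i ⬝ᵥ V.col i| ≤ 1 := fun i => by
    obtain ⟨s, hs, hsx⟩ := exists_sign_mul_eq_abs (U.col i ⬝ᵥ V.col i)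
    have e := sum_sub_sq_eq hU h.1.1 hs i
    rw [hsx] at e
    have : 0 ≤ ∑ a, (U a i - s * V a i) ^ 2 := by positivity
    linarith
  have h3 : (q : ℝ) - q * (q * ε ^ 2 / 2) ≤ ∑ i, |U.col i ⬝ᵥ V.col i| := by
    refine le_trans ?_ (h.2 V' hV')
    calc (q : ℝ) - q * (q * ε ^ 2 / 2) = ∑ _i : Fin q, (1 - q * ε ^ 2 / 2) := by
          simp
      _ ≤ _ := Finset.sum_le_sum fun i _ => h1 i
  intro i
  obtain ⟨s, hs, hsx⟩ := exists_sign_mul_eq_abs (U.col i ⬝ᵥ V.col i)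
  refine ⟨s, hs, fun a => ?_⟩
  have h4 : ∑ j, (1 - |U.col j ⬝ᵥ V.col j|) ≤ q * (q * ε ^ 2 / 2) := by
    rw [Finset.sum_sub_distrib]; simp; linarith
  have h5 := (Finset.single_le_sum (f := fun j => 1 - |U.col j ⬝ᵥ V.col j|)
    (fun j _ => sub_nonneg.2 (h2 j)) (Finset.mem_univ i)).trans h4
  have e := sum_sub_sq_eq hU h.1.1 hs i
  rw [hsx] at e
  have h6 := Finset.single_le_sum (f := fun a => (U a i - s * V a i) ^ 2)
    (fun a _ => sq_nonneg _) (Finset.mem_univ a)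
  refine abs_le_of_sq_le_sq (h6.trans ?_) (by positivity)
  rw [e]
  linarith [show (q * ε) ^ 2 = 2 * (q * (q * ε ^ 2 / 2)) by ring]

end Eigenbasis

/-! ### Distinct eigenvalues and bilinear forms -/

section SimpleSpectrum

variable {q : ℕ} {W S U V V' : Matrix (Fin q) (Fin q) ℝ}

/-- Entries of `Uᵀ V'` for two eigenvector matrices of a symmetric matrix vanish unless the
eigenvalues agree. -/
lemma IsEigenbasis.transpose_mul_eq_zero (hW : Wᵀ = W) (hU : IsEigenbasis W U)
    (hV' : IsEigenbasis W V') {b i : Fin q} (h : eigenvalueOf W U b ≠ eigenvalueOf W V' i) :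
    (Uᵀ * V') b i = 0 := by
  have e : (Uᵀ * V') b i = U.col b ⬝ᵥ V'.col i := rfl
  have h1 : U.col b ⬝ᵥ (W *ᵥ V'.col i) = (W *ᵥ U.col b) ⬝ᵥ V'.col i := by
    rw [Matrix.dotProduct_mulVec, ← Matrix.mulVec_transpose, hW]
  rw [hV'.mulVec_col, hU.mulVec_col, dotProduct_smul, smul_dotProduct, smul_eq_mul,
    smul_eq_mul] at h1
  have h2 : (eigenvalueOf W U b - eigenvalueOf W V' i) * (U.col b ⬝ᵥ V'.col i) = 0 := by
    linarith
  rw [e]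
  exact (mul_eq_zero.1 h2).resolve_left (sub_ne_zero.2 h)

lemma transpose_mul_orth (hU : Uᵀ * U = 1) (hV : Vᵀ * V = 1) : (Uᵀ * V)ᵀ * (Uᵀ * V) = 1 := by
  rw [Matrix.transpose_mul, Matrix.transpose_transpose, Matrix.mul_assoc, ← Matrix.mul_assoc U,
    mul_eq_one_comm.1 hU, Matrix.one_mul, hV]

lemma eq_mul_transpose_mul (hU : Uᵀ * U = 1) (V : Matrix (Fin q) (Fin q) ℝ) :
    V = U * (Uᵀ * V) := by
  rw [← Matrix.mul_assoc, mul_eq_one_comm.1 hU, Matrix.one_mul]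

/-- If the eigenvalues are distinct and the approximating eigenvalues are ordered in the same way,
then two eigenvector matrices of `W` agree up to signs. -/
lemma IsEigenbasis.eq_sign_mul_of_strictAnti (hW : Wᵀ = W) (hU : IsEigenbasis W U)
    (hV' : IsEigenbasis W V') (hanti : StrictAnti (eigenvalueOf W U)) {l : Fin q → ℝ}
    (hl : Antitone l) {ε : ℝ} (hclose : ∀ i, |l i - eigenvalueOf W V' i| ≤ ε)
    (hgap : ∀ a b, a ≠ b → 2 * ε < |eigenvalueOf W U a - eigenvalueOf W U b|) (i : Fin q) :
    ∃ s : ℝ, (s = 1 ∨ s = -1) ∧ ∀ a, V' a i = s * U a i := by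
  set O := Uᵀ * V' with hO
  have hOO : Oᵀ * O = 1 := transpose_mul_orth hU.1 hV'.1
  have hex : ∀ i, ∃ b, O b i ≠ 0 := fun i => by
    by_contra hcon
    push Not at hcon
    have := sum_col_mul_col hOO i i
    simp [hcon] at this
  choose σ hσ using hex
  have hlam : ∀ i, eigenvalueOf W U (σ i) = eigenvalueOf W V' i := fun i => by
    by_contra hcon
    exact hσ i (hU.transpose_mul_eq_zero hW hV' hcon)
  have hzero : ∀ i b, b ≠ σ i → O b i = 0 := fun i b hb => by
    refine hU.transpose_mul_eq_zero hW hV' fun hcon => hb (hanti.injective ?_)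
    rw [hcon, hlam]
  have hinj : Function.Injective σ := fun i j hij => by
    by_contra hne
    have h0 := sum_col_mul_col hOO i j
    rw [if_neg hne, Finset.sum_eq_single (σ i) (fun b _ hb => by rw [hzero i b hb, zero_mul])
      (by simp)] at h0
    rcases mul_eq_zero.1 h0 with h | h
    · exact hσ i h
    · rw [hij] at h; exact hσ j h
  have hmono : StrictMono σ := fun i j hij => by
    refine hanti.lt_iff_gt.1 ?_
    by_contra hcon
    push Not at hcon
    have hne : σ j ≠ σ i := fun h => hij.ne' (hinj h)
    have h1 := hgap (σ j) (σ i) hne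
    rw [abs_of_nonneg (sub_nonneg.2 hcon), hlam, hlam] at h1
    have h2 := abs_le.1 (hclose i)
    have h3 := abs_le.1 (hclose j)
    have h4 := hl hij.le
    linarith [h2.1, h3.2, h2.2, h3.1]
  -- a strictly increasing self-map of `Fin q` is the identity
  have hid : σ = id := (hmono.range_inj strictMono_id).1 (by
    rw [(Finite.surjective_of_injective hinj).range_eq, Set.range_id])
  have hsq := sum_col_mul_col hOO i i
  rw [if_pos rfl, Finset.sum_eq_single i (fun b _ hb => by
    rw [hzero i b (by rw [hid]; exact hb), zero_mul]) (by simp)] at hsq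
  refine ⟨O i i, mul_self_eq_one_iff.1 hsq, fun a => ?_⟩
  have h5 := congrFun₂ (eq_mul_transpose_mul hU.1 V') a i
  rw [← hO, Matrix.mul_apply, Finset.sum_eq_single i (fun b _ hb => by
    rw [hzero i b (by rw [hid]; exact hb), mul_zero]) (by simp)] at h5
  rw [h5, mul_comm]

/-- Perturbation bound for bilinear forms. -/
lemma abs_bilin_sub_le {S W : Matrix (Fin q) (Fin q) ℝ} {u u' v v' : Fin q → ℝ} {ε B : ℝ}
    (hε : 0 ≤ ε) (hS : ∀ a b, |S a b - W a b| ≤ ε) (hW : ∀ a b, |W a b| ≤ B)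
    (hu : ∀ a, |u a - u' a| ≤ ε) (hv : ∀ a, |v a - v' a| ≤ ε) (hu1 : ∀ a, |u a| ≤ 1)
    (hu1' : ∀ a, |u' a| ≤ 1) (hv1 : ∀ a, |v a| ≤ 1) :
    |u ⬝ᵥ (S *ᵥ v) - u' ⬝ᵥ (W *ᵥ v')| ≤ q ^ 2 * (1 + 2 * B) * ε := by
  have e : u ⬝ᵥ (S *ᵥ v) - u' ⬝ᵥ (W *ᵥ v') =
      ∑ a, ∑ b, (u a * (S a b * v b) - u' a * (W a b * v' b)) := by
    simp only [dotProduct, Matrix.mulVec, Finset.mul_sum, Finset.sum_sub_distrib]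
  rw [e]
  calc _ ≤ ∑ _a : Fin q, ∑ _b : Fin q, (1 + 2 * B) * ε := by
        refine (Finset.abs_sum_le_sum_abs _ _).trans (Finset.sum_le_sum fun a _ =>
          (Finset.abs_sum_le_sum_abs _ _).trans (Finset.sum_le_sum fun b _ => ?_))
        have hB : 0 ≤ B := (abs_nonneg _).trans (hW a b)
        have e1 : u a * (S a b * v b) - u' a * (W a b * v' b) =
          u a * (S a b - W a b) * v b + (u a - u' a) * W a b * v b
            + u' a * W a b * (v b - v' b) := by ring
        rw [e1]
        have t1 : |u a * (S a b - W a b) * v b| ≤ 1 * ε * 1 := by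
          rw [abs_mul, abs_mul]
          gcongr
          exacts [hu1 a, hS a b, hv1 b]
        have t2 : |(u a - u' a) * W a b * v b| ≤ ε * B * 1 := by
          rw [abs_mul, abs_mul]
          gcongr
          exacts [hu a, hW a b, hv1 b]
        have t3 : |u' a * W a b * (v b - v' b)| ≤ 1 * B * ε := by
          rw [abs_mul, abs_mul]
          gcongr
          exacts [hu1' a, hW a b, hv b]
        refine (abs_add_le _ _).trans ((add_le_add ((abs_add_le _ _).trans
          (add_le_add t1 t2)) t3).trans (le_of_eq (by ring)))
    _ = _ := by simp; ring

lemma eigenvalueOf_eq_dotProduct (M V : Matrix (Fin q) (Fin q) ℝ) (i : Fin q) :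
    eigenvalueOf M V i = V.col i ⬝ᵥ (M *ᵥ V.col i) := by
  rw [eigenvalueOf, Matrix.mul_assoc, Matrix.mul_apply]; rfl

lemma exists_entry_bound {ι κ : Type*} [Fintype ι] [Fintype κ] (W : Matrix ι κ ℝ) :
    ∃ B : ℝ, 0 ≤ B ∧ ∀ a b, |W a b| ≤ B := by
  refine ⟨∑ a, ∑ b, |W a b|, by positivity, fun a b => ?_⟩
  exact (Finset.single_le_sum (f := fun b => |W a b|) (fun _ _ => abs_nonneg _)
    (Finset.mem_univ b)).trans (Finset.single_le_sum (f := fun a => ∑ b, |W a b|)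
      (fun _ _ => by positivity) (Finset.mem_univ a))

/-- Distinct eigenvalues: the ordered eigenvectors of a small perturbation are close, up to signs,
to the ordered eigenvectors of `W`. -/
lemma exists_signClose_of_strictAnti (hW : Wᵀ = W) (hU : IsEigenbasis W U)
    (hanti : StrictAnti (eigenvalueOf W U)) : ∃ C δ : ℝ, 0 ≤ C ∧ 0 < δ ∧
    ∀ (S V : Matrix (Fin q) (Fin q) ℝ) (r : ℝ), IsEigenbasis S V → Antitone (eigenvalueOf S V) →
      0 ≤ r → r ≤ δ → (∀ a b, |S a b - W a b| ≤ r) → SignClose V U (C * r) := by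
  obtain ⟨C, δ, hC, hδ, h⟩ := exists_isEigenbasis_near hW
  obtain ⟨B, hB0, hB⟩ := exists_entry_bound W
  obtain ⟨ρ, hρ, hgap⟩ : ∃ ρ : ℝ, 0 < ρ ∧ ∀ a b, a ≠ b →
      ρ ≤ |eigenvalueOf W U a - eigenvalueOf W U b| := by
    have hfin : Set.Finite {x : Fin q × Fin q | x.1 ≠ x.2} := Set.toFinite _
    rcases Set.eq_empty_or_nonempty {x : Fin q × Fin q | x.1 ≠ x.2} with hem | hne
    · exact ⟨1, one_pos, fun a b hab => absurd (show (a, b) ∈ {x : Fin q × Fin q | x.1 ≠ x.2} from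
        hab) (by rw [hem]; simp)⟩
    · obtain ⟨x, hx, hmin⟩ := Set.exists_min_image _
        (fun x : Fin q × Fin q => |eigenvalueOf W U x.1 - eigenvalueOf W U x.2|) hfin hne
      exact ⟨_, abs_pos.2 (sub_ne_zero.2 fun h => hx (hanti.injective h)),
        fun a b hab => hmin (a, b) hab⟩
  set D : ℝ := q ^ 2 * (1 + 2 * B) * (C + 1) with hD
  have hD0 : 0 ≤ D := by positivity
  refine ⟨C, min δ (ρ / (4 * (D + 1))), hC, by positivity, fun S V r hV hVa hr0 hr hSW => ?_⟩
  obtain ⟨V', hV', hVV'⟩ := h S V r hV hr0 (hr.trans (min_le_left _ _)) hSW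
  have hrD : 2 * (D * r) < ρ := by
    have h1 := hr.trans (min_le_right _ _)
    rw [le_div_iff₀ (by positivity)] at h1
    nlinarith
  have hclose : ∀ i, |eigenvalueOf S V i - eigenvalueOf W V' i| ≤ D * r := fun i => by
    have hCr : C * r ≤ (C + 1) * r := by nlinarith
    have := abs_bilin_sub_le (ε := (C + 1) * r) (by positivity)
      (fun a b => (hSW a b).trans (by nlinarith)) hB (fun a => (hVV' a i).trans hCr)
      (fun a => (hVV' a i).trans hCr) (fun a => abs_entry_le_one hV.1 a i)
      (fun a => abs_entry_le_one hV'.1 a i) (fun a => abs_entry_le_one hV.1 a i)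
    rw [eigenvalueOf_eq_dotProduct, eigenvalueOf_eq_dotProduct]
    refine le_trans this (le_of_eq ?_)
    rw [hD]; ring
  intro i
  obtain ⟨s, hs, hsV⟩ := hU.eq_sign_mul_of_strictAnti hW hV' hanti hVa hclose
    (fun a b hab => hrD.trans_le (hgap a b hab)) i
  exact ⟨s, hs, fun a => by rw [← hsV]; exact hVV' a i⟩

end SimpleSpectrum

/-! ### Block structure of the eigenvectors and the distance of column spaces -/

section Blocks

variable {q q₁ : ℕ} {g : Fin q → Fin q₁} {W D A V V' : Matrix (Fin q) (Fin q) ℝ}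

/-- The entries of a vector that belong to block `j`. -/
def blockPart (g : Fin q → Fin q₁) (x : Fin q → ℝ) (j : Fin q₁) : Block g j → ℝ :=
  fun c => x c.1

/-- The block of an eigenvector of a block-diagonal matrix is an eigenvector of the diagonal
block, unless it vanishes. -/
lemma mem_spectrum_diagBlock (hD : ∀ a b, g a ≠ g b → D a b = 0) {x : Fin q → ℝ} {l : ℝ}
    (hx : D *ᵥ x = l • x) {b : Fin q} (hb : x b ≠ 0) :
    l ∈ spectrum ℝ (diagBlock g D (g b)) := by
  have h1 : diagBlock g D (g b) *ᵥ blockPart g x (g b) = l • blockPart g x (g b) := by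
    ext c
    have h2 := congrFun hx c.1
    simp only [Pi.smul_apply, smul_eq_mul, Matrix.mulVec, dotProduct] at h2 ⊢
    have h3 : ∑ d, D c.1 d * x d = ∑ d : Block g (g b), D c.1 d.1 * x d.1 := by
      rw [← Finset.sum_filter_of_ne (p := fun d => g d = g b) fun d _ hne => ?_,
        Finset.sum_subtype (p := fun d => g d = g b) _ (by simp)]
      by_contra hcon
      exact hne (by rw [hD c.1 d (by rw [c.2]; exact fun h => hcon h.symm), zero_mul])
    exact h3.symm.trans h2
  rw [← Matrix.spectrum_toLin', ← Module.End.hasEigenvalue_iff_mem_spectrum]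
  refine Module.End.hasEigenvalue_of_hasEigenvector (x := blockPart g x (g b)) ⟨?_, fun h => ?_⟩
  · rw [Module.End.mem_eigenspace_iff, Matrix.toLin'_apply, h1]
  · exact hb (congrFun h ⟨b, rfl⟩)

/-- If the spectra of the diagonal blocks are disjoint, every eigenvector of the block-diagonal
matrix lives in a single block, and the number of eigenvectors in an orthonormal basis that
live in a block is the size of the block. -/
lemma exists_perm_of_blockDiagonal (hA : Aᵀ * A = 1)
    (hD : ∀ a b, g a ≠ g b → (Aᵀ * W * A) a b = 0)
    (hgap : ∀ i j, i < j → ∀ l ∈ spectrum ℝ (diagBlock g (Aᵀ * W * A) i),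
      l ∉ spectrum ℝ (diagBlock g (Aᵀ * W * A) j))
    (hV' : IsEigenbasis W V') :
    ∃ π : Equiv.Perm (Fin q), ∀ a b, g b ≠ g a → (Aᵀ * V') b (π a) = 0 := by
  set O := Aᵀ * V' with hO
  have hOO : Oᵀ * O = 1 := transpose_mul_orth hA hV'.1
  have heig : ∀ i, (Aᵀ * W * A) *ᵥ O.col i = eigenvalueOf W V' i • O.col i := fun i => by
    have e : O.col i = Aᵀ *ᵥ V'.col i := by
      ext a; rfl
    rw [e, Matrix.mulVec_mulVec, Matrix.mul_assoc, mul_eq_one_comm.1 hA, Matrix.mul_one,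
      ← Matrix.mulVec_mulVec, hV'.mulVec_col, Matrix.mulVec_smul]
  have hex : ∀ i, ∃ b, O b i ≠ 0 := fun i => by
    by_contra hcon
    push Not at hcon
    have := sum_col_mul_col hOO i i
    simp [hcon] at this
  choose σ hσ using hex
  have hzero : ∀ i b, g b ≠ g (σ i) → O b i = 0 := fun i b hb => by
    by_contra hcon
    have h1 := mem_spectrum_diagBlock hD (heig i) (b := b) hcon
    have h2 := mem_spectrum_diagBlock hD (heig i) (b := σ i) (hσ i)
    rcases lt_or_gt_of_ne hb with h | h
    · exact hgap _ _ h _ h1 h2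
    · exact hgap _ _ h _ h2 h1
  -- the squared entries of `O` in the rows of block `j`, summed by rows and by columns
  have hcard : ∀ j : Fin q₁, Fintype.card {a // g a = j} = Fintype.card {i // g (σ i) = j} := by
    intro j
    have h1 : ∀ i, ∑ b, (if g b = j then O b i * O b i else 0) = if g (σ i) = j then 1 else 0 := by
      intro i
      split_ifs with h
      · have := sum_col_mul_col hOO i i
        rw [if_pos rfl] at this
        rw [← this]
        refine Finset.sum_congr rfl fun b _ => ?_
        split_ifs with hb
        · rfl
        · rw [hzero i b (by rw [h]; exact hb), zero_mul]
      · refine Finset.sum_eq_zero fun b _ => ?_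
        split_ifs with hb
        · rw [hzero i b (by rw [hb]; exact fun h' => h h'.symm), zero_mul]
        · rfl
    have h2 : ∀ b, ∑ i, (if g b = j then O b i * O b i else 0) = if g b = j then 1 else 0 := by
      intro b
      split_ifs with h
      · have := sum_row_mul_row hOO b b
        rwa [if_pos rfl] at this
      · simp
    have h3 : ((∑ b : Fin q, if g b = j then 1 else 0 : ℝ)) =
        ∑ i : Fin q, if g (σ i) = j then 1 else 0 := by
      rw [← Finset.sum_congr rfl fun i _ => h1 i, ← Finset.sum_congr rfl fun b _ => h2 b,
        Finset.sum_comm]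
    rw [Finset.sum_boole, Finset.sum_boole] at h3
    rw [Fintype.card_subtype, Fintype.card_subtype]
    exact_mod_cast h3
  let π : Fin q ≃ Fin q := Equiv.ofFiberEquiv (f := g) (g := fun i => g (σ i))
    fun j => Fintype.equivOfCardEq (hcard j)
  refine ⟨π, fun a b hab => hzero (π a) b ?_⟩
  have : g (σ (π a)) = g a := Equiv.ofFiberEquiv_map (f := g) (g := fun i => g (σ i)) _ a
  rw [this]; exact hab

lemma colBlock_transpose_mul (hV : Vᵀ * V = 1) (j : Fin q₁) :
    (colBlock g V j)ᵀ * colBlock g V j = 1 := by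
  ext a b
  have := sum_col_mul_col hV a.1 b.1
  simpa [colBlock, Matrix.mul_apply, Matrix.one_apply, Subtype.ext_iff] using this

lemma colProj_of_orthonormal {ι : Type*} [Fintype ι] [DecidableEq ι] {H : Matrix (Fin q) ι ℝ}
    (hH : Hᵀ * H = 1) : colProj H = H * Hᵀ := by
  rw [colProj, hH, inv_one, Matrix.mul_one]

lemma trace_colProj_mul {ι κ : Type*} [Fintype ι] [Fintype κ] [DecidableEq ι] [DecidableEq κ]
    {H : Matrix (Fin q) ι ℝ} {G : Matrix (Fin q) κ ℝ} (hH : Hᵀ * H = 1) (hG : Gᵀ * G = 1) :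
    (colProj H * colProj G).trace = ∑ a, ∑ b, (Gᵀ * H) b a ^ 2 := by
  rw [colProj_of_orthonormal hH, colProj_of_orthonormal hG]
  have e : H * Hᵀ * (G * Gᵀ) = (H * (Gᵀ * H)ᵀ) * Gᵀ := by
    simp only [Matrix.transpose_mul, Matrix.transpose_transpose, Matrix.mul_assoc]
  rw [e, Matrix.trace_mul_comm, ← Matrix.mul_assoc, Matrix.trace_mul_comm, Matrix.trace]
  refine Finset.sum_congr rfl fun a _ => ?_
  rw [Matrix.diag_apply, Matrix.mul_apply]
  exact Finset.sum_congr rfl fun b _ => by rw [Matrix.transpose_apply, sq]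

/-- If the coordinates of the columns of `U` with respect to the columns of `A` outside the own
block are at most `ε`, then the column spaces of corresponding blocks are close. -/
lemma spaceDist_colBlock_le {U : Matrix (Fin q) (Fin q) ℝ} (hg : Function.Surjective g)
    (hU : Uᵀ * U = 1) (hA : Aᵀ * A = 1) {ε : ℝ} (hε : 0 ≤ ε)
    (h : ∀ a b, g b ≠ g a → |(Aᵀ * U) b a| ≤ ε) (j : Fin q₁) :
    spaceDist (colBlock g U j) (colBlock g A j) ≤ q * ε := by
  have hOO := transpose_mul_orth hA hU
  have hne : Nonempty (Block g j) := let ⟨c, hc⟩ := hg j; ⟨⟨c, hc⟩⟩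
  have hcard : (0 : ℝ) < Fintype.card (Block g j) := by exact_mod_cast Fintype.card_pos
  have hcol : ∀ a : Block g j, 1 - q * ε ^ 2 ≤
      ∑ b : Block g j, ((colBlock g A j)ᵀ * colBlock g U j) b a ^ 2 := fun a => by
    have h1 := sum_col_mul_col hOO a.1 a.1
    rw [if_pos rfl, ← Finset.sum_filter_add_sum_filter_not _ (fun b => g b = j)] at h1
    have h2 : ∑ b ∈ Finset.univ.filter (fun b => ¬ g b = j), (Aᵀ * U) b a.1 * (Aᵀ * U) b a.1 ≤
        q * ε ^ 2 := by
      calc _ ≤ ∑ _b ∈ Finset.univ.filter (fun b => ¬ g b = j), ε ^ 2 := by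
            refine Finset.sum_le_sum fun b hb => ?_
            rw [← sq, ← sq_abs]
            refine pow_le_pow_left₀ (abs_nonneg _) (h a.1 b ?_) 2
            rw [a.2]; exact (Finset.mem_filter.1 hb).2
        _ ≤ ∑ _b : Fin q, ε ^ 2 :=
            Finset.sum_le_sum_of_subset_of_nonneg (Finset.filter_subset _ _)
              fun _ _ _ => sq_nonneg _
        _ = _ := by simp
    have h3 : ∑ b ∈ Finset.univ.filter (fun b => g b = j), (Aᵀ * U) b a.1 * (Aᵀ * U) b a.1 =
        ∑ b : Block g j, ((colBlock g A j)ᵀ * colBlock g U j) b a ^ 2 := by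
      rw [Finset.sum_subtype (p := fun b => g b = j) _ (by simp)]
      exact Finset.sum_congr rfl fun b _ => by rw [sq]; rfl
    linarith
  rw [spaceDist, min_self, trace_colProj_mul (colBlock_transpose_mul hU j)
    (colBlock_transpose_mul hA j)]
  refine Real.sqrt_le_iff.2 ⟨by positivity, ?_⟩
  have h4 : (Fintype.card (Block g j) : ℝ) * (1 - q * ε ^ 2) ≤
      ∑ a : Block g j, ∑ b : Block g j, ((colBlock g A j)ᵀ * colBlock g U j) b a ^ 2 := by
    rw [← nsmul_eq_mul]
    exact Finset.card_nsmul_le_sum _ _ _ fun a _ => hcol a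
  have h5 : 1 - q * ε ^ 2 ≤ (∑ a : Block g j, ∑ b : Block g j,
      ((colBlock g A j)ᵀ * colBlock g U j) b a ^ 2) / (Fintype.card (Block g j) : ℝ) := by
    rw [le_div_iff₀ hcard]; linarith
  have hq : (1 : ℝ) ≤ q := by
    have : 0 < q := Fin.pos (hg j).choose
    exact_mod_cast this
  have h6 : (q : ℝ) * ε ^ 2 ≤ (q * ε) ^ 2 := by
    rw [mul_pow]
    gcongr
    nlinarith
  linarith

end Blocks

/-! ### Order statistics and the ratio rule -/

section RatioRule

variable {q : ℕ}

lemma le_getElem_iff_lt_countP {x : ℝ} {l : List ℝ} (hl : l.Pairwise (· ≥ ·)) {i : ℕ}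
    (hi : i < l.length) : x ≤ l[i] ↔ i < l.countP fun y => decide (x ≤ y) := by
  induction l generalizing i with
  | nil => simp at hi
  | cons a t ih =>
    rw [List.pairwise_cons] at hl
    by_cases hxa : x ≤ a
    · cases i with
      | zero => simp [hxa]
      | succ i => simpa [hxa] using ih hl.2 (by simpa using hi)
    · have h0 : ∀ y ∈ a :: t, ¬ x ≤ y := by
        intro y hy
        rcases List.mem_cons.1 hy with rfl | hy
        · exact hxa
        · exact fun h => hxa (h.trans (hl.1 y hy))
      have h1 : (a :: t).countP (fun y => decide (x ≤ y)) = 0 := by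
        rw [List.countP_eq_zero]
        intro y hy
        simpa using h0 y hy
      rw [h1]
      simpa using h0 _ (List.getElem_mem hi)

/-- The `j`-th largest value is at least `x` if and only if at least `j` values are. -/
lemma le_ordStat_iff (L : Pair q → ℝ) {j : ℕ} (hj : 1 ≤ j) (hj' : j ≤ Fintype.card (Pair q))
    (x : ℝ) : x ≤ ordStat L j ↔ j ≤ (Finset.univ.filter fun e => x ≤ L e).card := by
  have hlen : (((Finset.univ : Finset (Pair q)).val.map L).sort (· ≥ ·)).length =
      Fintype.card (Pair q) := by
    rw [Multiset.length_sort, Multiset.card_map]; rfl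
  have hi : j - 1 < (((Finset.univ : Finset (Pair q)).val.map L).sort (· ≥ ·)).length := by
    rw [hlen]; omega
  rw [ordStat, List.getD_eq_getElem _ _ hi,
    le_getElem_iff_lt_countP (Multiset.pairwise_sort _ _) hi, ← Multiset.coe_countP,
    Multiset.sort_eq, Multiset.countP_map]
  have : Multiset.card ((Finset.univ : Finset (Pair q)).val.filter fun e => x ≤ L e) =
      (Finset.univ.filter fun e => x ≤ L e).card := rfl
  rw [this]
  omega

lemma ordStat_le_add {L L' : Pair q → ℝ} {τ : ℝ} (h : ∀ e, L e ≤ L' e + τ) {j : ℕ} (hj : 1 ≤ j)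
    (hj' : j ≤ Fintype.card (Pair q)) : ordStat L j ≤ ordStat L' j + τ := by
  rw [← sub_le_iff_le_add, le_ordStat_iff L' hj hj']
  refine ((le_ordStat_iff L hj hj' _).1 le_rfl).trans (Finset.card_le_card fun e he => ?_)
  simp only [Finset.mem_filter, Finset.mem_univ, true_and] at he ⊢
  linarith [h e]

lemma card_pair (q : ℕ) : Fintype.card (Pair q) = q * (q - 1) / 2 := by
  rw [Fintype.card_subtype, Finset.card_filter, Fintype.sum_prod_type_right, ← Finset.sum_range_id,
    ← Fin.sum_univ_eq_sum_range fun i => i]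
  refine Finset.sum_congr rfl fun b _ => ?_
  rw [← Finset.card_filter]
  rw [show Finset.univ.filter (fun a : Fin q => a < b) = Finset.Iio b by ext; simp, Fin.card_Iio]

lemma le_chi (L : Pair q → ℝ) {j : ℕ} (hj : 1 ≤ j) (hjd : j < (edges L).card) :
    ordStat L j / ordStat L (j + 1) ≤ chi L :=
  le_csSup ((Set.finite_Ico 1 (edges L).card).image _).bddAbove
    (Set.mem_image_of_mem (fun j : ℕ => ordStat L j / ordStat L (j + 1)) ⟨hj, hjd⟩)

/-- Exact recovery by the ratio rule: if the estimated values are within `τ` of the true ones, and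
`τ` and the regularization `c` are small compared with the smallest positive value, then the ratio
at the true number `d` of edges exceeds the ratios at all `j < d`, which are controlled by `chi`,
and at all `j > d`, where both values are of the order `τ`. -/
lemma IsRatioGraph.eq_edges {L Lh : Pair q → ℝ} {c τ ε : ℝ} {F : Finset (Pair q)}
    (hF : IsRatioGraph Lh c F) (hLh : ∀ e, 0 ≤ Lh e) (hclose : ∀ e, |Lh e - L e| ≤ τ)
    (hc : 0 < c) (hτ : 0 ≤ τ) (hd0 : 0 < (edges L).card) (hdq : (edges L).card < q * (q - 1) / 2)
    (hε : ∀ e ∈ edges L, ε ≤ L e) (hτε : 2 * τ < ε)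
    (habove : (τ + c) / c < ε / (2 * (τ + c)))
    (hbelow : 2 * chi L + 2 * (τ + c) / ε < ε / (2 * (τ + c))) : F = edges L := by
  set d := (edges L).card with hd
  have hq := card_pair q
  have hε0 : 0 < ε := by linarith
  have hoff : ∀ e ∉ edges L, L e ≤ 0 := fun e he => by
    by_contra hcon
    exact he (by simpa [edges] using hcon)
  have hup : ∀ j, 1 ≤ j → j ≤ Fintype.card (Pair q) → ordStat Lh j ≤ ordStat L j + τ :=
    fun j h1 h2 => ordStat_le_add (fun e => by linarith [(abs_le.1 (hclose e)).2]) h1 h2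
  have hlow : ∀ j, 1 ≤ j → j ≤ Fintype.card (Pair q) → ordStat L j ≤ ordStat Lh j + τ :=
    fun j h1 h2 => ordStat_le_add (fun e => by linarith [(abs_le.1 (hclose e)).1]) h1 h2
  have hnn : ∀ j, 1 ≤ j → j ≤ Fintype.card (Pair q) → 0 ≤ ordStat Lh j := fun j h1 h2 => by
    rw [le_ordStat_iff Lh h1 h2, Finset.filter_true_of_mem fun e _ => hLh e]
    exact h2
  have hLd : ∀ j, 1 ≤ j → j ≤ d → ε ≤ ordStat L j := fun j h1 h2 => by
    rw [le_ordStat_iff L h1 (by omega)]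
    refine h2.trans (Finset.card_le_card fun e he => ?_)
    simpa using hε e he
  have hL0 : ∀ j, d < j → j ≤ Fintype.card (Pair q) → ordStat L j ≤ 0 := fun j h1 h2 => by
    by_contra hcon
    push Not at hcon
    have h3 := (le_ordStat_iff L (by omega) h2 _).1 (le_refl (ordStat L j))
    have h4 : (Finset.univ.filter fun e => ordStat L j ≤ L e).card ≤ d :=
      Finset.card_le_card fun e he => by
        simp only [Finset.mem_filter, Finset.mem_univ, true_and, edges] at he ⊢
        linarith
    omega
  -- the ratio at the true number of edges
  have hratio : ε / (2 * (τ + c)) ≤ (ordStat Lh d + c) / (ordStat Lh (d + 1) + c) := by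
    have h1 := hlow d (by omega) (by omega)
    have h2 := hLd d (by omega) le_rfl
    have h3 := hup (d + 1) (by omega) (by omega)
    have h4 := hL0 (d + 1) (by omega) (by omega)
    have h5 := hnn (d + 1) (by omega) (by omega)
    calc ε / (2 * (τ + c)) = (ε / 2) / (τ + c) := by field_simp
      _ ≤ (ordStat Lh d + c) / (ordStat Lh (d + 1) + c) := by
        gcongr <;> linarith
  have hmax := hF.1.2 d ⟨hd0, hdq⟩
  obtain ⟨hj1, hjq⟩ := hF.1.1
  have hcard : F.card = d := by
    rcases lt_trichotomy F.card d with h | h | h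
    · exfalso
      have h1 := hup F.card hj1 (by omega)
      have h2 := hlow (F.card + 1) (by omega) (by omega)
      have h3 := hLd (F.card + 1) (by omega) (by omega)
      have h4 := hLd F.card hj1 (by omega)
      have h5 := le_chi L hj1 (hd ▸ h)
      have h6 : (ordStat Lh F.card + c) / (ordStat Lh (F.card + 1) + c) ≤
          2 * chi L + 2 * (τ + c) / ε := by
        calc (ordStat Lh F.card + c) / (ordStat Lh (F.card + 1) + c)
            ≤ (ordStat L F.card + (τ + c)) / (ordStat L (F.card + 1) / 2) :=
              div_le_div₀ (by linarith) (by linarith) (by linarith) (by linarith)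
          _ = 2 * (ordStat L F.card / ordStat L (F.card + 1))
              + 2 * (τ + c) / ordStat L (F.card + 1) := by
              have : ordStat L (F.card + 1) ≠ 0 := by linarith
              field_simp
          _ ≤ 2 * chi L + 2 * (τ + c) / ε := by gcongr
      linarith
    · exact h
    · exfalso
      have h1 := hup F.card hj1 (by omega)
      have h2 := hL0 F.card h (by omega)
      have h3 := hnn (F.card + 1) (by omega) (by omega)
      have h6 : (ordStat Lh F.card + c) / (ordStat Lh (F.card + 1) + c) ≤ (τ + c) / c := by
        gcongr <;> linarith
      linarith
  refine Finset.eq_of_subset_of_card_le (fun e he => ?_) (by rw [hcard])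
  by_contra hcon
  have hnsub : ¬ edges L ⊆ F := fun hsub =>
    hcon (by rw [Finset.eq_of_subset_of_card_le hsub hcard.le]; exact he)
  obtain ⟨e', he', hne'⟩ := Finset.not_subset.1 hnsub
  have h1 := hF.2 e he e' hne'
  have h2 := hε e' he'
  have h3 := hoff e hcon
  have h4 := (abs_le.1 (hclose e)).2
  have h5 := (abs_le.1 (hclose e')).1
  linarith

end RatioRule

/-! ### Second moments of the model -/

section Model

variable {Ω : Type*} [MeasurableSpace Ω] {μ : Measure Ω} {p q : ℕ}

lemma integrable_centered_transpose_mul [IsProbabilityMeasure μ]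
    {U V : Ω → Matrix (Fin p) (Fin q) ℝ}
    (hU : ∀ i a, MemLp (fun ω => U ω i a) 2 μ) (hV : ∀ i a, MemLp (fun ω => V ω i a) 2 μ)
    (M N : Matrix (Fin p) (Fin q) ℝ) (a b : Fin q) :
    Integrable (fun ω => ((U ω - M)ᵀ * (V ω - N)) a b) μ := by
  simp only [Matrix.mul_apply, Matrix.transpose_apply, Matrix.sub_apply]
  exact integrable_finsetSum _ fun i _ =>
    ((hU i a).sub (memLp_const _)).integrable_mul ((hV i b).sub (memLp_const _))

lemma meanMat_mul [IsProbabilityMeasure μ] {U : Ω → Matrix (Fin p) (Fin q) ℝ}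
    (hU : ∀ i a, MemLp (fun ω => U ω i a) 2 μ) (B : Matrix (Fin q) (Fin q) ℝ) :
    meanMat μ (fun ω => U ω * B) = meanMat μ U * B := by
  ext i a
  simp only [meanMat, Matrix.of_apply, Matrix.mul_apply]
  rw [integral_finsetSum _ fun b _ => ((hU i b).integrable one_le_two).mul_const _]
  exact Finset.sum_congr rfl fun b _ => integral_mul_const _ _

/-- Transformation of covariance matrices under linear transformations of the columns. -/
lemma covR_mul [IsProbabilityMeasure μ] {U V : Ω → Matrix (Fin p) (Fin q) ℝ}
    (hU : ∀ i a, MemLp (fun ω => U ω i a) 2 μ) (hV : ∀ i a, MemLp (fun ω => V ω i a) 2 μ)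
    (B : Matrix (Fin q) (Fin q) ℝ) :
    covR μ (fun ω => U ω * B) (fun ω => V ω * B) = Bᵀ * covR μ U V * B := by
  ext a b
  have e : ∀ ω, ((U ω * B - meanMat μ U * B)ᵀ * (V ω * B - meanMat μ V * B)) a b =
      ∑ d, ∑ c, B c a * ((U ω - meanMat μ U)ᵀ * (V ω - meanMat μ V)) c d * B d b := fun ω => by
    rw [← Matrix.sub_mul, ← Matrix.sub_mul, Matrix.transpose_mul, Matrix.mul_assoc,
      ← Matrix.mul_assoc _ _ B, ← Matrix.mul_assoc, Matrix.mul_apply]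
    refine Finset.sum_congr rfl fun d _ => ?_
    rw [Matrix.mul_apply, Finset.sum_mul]
    rfl
  have hi := integrable_centered_transpose_mul hU hV (meanMat μ U) (meanMat μ V)
  rw [covR, Matrix.of_apply, meanMat_mul hU, meanMat_mul hV]
  simp only [e]
  rw [integral_finsetSum _ fun d _ => integrable_finsetSum _ fun c _ =>
    ((hi c d).const_mul _).mul_const _, Matrix.mul_apply, Finset.mul_sum]
  refine Finset.sum_congr rfl fun d _ => ?_
  rw [integral_finsetSum _ fun c _ => ((hi c d).const_mul _).mul_const _, Matrix.mul_apply,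
    Finset.mul_sum, Finset.sum_mul]
  refine Finset.sum_congr rfl fun c _ => ?_
  rw [integral_mul_const, integral_const_mul, covR, Matrix.of_apply, Matrix.transpose_apply]
  ring

variable {Y X : ℤ → Ω → Matrix (Fin p) (Fin q) ℝ} {q₁ : ℕ} {A : Matrix (Fin q) (Fin q) ℝ}
  {g : Fin q → Fin q₁}

/-- The transformation matrix is orthogonal. It is invertible because `Y` has nonsingular
covariance, so the latent series is a linear transformation of the observed one, and no
measurability of the latent series is needed. -/
lemma Segmented.orthogonal [IsProbabilityMeasure μ] (h : Segmented μ Y X A g)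
    (hY : ∀ t i a, MemLp (fun ω => Y t ω i a) 2 μ) : Aᵀ * A = 1 := by
  have hdet : Aᵀ.det ≠ 0 := by
    intro h0
    obtain ⟨v, hv, hAv⟩ := Matrix.exists_mulVec_eq_zero_iff.2 h0
    set B : Matrix (Fin q) (Fin q) ℝ := Matrix.of fun b _ => v b with hB
    have hAB : Aᵀ * B = 0 := by
      ext a b
      exact congrFun hAv a
    have h1 := covR_mul (hY 0) (hY 0) B
    have h2 : (fun ω => Y 0 ω * B) = fun _ => 0 := by
      ext1 ω
      rw [h.eq, Matrix.mul_assoc, hAB, Matrix.mul_zero]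
    rw [h.var_Y, h2, Matrix.mul_one] at h1
    have h3 : covR μ (fun _ => (0 : Matrix (Fin p) (Fin q) ℝ)) (fun _ => 0) = 0 := by
      have hm : meanMat μ (fun _ => (0 : Matrix (Fin p) (Fin q) ℝ)) = 0 := by
        ext i a; simp [meanMat]
      ext a b
      simp [covR, hm]
    rw [h3] at h1
    obtain ⟨a, ha⟩ := Function.ne_iff.1 hv
    have h4 := congrFun₂ h1 a a
    have h5 : ∑ b, v b * v b = 0 := by simpa [Matrix.mul_apply, hB] using h4.symm
    exact ha (mul_self_eq_zero.1
      ((Finset.sum_eq_zero_iff_of_nonneg fun b _ => mul_self_nonneg (v b)).1 h5 a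
        (Finset.mem_univ a)))
  have hu : IsUnit Aᵀ.det := isUnit_iff_ne_zero.2 hdet
  have h1 := covR_mul (hY 0) (hY 0) (Aᵀ)⁻¹
  have h2 : (fun ω => Y 0 ω * (Aᵀ)⁻¹) = X 0 := by
    ext1 ω
    rw [h.eq, Matrix.mul_assoc, Matrix.mul_nonsing_inv _ hu, Matrix.mul_one]
  rw [h2, h.var_X, h.var_Y, Matrix.mul_one] at h1
  -- `B = (Aᵀ)⁻¹` satisfies `Bᵀ B = 1`, so `Aᵀ = Bᵀ`
  have h3 : Aᵀ = ((Aᵀ)⁻¹)ᵀ := by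
    calc Aᵀ = (((Aᵀ)⁻¹)ᵀ * (Aᵀ)⁻¹) * Aᵀ := by rw [← h1, Matrix.one_mul]
      _ = _ := by rw [Matrix.mul_assoc, Matrix.nonsing_inv_mul _ hu, Matrix.mul_one]
  have h4 : A = (Aᵀ)⁻¹ := Matrix.transpose_injective h3
  nth_rewrite 2 [h4]
  exact Matrix.mul_nonsing_inv _ hu

lemma Segmented.latent_eq (h : Segmented μ Y X A g) (hA : Aᵀ * A = 1) (t : ℤ) :
    X t = fun ω => Y t ω * A := by
  ext1 ω
  rw [h.eq, Matrix.mul_assoc, hA, Matrix.mul_one]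

lemma Segmented.autocov_latent [IsProbabilityMeasure μ] (h : Segmented μ Y X A g)
    (hY : ∀ t i a, MemLp (fun ω => Y t ω i a) 2 μ) (hA : Aᵀ * A = 1) (k : ℤ) :
    autocov μ X k = Aᵀ * autocov μ Y k * A := by
  rw [autocov, h.latent_eq hA, h.latent_eq hA, covR_mul (hY k) (hY 0)]
  rfl

lemma Segmented.wMat_latent [IsProbabilityMeasure μ] (h : Segmented μ Y X A g)
    (hY : ∀ t i a, MemLp (fun ω => Y t ω i a) 2 μ) (hA : Aᵀ * A = 1) (k₀ : ℕ) :
    wMat μ X k₀ = Aᵀ * wMat μ Y k₀ * A := by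
  rw [wMat, wMat, Matrix.mul_sum, Matrix.sum_mul]
  refine Finset.sum_congr rfl fun k _ => ?_
  rw [h.autocov_latent hY hA, Matrix.transpose_mul, Matrix.transpose_mul,
    Matrix.transpose_transpose]
  have hA' : A * Aᵀ = 1 := mul_eq_one_comm.1 hA
  calc Aᵀ * autocov μ Y k * A * (Aᵀ * ((autocov μ Y k)ᵀ * A))
      = Aᵀ * autocov μ Y k * (A * Aᵀ) * ((autocov μ Y k)ᵀ * A) := by
        simp only [Matrix.mul_assoc]
    _ = _ := by rw [hA', Matrix.mul_one]; simp only [Matrix.mul_assoc]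

lemma Segmented.wMat_latent_eq_zero (h : Segmented μ Y X A g) (k₀ : ℕ) {a b : Fin q}
    (hab : g a ≠ g b) : wMat μ X k₀ a b = 0 := by
  rw [wMat, Matrix.sum_apply]
  refine Finset.sum_eq_zero fun k _ => ?_
  rw [Matrix.mul_apply]
  refine Finset.sum_eq_zero fun c _ => ?_
  by_cases hc : g a = g c
  · rw [Matrix.transpose_apply, autocov, h.uncorrelated k 0 b c (by rw [← hc]; exact hab.symm),
      mul_zero]
  · rw [autocov, h.uncorrelated k 0 a c hc, zero_mul]

lemma spectrum_disjoint_of_eigenGap_pos {W : Matrix (Fin q) (Fin q) ℝ} (hgap : 0 < eigenGap g W)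
    (i j : Fin q₁) (hij : i < j) (l : ℝ) (hl : l ∈ spectrum ℝ (diagBlock g W i)) :
    l ∉ spectrum ℝ (diagBlock g W j) := by
  intro hl'
  have h1 : eigenGap g W ≤ |l - l| := by
    refine csInf_le ⟨0, ?_⟩ ⟨i, j, hij, l, hl, l, hl', rfl⟩
    rintro x ⟨_, _, _, _, _, _, _, rfl⟩
    exact abs_nonneg _
  rw [sub_self, abs_zero] at h1
  exact absurd hgap (not_lt.2 h1)

lemma wMat_transpose (k₀ : ℕ) : (wMat μ Y k₀)ᵀ = wMat μ Y k₀ := by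
  rw [wMat, Matrix.transpose_sum]
  exact Finset.sum_congr rfl fun k _ => by rw [Matrix.transpose_mul, Matrix.transpose_transpose]

/-! ### The matrix `Ŝ` estimates `W` -/

lemma autocov_apply [IsProbabilityMeasure μ]
    (hY : ∀ t i a, MemLp (fun ω => Y t ω i a) 2 μ) (k : ℤ) (a b : Fin q) :
    autocov μ Y k a b = (p : ℝ)⁻¹ * ∑ i, rowAutocov μ Y i i k a b := by
  rw [autocov, covR, Matrix.of_apply]
  congr 1
  simp only [Matrix.mul_apply, Matrix.transpose_apply, Matrix.sub_apply]
  have hi : ∀ i, Integrable (fun ω => (Y k ω i a - meanMat μ (Y k) i a) *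
      (Y 0 ω i b - meanMat μ (Y 0) i b)) μ := fun i =>
    ((hY k i a).sub (memLp_const _)).integrable_mul ((hY 0 i b).sub (memLp_const _))
  rw [integral_finsetSum _ fun i _ => hi i]
  rfl

lemma sampleAutocov_apply {Ω : Type*} (Y : ℤ → Ω → Matrix (Fin p) (Fin q) ℝ) (n k : ℕ)
    (ω : Ω) (a b : Fin q) :
    sampleAutocov Y n k ω a b = (p : ℝ)⁻¹ * ∑ i, sampleRowAutocov Y n i i k ω a b := by
  have hT : (Finset.Icc (1 : ℤ) n).filter (fun t => t + (k : ℤ) ∈ Finset.Icc (1 : ℤ) n) =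
      Finset.Icc (1 : ℤ) (n - k) := by
    ext t
    simp only [Finset.mem_filter, Finset.mem_Icc]
    omega
  simp only [sampleAutocov, sampleRowAutocov, hT, Matrix.smul_apply, Matrix.sum_apply, smul_eq_mul,
    Matrix.mul_apply, Matrix.transpose_apply, Matrix.vecMulVec_apply]
  rw [Finset.sum_comm, ← Finset.mul_sum, mul_inv]
  ring

lemma abs_sampleAutocov_sub_le [IsProbabilityMeasure μ] (hp : 0 < p)
    (hY : ∀ t i a, MemLp (fun ω => Y t ω i a) 2 μ)
    {H k : ℕ} (hk : k ≤ H) (n : ℕ) (ω : Ω) (a b : Fin q) :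
    |sampleAutocov Y n k ω a b - autocov μ Y k a b| ≤ autocovError μ Y H n ω := by
  have hp' : (0 : ℝ) < p := by exact_mod_cast hp
  rw [sampleAutocov_apply, autocov_apply hY, ← mul_sub, ← Finset.sum_sub_distrib, abs_mul,
    abs_of_pos (inv_pos.2 hp'), inv_mul_le_iff₀ hp', ← nsmul_eq_mul]
  refine (Finset.abs_sum_le_sum_abs _ _).trans ?_
  refine (Finset.sum_le_card_nsmul _ _ _ fun i _ =>
    abs_sampleRowAutocov_sub_le (H := H) ?_ n ω i i a b).trans (le_of_eq (by simp))
  rw [Finset.mem_Icc]; omega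

lemma abs_mul_transpose_sub_le {S W : Matrix (Fin q) (Fin q) ℝ} {r B : ℝ} (hr0 : 0 ≤ r)
    (hr : r ≤ 1) (hB : ∀ a b, |W a b| ≤ B) (h : ∀ a b, |S a b - W a b| ≤ r) (a b : Fin q) :
    |(S * Sᵀ) a b - (W * Wᵀ) a b| ≤ q * (2 * B + 1) * r := by
  simp only [Matrix.mul_apply, Matrix.transpose_apply]
  rw [← Finset.sum_sub_distrib]
  calc _ ≤ ∑ _c : Fin q, (2 * B + 1) * r := by
        refine (Finset.abs_sum_le_sum_abs _ _).trans (Finset.sum_le_sum fun c _ => ?_)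
        have hB0 : 0 ≤ B := (abs_nonneg _).trans (hB a c)
        have e : S a c * S b c - W a c * W b c = (S a c - W a c) * (S b c - W b c)
            + (S a c - W a c) * W b c + W a c * (S b c - W b c) := by ring
        have t1 : |(S a c - W a c) * (S b c - W b c)| ≤ r * 1 := by
          rw [abs_mul]; gcongr
          exacts [h a c, (h b c).trans hr]
        have t2 : |(S a c - W a c) * W b c| ≤ r * B := by
          rw [abs_mul]; gcongr
          exacts [h a c, hB b c]
        have t3 : |W a c * (S b c - W b c)| ≤ B * r := by
          rw [abs_mul]; gcongr
          exacts [hB a c, h b c]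
        rw [e]
        exact (abs_add_le _ _).trans ((add_le_add ((abs_add_le _ _).trans (add_le_add t1 t2))
          t3).trans (le_of_eq (by ring)))
    _ = _ := by simp; ring

/-- The summand `k = 0` of `W_y` is the identity, as in `Ŝ`, because `Y` is standardized. -/
lemma exists_abs_sHat_sub_le [IsProbabilityMeasure μ] (hp : 0 < p)
    (hY : ∀ t i a, MemLp (fun ω => Y t ω i a) 2 μ)
    (hvar : covR μ (Y 0) (Y 0) = 1) {H k₀ : ℕ} (hk : k₀ ≤ H) :
    ∃ C : ℝ, 0 ≤ C ∧ ∀ (n : ℕ) (ω : Ω), autocovError μ Y H n ω ≤ 1 → ∀ a b,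
      |sHat Y k₀ n ω a b - wMat μ Y k₀ a b| ≤ C * autocovError μ Y H n ω := by
  choose B hB0 hB using fun k : ℕ => exists_entry_bound (autocov μ Y k)
  refine ⟨∑ k ∈ Finset.Icc 1 k₀, q * (2 * B k + 1),
    Finset.sum_nonneg fun k _ => by have := hB0 k; positivity, fun n ω hR a b => ?_⟩
  have hW : wMat μ Y k₀ = 1 + ∑ k ∈ Finset.Icc 1 k₀, autocov μ Y k * (autocov μ Y k)ᵀ := by
    have h0 : autocov μ Y ((0 : ℕ) : ℤ) = 1 := hvar
    rw [wMat, Finset.range_eq_Ico, Finset.sum_eq_sum_Ico_succ_bot (Nat.succ_pos k₀), h0,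
      Matrix.transpose_one, Matrix.mul_one]
    rfl
  rw [sHat, hW, Matrix.add_apply, Matrix.add_apply, add_sub_add_left_eq_sub, Matrix.sum_apply,
    Matrix.sum_apply, ← Finset.sum_sub_distrib, Finset.sum_mul]
  refine (Finset.abs_sum_le_sum_abs _ _).trans (Finset.sum_le_sum fun k hk' => ?_)
  exact abs_mul_transpose_sub_le (autocovError_nonneg H n ω) hR (hB k)
    (abs_sampleAutocov_sub_le hp hY ((Finset.mem_Icc.1 hk').2.trans hk) n ω) a b

end Model

/-! ### Estimation of the maximum cross correlations -/

section Correlation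

lemma exists_pos_le_of_finite {ι : Type*} [Finite ι] (c : ι → ℝ) (hc : ∀ i, 0 < c i) :
    ∃ c₀ : ℝ, 0 < c₀ ∧ ∀ i, c₀ ≤ c i := by
  rcases isEmpty_or_nonempty ι with h | h
  · exact ⟨1, one_pos, fun i => h.elim i⟩
  · obtain ⟨i, hi⟩ := Finite.exists_min c
    exact ⟨c i, hc i, hi⟩

/-- Lipschitz bound for a ratio `x / √(y z)` whose denominators are bounded away from zero. -/
lemma abs_div_sqrt_sub_le {x x' y y' z z' η c B : ℝ} (hc : 0 < c) (hη : 0 ≤ η) (hηc : η ≤ c / 2)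
    (hx : |x - x'| ≤ η) (hy : |y - y'| ≤ η) (hz : |z - z'| ≤ η) (hy' : c ≤ y') (hz' : c ≤ z')
    (hxB : |x'| ≤ B) (hyB : y' ≤ B) (hzB : z' ≤ B) :
    |x / (√y * √z) - x' / (√y' * √z')| ≤
      (2 / c + B * ((2 * B + c) / c) * (2 / c ^ 2)) * η := by
  have hy1 := abs_le.1 hy
  have hz1 := abs_le.1 hz
  have hyc : c / 2 ≤ y := by linarith
  have hzc : c / 2 ≤ z := by linarith
  have hB : 0 < B := by linarith
  set s := √y * √z with hs
  set s' := √y' * √z' with hs'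
  have hss : s * s = y * z := by
    rw [hs, mul_mul_mul_comm, Real.mul_self_sqrt (by linarith), Real.mul_self_sqrt (by linarith)]
  have hss' : s' * s' = y' * z' := by
    rw [hs', mul_mul_mul_comm, Real.mul_self_sqrt (by linarith), Real.mul_self_sqrt (by linarith)]
  have hs0 : 0 ≤ s := by positivity
  have hs0' : 0 ≤ s' := by positivity
  have hsc : c / 2 ≤ s := by
    refine le_of_sq_le_sq ?_ hs0
    rw [sq, sq, hss]
    exact mul_le_mul hyc hzc (by linarith) (by linarith)
  have hsc' : c ≤ s' := by
    refine le_of_sq_le_sq ?_ hs0'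
    rw [sq, sq, hss']
    exact mul_le_mul hy' hz' (by linarith) (by linarith)
  have hdiff : |s' - s| ≤ (2 * B + c) / c * η := by
    have e : (s' - s) * (s' + s) = (y' - y) * z + y' * (z' - z) := by
      linear_combination hss' - hss
    have h1 : |s' - s| * (s' + s) ≤ η * (B + c) + B * η := by
      have h2 : |s' - s| * (s' + s) = |(y' - y) * z + y' * (z' - z)| := by
        rw [← e, abs_mul, abs_of_nonneg (by linarith : 0 ≤ s' + s)]
      rw [h2]
      refine (abs_add_le _ _).trans (add_le_add ?_ ?_)
      · rw [abs_mul, abs_sub_comm, abs_of_nonneg (by linarith : 0 ≤ z)]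
        exact mul_le_mul hy (by linarith) (by linarith) hη
      · rw [abs_mul, abs_sub_comm, abs_of_nonneg (by linarith : 0 ≤ y')]
        exact mul_le_mul hyB hz (abs_nonneg _) hB.le
    have h3 : |s' - s| * c ≤ |s' - s| * (s' + s) := by
      gcongr; linarith
    rw [div_mul_eq_mul_div, le_div_iff₀ hc]
    linarith
  have hspos : 0 < s := by linarith
  have hspos' : 0 < s' := by linarith
  have e : x / s - x' / s' = (x - x') / s + x' * ((s' - s) / (s * s')) := by
    field_simp; ring
  rw [e]
  have t1 : |(x - x') / s| ≤ η / (c / 2) := by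
    rw [abs_div, abs_of_pos hspos]
    gcongr
  have t2 : |x' * ((s' - s) / (s * s'))| ≤
      B * (((2 * B + c) / c * η) / (c / 2 * c)) := by
    rw [abs_mul, abs_div, abs_of_pos (mul_pos hspos hspos')]
    gcongr
  refine (abs_add_le _ _).trans ((add_le_add t1 t2).trans (le_of_eq ?_))
  field_simp

lemma maxCorr_le_add {p m : ℕ} {G G' : ℤ → Matrix (Fin p) (Fin p) ℝ} {τ : ℝ} (hτ : 0 ≤ τ)
    (h : ∀ h ∈ Finset.Icc (-(m : ℤ)) m, ∀ k l, |G h k l| ≤ |G' h k l| + τ) :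
    maxCorr m G ≤ maxCorr m G' + τ := by
  have h0 : 0 ≤ maxCorr m G' := Real.iSup_nonneg fun _ => abs_nonneg _
  refine Real.iSup_le (fun x => (h x.1 x.1.2 x.2.1 x.2.2).trans ?_) (by positivity)
  gcongr
  exact le_ciSup (f := fun x : (Finset.Icc (-(m : ℤ)) m : Finset ℤ) × Fin p × Fin p =>
    |G' x.1 x.2.1 x.2.2|) (Set.finite_range _).bddAbove x

lemma abs_maxCorr_sub_le {p m : ℕ} {G G' : ℤ → Matrix (Fin p) (Fin p) ℝ} {τ : ℝ} (hτ : 0 ≤ τ)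
    (h : ∀ h ∈ Finset.Icc (-(m : ℤ)) m, ∀ k l, |(|G h k l| - |G' h k l|)| ≤ τ) :
    |maxCorr m G - maxCorr m G'| ≤ τ := by
  have h1 := maxCorr_le_add (G := G) (G' := G') hτ fun a ha k l => by
    linarith [(abs_le.1 (h a ha k l)).2]
  have h2 := maxCorr_le_add (G := G') (G' := G) hτ fun a ha k l => by
    linarith [(abs_le.1 (h a ha k l)).1]
  rw [abs_le]; constructor <;> linarith

variable {Ω : Type*} [MeasurableSpace Ω] {μ : Measure Ω} {p q : ℕ}
  {Y : ℤ → Ω → Matrix (Fin p) (Fin q) ℝ}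

lemma cov_mul_entries [IsProbabilityMeasure μ] (hY : ∀ t i a, MemLp (fun ω => Y t ω i a) 2 μ)
    (hstat : WeaklyStationary μ Y) (V : Matrix (Fin q) (Fin q) ℝ) (i j : Fin q) (k l : Fin p)
    (t h : ℤ) : cov[fun ω => (Y (t + h) ω * V) k i, fun ω => (Y t ω * V) l j; μ] =
      V.col i ⬝ᵥ (rowAutocov μ Y k l h *ᵥ V.col j) := by
  simp only [Matrix.mul_apply]
  rw [covariance_fun_sum_fun_sum (fun a => (hY (t + h) k a).mul_const _)
    (fun b => (hY t l b).mul_const _)]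
  simp only [dotProduct, Matrix.mulVec, Matrix.col_apply, Finset.mul_sum]
  refine Finset.sum_congr rfl fun a _ => Finset.sum_congr rfl fun b _ => ?_
  rw [covariance_mul_const_left, covariance_mul_const_right, hstat.2 t h k l a b, rowAutocov,
    Matrix.of_apply]
  ring

lemma popCorr_apply [IsProbabilityMeasure μ] (hY : ∀ t i a, MemLp (fun ω => Y t ω i a) 2 μ)
    (hstat : WeaklyStationary μ Y) (V : Matrix (Fin q) (Fin q) ℝ) (i j : Fin q) (h : ℤ)
    (k l : Fin p) : popCorr μ Y V i j h k l =
      V.col i ⬝ᵥ (rowAutocov μ Y k l h *ᵥ V.col j) /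
        (√(V.col i ⬝ᵥ (rowAutocov μ Y k k 0 *ᵥ V.col i)) *
          √(V.col j ⬝ᵥ (rowAutocov μ Y l l 0 *ᵥ V.col j))) := by
  have hae : ∀ (t : ℤ) (i : Fin q) (k : Fin p), AEMeasurable (fun ω => (Y t ω * V) k i) μ := by
    intro t i k
    simp only [Matrix.mul_apply]
    exact Finset.aemeasurable_fun_sum _ fun a _ =>
      (hY t k a).aestronglyMeasurable.aemeasurable.mul_const _
  have h1 := cov_mul_entries hY hstat V i j k l 0 h
  have h2 := cov_mul_entries hY hstat V i i k k h 0
  have h3 := cov_mul_entries hY hstat V j j l l 0 0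
  rw [zero_add] at h1 h3
  rw [add_zero] at h2
  rw [popCorr, Matrix.of_apply, ← covariance_self (hae h i k), ← covariance_self (hae 0 j l),
    h1, h2, h3]

/-- The variances of the transformed series are bounded away from zero, uniformly over all unit
eigenvectors of `W`, which form a compact set. -/
lemma exists_pos_le_variance {W : Matrix (Fin q) (Fin q) ℝ} {S : Fin p → Matrix (Fin q) (Fin q) ℝ}
    (hpos : ∀ (v : Fin q → ℝ) (l : ℝ), v ≠ 0 → W *ᵥ v = l • v →
      ∀ k : Fin p, 0 < v ⬝ᵥ (S k *ᵥ v)) :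
    ∃ c : ℝ, 0 < c ∧ ∀ V : Matrix (Fin q) (Fin q) ℝ, IsEigenbasis W V → ∀ i k,
      c ≤ V.col i ⬝ᵥ (S k *ᵥ V.col i) := by
  set K : Set (Fin q → ℝ) := {v | v ⬝ᵥ v = 1 ∧ W *ᵥ v = (v ⬝ᵥ (W *ᵥ v)) • v} with hK
  have hcW : ∀ M : Matrix (Fin q) (Fin q) ℝ, Continuous fun v : Fin q → ℝ => M *ᵥ v := fun M =>
    continuous_const.matrix_mulVec continuous_id
  have hcd : ∀ M : Matrix (Fin q) (Fin q) ℝ, Continuous fun v : Fin q → ℝ => v ⬝ᵥ (M *ᵥ v) :=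
    fun M => continuous_id.dotProduct (hcW M)
  have hKc : IsCompact K := by
    refine Metric.isCompact_of_isClosed_isBounded ?_ ?_
    · exact (isClosed_eq (continuous_id.dotProduct continuous_id) continuous_const).inter
        (isClosed_eq (hcW W) ((hcd W).smul continuous_id))
    · refine Metric.isBounded_closedBall (x := (0 : Fin q → ℝ)) (r := 1) |>.subset fun v hv => ?_
      rw [mem_closedBall_zero_iff, pi_norm_le_iff_of_nonneg zero_le_one]
      intro a
      have h1 : v a * v a ≤ 1 := hv.1 ▸ Finset.single_le_sum (f := fun a => v a * v a)
        (fun a _ => mul_self_nonneg _) (Finset.mem_univ a)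
      exact abs_le_one_iff_mul_self_le_one.2 h1
  have hmem : ∀ V : Matrix (Fin q) (Fin q) ℝ, IsEigenbasis W V → ∀ i, V.col i ∈ K := by
    intro V hV i
    have h1 := sum_col_mul_col hV.1 i i
    rw [if_pos rfl] at h1
    refine ⟨h1, ?_⟩
    rw [← eigenvalueOf_eq_dotProduct]
    exact hV.mulVec_col i
  have hk : ∀ k, ∃ c : ℝ, 0 < c ∧ ∀ v ∈ K, c ≤ v ⬝ᵥ (S k *ᵥ v) := fun k => by
    rcases K.eq_empty_or_nonempty with h | h
    · exact ⟨1, one_pos, fun v hv => by simp [h] at hv⟩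
    · obtain ⟨v, hv, hmin⟩ := hKc.exists_isMinOn h (hcd (S k)).continuousOn
      refine ⟨_, hpos v _ (fun h0 => ?_) hv.2 k, fun w hw => hmin hw⟩
      have := hv.1
      simp [h0] at this
  choose c hc hcle using hk
  obtain ⟨c₀, hc₀, hle⟩ := exists_pos_le_of_finite c hc
  exact ⟨c₀, hc₀, fun V hV i k => (hle k).trans (hcle k _ (hmem V hV i))⟩

lemma abs_dotProduct_mulVec_le {M : Matrix (Fin q) (Fin q) ℝ} {u v : Fin q → ℝ} {B : ℝ}
    (hM : ∀ a b, |M a b| ≤ B) (hu : ∀ a, |u a| ≤ 1) (hv : ∀ a, |v a| ≤ 1) :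
    |u ⬝ᵥ (M *ᵥ v)| ≤ q ^ 2 * B := by
  simp only [dotProduct, Matrix.mulVec, Finset.mul_sum]
  calc _ ≤ ∑ _a : Fin q, ∑ _b : Fin q, B := by
        refine (Finset.abs_sum_le_sum_abs _ _).trans (Finset.sum_le_sum fun a _ =>
          (Finset.abs_sum_le_sum_abs _ _).trans (Finset.sum_le_sum fun b _ => ?_))
        have hB : 0 ≤ B := (abs_nonneg _).trans (hM a b)
        rw [abs_mul, abs_mul]
        calc _ ≤ 1 * (B * 1) := by
              gcongr
              exacts [hu a, hM a b, hv b]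
          _ = B := by ring
    _ = _ := by simp; ring

/-- The sample maximum cross correlations are close to the true ones if the sample autocovariances
are, and if the estimated eigenvectors agree with the true ones up to small errors and signs. The
signs do not matter because of the absolute values. -/
lemma exists_abs_sampleMaxCorr_sub_le [IsProbabilityMeasure μ]
    (hY : ∀ t i a, MemLp (fun ω => Y t ω i a) 2 μ) (hstat : WeaklyStationary μ Y)
    {W : Matrix (Fin q) (Fin q) ℝ}
    (hpos : ∀ (v : Fin q → ℝ) (l : ℝ), v ≠ 0 → W *ᵥ v = l • v →
      ∀ k : Fin p, 0 < v ⬝ᵥ (rowAutocov μ Y k k 0 *ᵥ v)) (m : ℕ) :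
    ∃ C δ : ℝ, 0 ≤ C ∧ 0 < δ ∧ ∀ (n : ℕ) (ω : Ω) (U V : Matrix (Fin q) (Fin q) ℝ) (r : ℝ),
      Uᵀ * U = 1 → IsEigenbasis W V → SignClose U V r → 0 ≤ r → r ≤ δ →
      (∀ h ∈ Finset.Icc (-(m : ℤ)) m, ∀ k l a b,
        |sampleRowAutocov Y n k l h ω a b - rowAutocov μ Y k l h a b| ≤ r) →
      ∀ e, |sampleMaxCorr Y m n U ω e - popMaxCorr μ Y m V e| ≤ C * r := by
  obtain ⟨c, hc, hcle⟩ := exists_pos_le_variance hpos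
  choose B₀ hB₀0 hB₀ using fun x : ℤ × Fin p × Fin p =>
    exists_entry_bound (rowAutocov μ Y x.2.1 x.2.2 x.1)
  set I : Finset (ℤ × Fin p × Fin p) := Finset.Icc (-(m : ℤ)) m ×ˢ Finset.univ with hI
  set B : ℝ := ∑ x ∈ I, B₀ x with hBdef
  have hB0 : 0 ≤ B := Finset.sum_nonneg fun x _ => hB₀0 x
  have hB : ∀ h ∈ Finset.Icc (-(m : ℤ)) m, ∀ k l a b, |rowAutocov μ Y k l h a b| ≤ B := by
    intro h hh k l a b
    refine (hB₀ (h, k, l) a b).trans ?_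
    exact Finset.single_le_sum (f := B₀) (fun x _ => hB₀0 x) (by simpa [hI] using hh)
  set D : ℝ := q ^ 2 * (1 + 2 * B) with hD
  have hD0 : 0 ≤ D := by positivity
  set C : ℝ := 2 / c + q ^ 2 * B * ((2 * (q ^ 2 * B) + c) / c) * (2 / c ^ 2) with hC
  have hC0 : 0 ≤ C := by positivity
  refine ⟨C * D, c / 2 / (D + 1), by positivity, by positivity, ?_⟩
  intro n ω U V r hU hV hUV hr0 hr hcov e
  have hDr : D * r ≤ c / 2 := by
    rw [le_div_iff₀ (by positivity)] at hr
    nlinarith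
  choose s hs hsUV using hUV
  have hs1 : ∀ i, |s i| = 1 := fun i => by rcases hs i with h | h <;> simp [h]
  have hss : ∀ i, s i * s i = 1 := fun i => by rcases hs i with h | h <;> simp [h]
  have hV1 : ∀ i a, |s i * V a i| ≤ 1 := fun i a => by
    rw [abs_mul, hs1, one_mul]; exact abs_entry_le_one hV.1 a i
  -- the bilinear forms are close to those of the columns of `V` with adjusted signs
  have hbil : ∀ i j k l, ∀ h ∈ Finset.Icc (-(m : ℤ)) m,
      |sampleDelta Y n U i j k l h ω -
        s i * s j * (V.col i ⬝ᵥ (rowAutocov μ Y k l h *ᵥ V.col j))| ≤ D * r := by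
    intro i j k l h hh
    have := abs_bilin_sub_le (u := U.col i) (u' := s i • V.col i) (v := U.col j)
      (v' := s j • V.col j) hr0 (hcov h hh k l) (hB h hh k l) (hsUV i) (hsUV j)
      (fun a => abs_entry_le_one hU a i) (hV1 i) (fun a => abs_entry_le_one hU a j)
    rw [Matrix.mulVec_smul, dotProduct_smul, smul_dotProduct, smul_eq_mul, smul_eq_mul] at this
    rw [sampleDelta, show s i * s j * (V.col i ⬝ᵥ (rowAutocov μ Y k l h *ᵥ V.col j)) =
      s j * (s i * (V.col i ⬝ᵥ (rowAutocov μ Y k l h *ᵥ V.col j))) by ring]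
    exact this
  have h0 : (0 : ℤ) ∈ Finset.Icc (-(m : ℤ)) m := by simp
  have hbd : ∀ i j k l, ∀ h ∈ Finset.Icc (-(m : ℤ)) m,
      |V.col i ⬝ᵥ (rowAutocov μ Y k l h *ᵥ V.col j)| ≤ q ^ 2 * B := fun i j k l h hh =>
    abs_dotProduct_mulVec_le (hB h hh k l) (fun a => abs_entry_le_one hV.1 a i)
      (fun a => abs_entry_le_one hV.1 a j)
  have hdiag : ∀ i k, |sampleDelta Y n U i i k k 0 ω -
      V.col i ⬝ᵥ (rowAutocov μ Y k k 0 *ᵥ V.col i)| ≤ D * r := fun i k => by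
    have := hbil i i k k 0 h0
    rwa [hss, one_mul] at this
  refine abs_maxCorr_sub_le (by positivity) fun h hh k l => ?_
  have hx := abs_div_sqrt_sub_le hc (by positivity) hDr (hbil e.1.1 e.1.2 k l h hh)
    (hdiag e.1.1 k) (hdiag e.1.2 l) (hcle V hV _ k) (hcle V hV _ l)
    (B := q ^ 2 * B) (by
      rw [abs_mul, abs_mul, hs1, hs1, one_mul, one_mul]
      exact hbd e.1.1 e.1.2 k l h hh)
    ((le_abs_self _).trans (hbd _ _ k k 0 h0)) ((le_abs_self _).trans (hbd _ _ l l 0 h0))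
  have hpop : |popCorr μ Y V e.1.1 e.1.2 h k l| =
      |s e.1.1 * s e.1.2 * (V.col e.1.1 ⬝ᵥ (rowAutocov μ Y k l h *ᵥ V.col e.1.2)) /
        (√(V.col e.1.1 ⬝ᵥ (rowAutocov μ Y k k 0 *ᵥ V.col e.1.1)) *
          √(V.col e.1.2 ⬝ᵥ (rowAutocov μ Y l l 0 *ᵥ V.col e.1.2)))| := by
    rw [popCorr_apply hY hstat, abs_div, abs_div, abs_mul (s _ * s _), abs_mul (s _), hs1, hs1,
      one_mul, one_mul]
  rw [hpop]
  refine (abs_abs_sub_abs_le _ _).trans ?_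
  rw [mul_assoc C]
  exact hx

end Correlation

/-! ### Consistency of the ratio rule -/

section Consistency

variable {Ω : Type*} [MeasurableSpace Ω] {μ : Measure Ω} {p q : ℕ}

lemma tendsto_sqrt_mul_atTop {ε : ℕ → ℝ} (hε : ∀ n, 0 < ε n)
    (h : Tendsto (fun n : ℕ => n * ε n ^ 2) atTop atTop) :
    Tendsto (fun n : ℕ => √(n : ℝ) * ε n) atTop atTop := by
  refine (Real.tendsto_sqrt_atTop.comp h).congr fun n => ?_
  rw [Function.comp_apply, Real.sqrt_mul (by positivity), Real.sqrt_sq (hε n).le]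

/-- If the estimated maximum cross correlations are within `O_p(n^{-1/2})` of the true ones, the
smallest positive true value is at least `ε n ≫ n^{-1/2}` and `chi` is small compared with
`√n ε n`, then the ratio rule recovers the graph with probability tending to one. -/
lemma withProbTendingToOne_eq_edges {R : ℕ → Ω → ℝ} (hR : IsBigOp μ R fun n => (√(n : ℝ))⁻¹)
    (hR0 : ∀ n ω, 0 ≤ R n ω) {L Lh : ℕ → Ω → Pair q → ℝ} (hLh : ∀ n ω e, 0 ≤ Lh n ω e)
    {C₁ δ : ℝ} (hC₁ : 0 ≤ C₁) (hδ : 0 < δ)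
    (hclose : ∀ n ω, R n ω ≤ δ → ∀ e, |Lh n ω e - L n ω e| ≤ C₁ * R n ω)
    {C : ℝ} (hC : 0 < C) {F : ℕ → Ω → Finset (Pair q)}
    (hF : ∀ n ω, IsRatioGraph (Lh n ω) (C * (√(n : ℝ))⁻¹) (F n ω))
    {ε : ℕ → ℝ} (hε : ∀ n, 0 < ε n) (hεn : Tendsto (fun n : ℕ => n * ε n ^ 2) atTop atTop)
    (hcard : WithProbTendingToOne μ fun n ω =>
      0 < (edges (L n ω)).card ∧ (edges (L n ω)).card < q * (q - 1) / 2)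
    (hmin : WithProbTendingToOne μ fun n ω => ∀ e ∈ edges (L n ω), ε n ≤ L n ω e)
    (hchi : IsLittleOp μ (fun n ω => chi (L n ω) / ε n) fun n => √(n : ℝ)) :
    WithProbTendingToOne μ fun n ω => F n ω = edges (L n ω) := by
  rw [WithProbTendingToOne, ENNReal.tendsto_nhds_zero]
  intro η hη
  have hη4 : 0 < η / 4 := ENNReal.div_pos hη.ne' (by simp)
  obtain ⟨M₀, hM₀⟩ := hR (η / 4) hη4
  set M : ℝ := max M₀ 0 with hM
  have hM0 : 0 ≤ M := le_max_right _ _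
  set C₂ : ℝ := C₁ * M + C with hC₂
  have hC₂pos : 0 < C₂ := by positivity
  -- the threshold for `chi` is chosen so that `2 * chi` is at most half of the ratio at `d`
  set κ : ℝ := 1 / (8 * C₂) with hκ
  have hκpos : 0 < κ := by positivity
  have hy := tendsto_sqrt_mul_atTop hε hεn
  have hcard' := (ENNReal.tendsto_nhds_zero.1 hcard) _ hη4
  have hmin' := (ENNReal.tendsto_nhds_zero.1 hmin) _ hη4
  have hchi' := (ENNReal.tendsto_nhds_zero.1 (hchi κ hκpos)) _ hη4
  have hsmall : ∀ᶠ n : ℕ in atTop, M * (√(n : ℝ))⁻¹ ≤ δ := by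
    have : Tendsto (fun n : ℕ => M * (√(n : ℝ))⁻¹) atTop (𝓝 (M * 0)) :=
      ((Real.tendsto_sqrt_atTop.comp tendsto_natCast_atTop_atTop).inv_tendsto_atTop).const_mul M
    rw [mul_zero] at this
    exact this.eventually (ge_mem_nhds hδ)
  filter_upwards [hM₀, hcard', hmin', hchi', hsmall, eventually_gt_atTop 0,
    hy.eventually_gt_atTop (2 * (C₁ * M)), hy.eventually_gt_atTop (2 * C₂ * (C₂ / C)),
    hy.eventually_gt_atTop (4 * C₂)] with n hn₁ hn₂ hn₃ hn₄ hnδ hn0 hy1 hy2 hy3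
  have hn' : 0 < √(n : ℝ) := Real.sqrt_pos.2 (by exact_mod_cast hn0)
  set y : ℝ := √(n : ℝ) * ε n with hydef
  have hy0 : 0 < y := mul_pos hn' (hε n)
  have hsub : {ω | ¬ F n ω = edges (L n ω)} ⊆
      ({ω | M₀ * (√(n : ℝ))⁻¹ < |R n ω|} ∪
        {ω | ¬ (0 < (edges (L n ω)).card ∧ (edges (L n ω)).card < q * (q - 1) / 2)}) ∪
      ({ω | ¬ ∀ e ∈ edges (L n ω), ε n ≤ L n ω e} ∪
        {ω | κ * √(n : ℝ) < |chi (L n ω) / ε n|}) := by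
    intro ω hω
    by_contra hcon
    simp only [Set.mem_union, Set.mem_ofPred_eq, not_or, not_lt, not_not] at hcon hω
    obtain ⟨⟨h1, h2⟩, h3, h4⟩ := hcon
    rw [abs_of_nonneg (hR0 n ω)] at h1
    have hRM : R n ω ≤ M * (√(n : ℝ))⁻¹ := h1.trans (by gcongr; exact le_max_left _ _)
    have hτ : ∀ e, |Lh n ω e - L n ω e| ≤ C₁ * M * (√(n : ℝ))⁻¹ := fun e =>
      (hclose n ω (hRM.trans hnδ) e).trans (by rw [mul_assoc]; gcongr)
    have hs : C₁ * M * (√(n : ℝ))⁻¹ + C * (√(n : ℝ))⁻¹ = C₂ * (√(n : ℝ))⁻¹ := by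
      rw [hC₂]; ring
    have hratio : ε n / (2 * (C₂ * (√(n : ℝ))⁻¹)) = y / (2 * C₂) := by
      rw [hydef]; field_simp
    refine hω ((hF n ω).eq_edges (hLh n ω) hτ (by positivity) (by positivity) h2.1 h2.2 h3
      ?_ ?_ ?_)
    · rw [← mul_assoc, ← div_eq_mul_inv, div_lt_iff₀ hn', mul_comm (ε n)]
      exact hy1
    · rw [hs, hratio, lt_div_iff₀ (by positivity)]
      calc C₂ * (√(n : ℝ))⁻¹ / (C * (√(n : ℝ))⁻¹) * (2 * C₂) = 2 * C₂ * (C₂ / C) := by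
            field_simp
        _ < y := hy2
    · rw [hs, hratio]
      have h5 : chi (L n ω) ≤ κ * y := by
        have := (le_abs_self _).trans h4
        rw [div_le_iff₀ (hε n)] at this
        rw [hydef, ← mul_assoc]; exact this
      have h6 : 2 * (C₂ * (√(n : ℝ))⁻¹) / ε n = 2 * C₂ / y := by
        rw [hydef]; field_simp
      have h7 : 2 * C₂ / y < y / (4 * C₂) := by
        rw [div_lt_div_iff₀ hy0 (by positivity)]
        nlinarith
      have h8 : 2 * (κ * y) = y / (4 * C₂) := by rw [hκ]; field_simp; norm_num
      have h9 : y / (2 * C₂) = y / (4 * C₂) + y / (4 * C₂) := by field_simp; norm_num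
      rw [h6, h9]
      linarith
  calc μ {ω | ¬ F n ω = edges (L n ω)} ≤ _ := measure_mono hsub
    _ ≤ (η / 4 + η / 4) + (η / 4 + η / 4) :=
      (measure_union_le _ _).trans (add_le_add
        ((measure_union_le _ _).trans (add_le_add hn₁ hn₂))
        ((measure_union_le _ _).trans (add_le_add hn₃ hn₄)))
    _ = η := by
      have h4 : η / 4 + η / 4 = η / 2 := by
        rw [show (4 : ENNReal) = 2 * 2 by norm_num, ENNReal.div_eq_inv_mul,
          ENNReal.mul_inv (by simp) (by simp), mul_assoc, ← ENNReal.div_eq_inv_mul,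
          ← ENNReal.div_eq_inv_mul, ENNReal.add_halves]
      rw [h4, ENNReal.add_halves]

/-- The ratio rule for a fixed graph. -/
lemma withProbTendingToOne_eq_edges_const [IsProbabilityMeasure μ] {R : ℕ → Ω → ℝ}
    (hR : IsBigOp μ R fun n => (√(n : ℝ))⁻¹)
    (hR0 : ∀ n ω, 0 ≤ R n ω) {L : Pair q → ℝ} {Lh : ℕ → Ω → Pair q → ℝ}
    (hLh : ∀ n ω e, 0 ≤ Lh n ω e) {C₁ δ : ℝ} (hC₁ : 0 ≤ C₁) (hδ : 0 < δ)
    (hclose : ∀ n ω, R n ω ≤ δ → ∀ e, |Lh n ω e - L e| ≤ C₁ * R n ω)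
    {C : ℝ} (hC : 0 < C) {F : ℕ → Ω → Finset (Pair q)}
    (hF : ∀ n ω, IsRatioGraph (Lh n ω) (C * (√(n : ℝ))⁻¹) (F n ω))
    (hcard : 0 < (edges L).card) (hcard' : (edges L).card < q * (q - 1) / 2) :
    WithProbTendingToOne μ fun n ω => F n ω = edges L := by
  obtain ⟨ε, hε, hle⟩ := exists_pos_le_of_finite (fun e : edges L => L e.1)
    fun e => (Finset.mem_filter.1 e.2).2
  have hall : ∀ S : ℕ → Ω → Prop, (∀ n ω, S n ω) → WithProbTendingToOne μ S := fun S hS => by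
    simp [WithProbTendingToOne, hS]
  refine withProbTendingToOne_eq_edges (L := fun _ _ => L) hR hR0 hLh hC₁ hδ hclose hC hF
    (ε := fun _ => ε) (fun _ => hε) ?_ (hall _ fun _ _ => ⟨hcard, hcard'⟩)
    (hall _ fun _ _ e he => hle ⟨e, he⟩) ?_
  · exact tendsto_natCast_atTop_atTop.atTop_mul_const (by positivity)
  · intro η hη
    refine tendsto_const_nhds.congr' ?_
    have h1 : Tendsto (fun n : ℕ => η * √(n : ℝ)) atTop atTop :=
      (Real.tendsto_sqrt_atTop.comp tendsto_natCast_atTop_atTop).const_mul_atTop hη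
    filter_upwards [h1.eventually_ge_atTop |chi L / ε|] with n hn
    have : {ω : Ω | η * √(n : ℝ) < |chi L / ε|} = ∅ := by
      ext ω; simpa using hn
    rw [this, measure_empty]

end Consistency

/-! ### Rates for the sample eigenvectors -/

section Assembly

variable {Ω : Type*} [MeasurableSpace Ω] {μ : Measure Ω} {p q q₁ : ℕ}
  {Y X : ℤ → Ω → Matrix (Fin p) (Fin q) ℝ} {A : Matrix (Fin q) (Fin q) ℝ} {g : Fin q → Fin q₁}

lemma SignClose.mono {U V : Matrix (Fin q) (Fin q) ℝ} {ε ε' : ℝ} (h : SignClose U V ε)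
    (hε : ε ≤ ε') : SignClose U V ε' := fun i =>
  let ⟨s, hs, hsa⟩ := h i
  ⟨s, hs, fun a => (hsa a).trans hε⟩

/-- For `p = 0` the junk value `(0 : ℝ)⁻¹ = 0` makes `covR` vanish. -/
lemma pos_of_covR_eq_one (hq : 0 < q) (h : covR μ (Y 0) (Y 0) = 1) : 0 < p := by
  rcases Nat.eq_zero_or_pos p with rfl | hp
  · have := congrFun₂ h ⟨0, hq⟩ ⟨0, hq⟩
    simp [covR] at this
  · exact hp

lemma sampleMaxCorr_nonneg {Ω : Type*} (Y : ℤ → Ω → Matrix (Fin p) (Fin q) ℝ) (m n : ℕ)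
    (V : Matrix (Fin q) (Fin q) ℝ) (ω : Ω) (e : Pair q) : 0 ≤ sampleMaxCorr Y m n V ω e :=
  Real.iSup_nonneg fun _ => abs_nonneg _

/-- Eigenvector matrices of `Ŝ` are close to eigenvector matrices of `W_y`, with a distance
proportional to the estimation error of the autocovariances. -/
lemma exists_isEigenbasis_wMat_near [IsProbabilityMeasure μ]
    (hp : 0 < p)
    (hY : ∀ t i a, MemLp (fun ω => Y t ω i a) 2 μ) (hvar : covR μ (Y 0) (Y 0) = 1) {H k₀ : ℕ}
    (hk : k₀ ≤ H) : ∃ C δ : ℝ, 0 ≤ C ∧ 0 < δ ∧ ∀ n ω V, IsEigenbasis (sHat Y k₀ n ω) V →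
      autocovError μ Y H n ω ≤ δ →
      ∃ V', IsEigenbasis (wMat μ Y k₀) V' ∧
        ∀ a i, |V a i - V' a i| ≤ C * autocovError μ Y H n ω := by
  obtain ⟨C₁, hC₁, h₁⟩ := exists_abs_sHat_sub_le hp hY hvar hk
  obtain ⟨C₂, δ, hC₂, hδ, h₂⟩ := exists_isEigenbasis_near (wMat_transpose (μ := μ) (Y := Y) k₀)
  refine ⟨C₂ * C₁, min 1 (δ / (C₁ + 1)), by positivity, by positivity, fun n ω V hV hR => ?_⟩
  have hR0 := autocovError_nonneg (μ := μ) (Y := Y) H n ω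
  have hRδ : C₁ * autocovError μ Y H n ω ≤ δ := by
    have := hR.trans (min_le_right _ _)
    rw [le_div_iff₀ (by positivity)] at this
    nlinarith
  rw [mul_assoc]
  exact h₂ _ V _ hV (by positivity) hRδ (h₁ n ω (hR.trans (min_le_left _ _)))

/-- The analogue of `exists_isEigenbasis_wMat_near` for distinct, ordered eigenvalues, with a fixed
eigenvector matrix of `W_y`. -/
lemma exists_signClose_wMat [IsProbabilityMeasure μ]
    (hp : 0 < p)
    (hY : ∀ t i a, MemLp (fun ω => Y t ω i a) 2 μ) (hvar : covR μ (Y 0) (Y 0) = 1) {H k₀ : ℕ}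
    (hk : k₀ ≤ H) {U : Matrix (Fin q) (Fin q) ℝ} (hU : IsEigenbasis (wMat μ Y k₀) U)
    (hanti : StrictAnti (eigenvalueOf (wMat μ Y k₀) U)) :
    ∃ C δ : ℝ, 0 ≤ C ∧ 0 < δ ∧ ∀ n ω V, IsEigenbasis (sHat Y k₀ n ω) V →
      Antitone (eigenvalueOf (sHat Y k₀ n ω) V) → autocovError μ Y H n ω ≤ δ →
      SignClose V U (C * autocovError μ Y H n ω) := by
  obtain ⟨C₁, hC₁, h₁⟩ := exists_abs_sHat_sub_le hp hY hvar hk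
  obtain ⟨C₂, δ, hC₂, hδ, h₂⟩ := exists_signClose_of_strictAnti
    (wMat_transpose (μ := μ) (Y := Y) k₀) hU hanti
  refine ⟨C₂ * C₁, min 1 (δ / (C₁ + 1)), by positivity, by positivity, fun n ω V hV hVa hR => ?_⟩
  have hR0 := autocovError_nonneg (μ := μ) (Y := Y) H n ω
  have hRδ : C₁ * autocovError μ Y H n ω ≤ δ := by
    have := hR.trans (min_le_right _ _)
    rw [le_div_iff₀ (by positivity)] at this
    nlinarith
  rw [mul_assoc]
  exact h₂ _ V _ hV hVa (by positivity) hRδ (h₁ n ω (hR.trans (min_le_left _ _)))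

/-- Eigenvectors that are accurate up to signs give accurate maximum cross correlations. -/
lemma exists_abs_sampleMaxCorr_sub_le_autocovError [IsProbabilityMeasure μ]
    (hY : ∀ t i a, MemLp (fun ω => Y t ω i a) 2 μ) (hstat : WeaklyStationary μ Y)
    {W : Matrix (Fin q) (Fin q) ℝ}
    (hpos : ∀ (v : Fin q → ℝ) (l : ℝ), v ≠ 0 → W *ᵥ v = l • v →
      ∀ k : Fin p, 0 < v ⬝ᵥ (rowAutocov μ Y k k 0 *ᵥ v)) {m H : ℕ} (hm : m ≤ H) {K : ℝ}
    (hK : 0 ≤ K) :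
    ∃ C δ : ℝ, 0 ≤ C ∧ 0 < δ ∧ ∀ n ω U V, Uᵀ * U = 1 → IsEigenbasis W V →
      autocovError μ Y H n ω ≤ δ → SignClose U V (K * autocovError μ Y H n ω) →
      ∀ e, |sampleMaxCorr Y m n U ω e - popMaxCorr μ Y m V e| ≤ C * autocovError μ Y H n ω := by
  obtain ⟨C, δ, hC, hδ, h⟩ := exists_abs_sampleMaxCorr_sub_le hY hstat hpos m
  refine ⟨C * (K + 1), δ / (K + 1), by positivity, by positivity, fun n ω U V hU hV hR hUV => ?_⟩
  have hR0 := autocovError_nonneg (μ := μ) (Y := Y) H n ω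
  rw [le_div_iff₀ (by positivity), mul_comm] at hR
  rw [mul_assoc]
  refine h n ω U V _ hU hV (hUV.mono (by nlinarith)) (by positivity) hR fun h hh k l a b => ?_
  refine (abs_sampleRowAutocov_sub_le (H := H) ?_ n ω k l a b).trans (by nlinarith)
  rw [Finset.mem_Icc] at hh ⊢
  omega

/-- The sample eigenvectors can be grouped so that the column spaces of the groups are close to
those of the column groups of `A`. -/
lemma exists_perm_spaceDist_le [IsProbabilityMeasure μ]
    (hg : Function.Surjective g) (hp : 0 < p)
    (hY : ∀ t i a, MemLp (fun ω => Y t ω i a) 2 μ) (hmodel : Segmented μ Y X A g) {H k₀ : ℕ}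
    (hk : k₀ ≤ H) (hgap : 0 < eigenGap g (wMat μ X k₀)) :
    ∃ C δ : ℝ, 0 ≤ C ∧ 0 < δ ∧ ∀ n ω V, IsEigenbasis (sHat Y k₀ n ω) V →
      autocovError μ Y H n ω ≤ δ → ∃ π : Equiv.Perm (Fin q), ∀ j,
        spaceDist (colBlock g (V.submatrix id π) j) (colBlock g A j) ≤
          C * autocovError μ Y H n ω := by
  have hA := hmodel.orthogonal hY
  obtain ⟨C, δ, hC, hδ, h⟩ := exists_isEigenbasis_wMat_near hp hY hmodel.var_Y hk
  refine ⟨q * (q * C), δ, by positivity, hδ, fun n ω V hV hR => ?_⟩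
  have hR0 := autocovError_nonneg (μ := μ) (Y := Y) H n ω
  obtain ⟨V', hV', hVV'⟩ := h n ω V hV hR
  have hWx := hmodel.wMat_latent hY hA k₀
  obtain ⟨π, hπ⟩ := exists_perm_of_blockDiagonal (g := g) hA
    (fun a b hab => by rw [← hWx]; exact hmodel.wMat_latent_eq_zero k₀ hab)
    (fun i j hij l hl => by
      rw [← hWx] at hl ⊢
      exact spectrum_disjoint_of_eigenGap_pos hgap i j hij l hl) hV'
  have hU : (V.submatrix id π)ᵀ * V.submatrix id π = 1 := by
    ext i j
    have := sum_col_mul_col hV.1 (π i) (π j)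
    simpa [Matrix.mul_apply, Matrix.one_apply] using this
  refine ⟨π, fun j => ?_⟩
  rw [mul_assoc, mul_assoc]
  refine spaceDist_colBlock_le hg hU hA (by positivity) (fun a b hab => ?_) j
  have e : (Aᵀ * V.submatrix id π) b a = ∑ c, A c b * (V c (π a) - V' c (π a)) := by
    have h0 := hπ a b hab
    rw [Matrix.mul_apply] at h0
    rw [Matrix.mul_apply, ← sub_zero (∑ c, _), ← h0, ← Finset.sum_sub_distrib]
    exact Finset.sum_congr rfl fun c _ => by simp [mul_sub]
  rw [e]
  calc _ ≤ ∑ _c : Fin q, C * autocovError μ Y H n ω := by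
        refine (Finset.abs_sum_le_sum_abs _ _).trans (Finset.sum_le_sum fun c _ => ?_)
        rw [abs_mul, ← one_mul (C * _)]
        exact mul_le_mul (abs_entry_le_one hA c b) (hVV' c (π a)) (abs_nonneg _) zero_le_one
    _ = _ := by simp

end Assembly

end MatSeg

end

theorem theorem1
    {Ω : Type*} [MeasurableSpace Ω] (μ : Measure Ω) [IsProbabilityMeasure μ]
    {p q q₁ : ℕ} (hq₁ : 1 < q₁) (k₀ m : ℕ)
    -- the observed series, the latent series, the transformation and the column groups
    (Y X : ℤ → Ω → Matrix (Fin p) (Fin q) ℝ) (A : Matrix (Fin q) (Fin q) ℝ)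
    (g : Fin q → Fin q₁) (hg : Function.Surjective g)
    (hmeas : ∀ t i a, Measurable fun ω => Y t ω i a)
    (hstat : WeaklyStationary μ Y)
    (hmodel : Segmented μ Y X A g)
    -- moments of order `2γ`, `γ > 2`, and summable mixing coefficients
    (γ K₁ : ℝ) (hγ : 2 < γ) (hmom : MomentBound μ Y γ K₁)
    (hmix : Summable fun k : ℕ => alphaMix μ Y (k + 1) ^ (1 - 2 / γ))
    -- the eigenvalue gap between the blocks of `W_x`
    (hgap : 0 < eigenGap g (wMat μ X k₀))
    -- orthonormal eigenvectors of `Ŝ`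
    (Γhat : ℕ → Ω → Matrix (Fin q) (Fin q) ℝ)
    (hΓhat : ∀ n ω, IsEigenbasis (sHat Y k₀ n ω) (Γhat n ω)) :
    -- (i) the ratio-based rule recovers the connection graph
    ((∀ (v : Fin q → ℝ) (l : ℝ), v ≠ 0 → wMat μ Y k₀ *ᵥ v = l • v →
        ∀ k : Fin p, 0 < v ⬝ᵥ (rowAutocov μ Y k k 0 *ᵥ v)) →
      ∀ C : ℝ, 0 < C →
      ∀ Ehat : ℕ → Ω → Finset (Pair q),
        (∀ n ω, IsRatioGraph (sampleMaxCorr Y m n (Γhat n ω) ω) (C * (√n)⁻¹) (Ehat n ω)) →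
      -- reference eigenvectors of `W_y` matched with those of `Ŝ`
      (∀ Γ : ℕ → Ω → Matrix (Fin q) (Fin q) ℝ,
        (∀ n ω, IsClosestEigenbasis (wMat μ Y k₀) (Γhat n ω) (Γ n ω)) →
        ∀ ε : ℕ → ℝ, (∀ n, 0 < ε n) →
        Tendsto (fun n : ℕ => n * ε n ^ 2) atTop atTop →
        WithProbTendingToOne μ (fun n ω =>
          0 < (edges (popMaxCorr μ Y m (Γ n ω))).card ∧
          (edges (popMaxCorr μ Y m (Γ n ω))).card < q * (q - 1) / 2) →
        WithProbTendingToOne μ (fun n ω =>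
          ∀ e ∈ edges (popMaxCorr μ Y m (Γ n ω)), ε n ≤ popMaxCorr μ Y m (Γ n ω) e) →
        IsLittleOp μ (fun n ω => chi (popMaxCorr μ Y m (Γ n ω)) / ε n) (fun n => √n) →
        WithProbTendingToOne μ (fun n ω => Ehat n ω = edges (popMaxCorr μ Y m (Γ n ω)))) ∧
      -- nonrandom graph when the eigenvalues of `W_y` are distinct
      (∀ Γy : Matrix (Fin q) (Fin q) ℝ, IsEigenbasis (wMat μ Y k₀) Γy →
        StrictAnti (eigenvalueOf (wMat μ Y k₀) Γy) →
        (∀ n ω, Antitone (eigenvalueOf (sHat Y k₀ n ω) (Γhat n ω))) →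
        0 < (edges (popMaxCorr μ Y m Γy)).card →
        (edges (popMaxCorr μ Y m Γy)).card < q * (q - 1) / 2 →
        WithProbTendingToOne μ (fun n ω => Ehat n ω = edges (popMaxCorr μ Y m Γy)))) ∧
    -- (ii) the column spaces are estimated at rate `n^{-1/2}`
    (∃ π : ℕ → Ω → Equiv.Perm (Fin q),
      IsBigOp μ
        (fun n ω => ⨆ j : Fin q₁,
          spaceDist (colBlock g ((Γhat n ω).submatrix id (π n ω)) j) (colBlock g A j))
        (fun n => (√n)⁻¹)) := by
  have hY : ∀ t i a, MemLp (fun ω => Y t ω i a) 2 μ := hmom.memLp_two hγ hmeas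
  have hq : 0 < q := Fin.pos (hg ⟨0, by omega⟩).choose
  have hp : 0 < p := pos_of_covR_eq_one hq hmodel.var_Y
  set H : ℕ := max m k₀ with hH
  have hR := isBigOp_autocovError hγ hmeas hstat hmom hmix H
  have hR0 := autocovError_nonneg (μ := μ) (Y := Y) H
  refine ⟨fun hpos C hC Ehat hEhat => ⟨fun Γ hΓ ε hε hεn hcard hmin hchi => ?_,
    fun Γy hΓy hanti hanti' hcard hcard' => ?_⟩, ?_⟩
  · obtain ⟨C₁, δ₁, hC₁, hδ₁, h₁⟩ := exists_isEigenbasis_wMat_near hp hY hmodel.var_Y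
      (le_max_right m k₀)
    obtain ⟨C₂, δ₂, hC₂, hδ₂, h₂⟩ := exists_abs_sampleMaxCorr_sub_le_autocovError hY hstat hpos
      (le_max_left m k₀) (by positivity : 0 ≤ q * C₁)
    refine withProbTendingToOne_eq_edges hR hR0
      (fun n ω e => sampleMaxCorr_nonneg Y m n (Γhat n ω) ω e) hC₂ (lt_min hδ₁ hδ₂)
      (fun n ω hle e => ?_) hC hEhat hε hεn hcard hmin hchi
    obtain ⟨V', hV', hVV'⟩ := h₁ n ω _ (hΓhat n ω) (hle.trans (min_le_left _ _))
    refine h₂ n ω _ _ (hΓhat n ω).1 (hΓ n ω).1 (hle.trans (min_le_right _ _)) ?_ e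
    rw [mul_assoc]
    exact (hΓ n ω).signClose (hΓhat n ω).1 hV' (mul_nonneg hC₁ (hR0 n ω)) hVV'
  · obtain ⟨C₁, δ₁, hC₁, hδ₁, h₁⟩ := exists_signClose_wMat hp hY hmodel.var_Y
      (le_max_right m k₀) hΓy hanti
    obtain ⟨C₂, δ₂, hC₂, hδ₂, h₂⟩ := exists_abs_sampleMaxCorr_sub_le_autocovError hY hstat hpos
      (le_max_left m k₀) hC₁
    refine withProbTendingToOne_eq_edges_const hR hR0
      (fun n ω e => sampleMaxCorr_nonneg Y m n (Γhat n ω) ω e) hC₂ (lt_min hδ₁ hδ₂)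
      (fun n ω hle e => ?_) hC hEhat hcard hcard'
    exact h₂ n ω _ _ (hΓhat n ω).1 hΓy (hle.trans (min_le_right _ _))
      (h₁ n ω _ (hΓhat n ω) (hanti' n ω) (hle.trans (min_le_left _ _))) e
  · obtain ⟨C, δ, hC, hδ, h⟩ := exists_perm_spaceDist_le hg hp hY hmodel (le_max_right m k₀) hgap
    choose π hπ using fun n ω => show ∃ π : Equiv.Perm (Fin q), autocovError μ Y H n ω ≤ δ →
        ∀ j, spaceDist (colBlock g ((Γhat n ω).submatrix id π) j) (colBlock g A j) ≤
          C * autocovError μ Y H n ω by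
      by_cases hle : autocovError μ Y H n ω ≤ δ
      · obtain ⟨π, hπ⟩ := h n ω _ (hΓhat n ω) hle
        exact ⟨π, fun _ => hπ⟩
      · exact ⟨1, fun h => absurd h hle⟩
    refine ⟨π, fun η hη => ?_⟩
    obtain ⟨M, hM⟩ := hR η hη
    refine ⟨C * M, ?_⟩
    have hsmall : ∀ᶠ n : ℕ in atTop, M * (√(n : ℝ))⁻¹ ≤ δ := by
      have : Tendsto (fun n : ℕ => M * (√(n : ℝ))⁻¹) atTop (𝓝 (M * 0)) :=
        ((Real.tendsto_sqrt_atTop.comp tendsto_natCast_atTop_atTop).inv_tendsto_atTop).const_mul M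
      rw [mul_zero] at this
      exact this.eventually (ge_mem_nhds hδ)
    filter_upwards [hM, hsmall] with n hn hnδ
    refine (measure_mono fun ω hω => ?_).trans hn
    simp only [Set.mem_ofPred_eq] at hω ⊢
    by_contra hcon
    push Not at hcon
    rw [abs_of_nonneg (hR0 n ω)] at hcon
    have hne : Nonempty (Fin q₁) := ⟨⟨0, by omega⟩⟩
    have h1 : ⨆ j, spaceDist (colBlock g ((Γhat n ω).submatrix id (π n ω)) j) (colBlock g A j) ≤
        C * autocovError μ Y H n ω := ciSup_le (hπ n ω (hcon.trans hnδ))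
    have h0 : 0 ≤ ⨆ j, spaceDist (colBlock g ((Γhat n ω).submatrix id (π n ω)) j)
        (colBlock g A j) := Real.iSup_nonneg fun _ => Real.sqrt_nonneg _
    rw [abs_of_nonneg h0] at hω
    have h2 := mul_le_mul_of_nonneg_left hcon hC
    linarith
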